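/- **Setting.** Let $Z=(Z_0\sqcup\bigsqcup_{\lambda\in\Lambda}[0,1])/\phi$ be a finite one-dimensional CW complex with a fixed CW structure $Z^*=(Z,Z_0,\{\Phi_\lambda\}_{\lambda\in\Lambda})$: $Z_0$ and $\Lambda$ are finite, $Z_0$ is discrete, $\phi$ maps the endpoints of the intervals to $Z_0$, and $\Phi_\lambda:[0,1]\to Z$ is the $\lambda$-th characteristic map. Let $d\ge 0$ and $2\le r\le\infty$. Let $\mathcal F^r(Z^*,d)$ be the set of maps $f:Z\to\mathbb R^d$ such that every $f\circ\Phi_\lambda$ is $C^r$ on $[0,1]$, let $\mathcal E^r(Z^*,d)\subseteq\mathcal F^r(Z^*,d)$ be the set of those that are homeomorphisms onto their images, and let $\mathcal G^r(Z^*,d)$ be the set of images of maps in $\mathcal E^r(Z^*,d)$. A map $f\in\mathcal F^r(Z^*,d)$ has *curvature bounded by $M$* if every curve $\gamma=f\circ\Phi_\lambda$ is regular ($\gamma'\neq0$ on $[0,1]$) and its curvature $\sqrt{\|\gamma'\|^2\|\gamma''\|^2-\langle\gamma',\gamma''\rangle^2}\,/\,\|\gamma'\|^3$ is at most $M$ on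 $[0,1]$. A set $X\in\mathcal G^r(Z^*,d)$ has curvature bounded by $M$ if it is the image of some $h\in\mathcal E^r(Z^*,d)$ with curvature bounded by $M$. Call $f,g\in\mathcal F^r(Z^*,d)$ *$\epsilon$-close* if (1) for each $\lambda$ the arc lengths of $f\circ\Phi_\lambda$ and $g\circ\Phi_\lambda$ differ by at most $\epsilon$; (2) for each $\lambda$ both $f\circ\Phi_\lambda$ and $g\circ\Phi_\lambda$ have constant speed; (3) $\|f-g\|_\infty\le\epsilon$. For $X,Y\in\mathcal G^r(Z^*,d)$, an *$\epsilon$-matching* is an $\epsilon$-close pair $h_X,h_Y\in\mathcal E^r(Z^*,d)$ with images $X$ and $Y$, and $d_{Z^*}(X,Y)\in[0,\infty]$ is the infimum of all $\epsilon\ge0$ for which an $\epsilon$-matching exists ($\inf\emptyset=\infty$). For $v\in S^{d-1}$ and $t\in\mathbb R$ put $\mathrm{ECT}_X(v,t)=\chi(\{x\in X:\langle x,v\rangle\le t\})$ and $\mathrm{ECT}_f(v,t)=\chi(\{z\in Z:\langle f(z),v\rangle\le t\})$, where $\chi=\sum_k(-1)^k\operatorname{rank}H_k(\,\cdot\,;\mathbb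 Z)$ is the Euler characteristic in singular homology, set to $\infty$ if the homology is not finitely generated; a difference involving $\infty$ is $\infty$. Put $$\|\mathrm{ECT}_X-\mathrm{ECT}_Y\|=\sup_{v\in S^{d-1}}\int_{\mathbb R}|\mathrm{ECT}_X(v,t)-\mathrm{ECT}_Y(v,t)|\,dt,$$ and similarly for $\mathrm{ECT}_f$ and $\mathrm{ECT}_g$. For $M,\epsilon>0$ and $L_\lambda>0$ let $$n_\lambda=\max\left(\left\lceil\left(\frac{M^2L_\lambda^3}{24\epsilon}\right)^{1/3}\right\rceil,\left\lceil\frac{L_\lambda M}{\pi}\right\rceil\right),\qquad G_\lambda(\epsilon)=\begin{cases}8\sqrt{L_\lambda n_\lambda\epsilon}+n_\lambda\epsilon & L_\lambda/n_\lambda>2\epsilon\\ 11n_\lambda\epsilon & L_\lambda/n_\lambda\le2\epsilon.\end{cases}$$ **Theorem.** 1. The map $X\mapsto\mathrm{ECT}_X$ is continuous on $\mathcal G^r(Z^*,d)$: for every $X\in\mathcal G^r(Z^*,d)$ and every $\eta>0$ there is $\delta>0$ such that $\|\mathrm{ECT}_X-\mathrm{ECT}_Y\|<\eta$ for all $Y\in\mathcal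 G^r(Z^*,d)$ with $d_{Z^*}(X,Y)<\delta$. 2. Let $X,Y\in\mathcal G^r(Z^*,d)$, let $M>0$, let $X$ have curvature bounded by $M$, and let $d_{Z^*}(X,Y)<\epsilon$. Then an $\epsilon$-matching of $X$ and $Y$ exists, and for every $\epsilon$-matching $(h_X,h_Y)$, with $L_\lambda$ the arc length of $h_X\circ\Phi_\lambda$, $$\|\mathrm{ECT}_X-\mathrm{ECT}_Y\|\le|Z_0|\,\epsilon+\sum_{\lambda\in\Lambda}G_\lambda(\epsilon).$$ 3. Let $M,\epsilon>0$ and let $f,g\in\mathcal F^r(Z^*,d)$ be $\epsilon$-close, where $f$ has curvature bounded by $M$. Then, with $L_\lambda$ the arc length of $f\circ\Phi_\lambda$, $$\|\mathrm{ECT}_f-\mathrm{ECT}_g\|\le|Z_0|\,\epsilon+\sum_{\lambda\in\Lambda}G_\lambda(\epsilon).$$ In each case the functions of $t$ that are integrated are Lebesgue measurable. -/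

import Mathlib

open MeasureTheory
open scoped ENNReal NNReal

noncomputable section

/-! ### Euler characteristic and Euler characteristic transforms -/

/-- The integral singular chain complex of a topological space. -/
def singularChains (X : Type) [TopologicalSpace X] : ChainComplex (ModuleCat.{0} ℤ) ℕ :=
  ((AlgebraicTopology.singularChainComplexFunctor (ModuleCat.{0} ℤ)).obj
    (ModuleCat.of ℤ ℤ)).obj (TopCat.of X)

/-- The total integral singular homology of `X` is finitely generated: every homology group is
finitely generated and all but finitely many of them vanish. -/
def HasFGHomology (X : Type) [TopologicalSpace X] : Prop :=
  (∀ k, Module.Finite ℤ ((singularChains X).homology k)) ∧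
    ∃ N, ∀ k, N ≤ k → Subsingleton ((singularChains X).homology k)

open Classical in
/-- The Euler characteristic `∑ k, (-1) ^ k * rank H_k(X; ℤ)`; it takes the value `⊤`, standing
for "not well defined", if the homology of `X` is not finitely generated. -/
def eulerCharacteristic (X : Type) [TopologicalSpace X] : WithTop ℤ :=
  if HasFGHomology X then ((singularChains X).homologyEulerChar : ℤ) else ⊤

/-- The unit sphere of directions in Euclidean space of dimension `d`. -/
abbrev Direction (d : ℕ) : Type := Metric.sphere (0 : EuclideanSpace ℝ (Fin d)) 1

/-- The Euler characteristic transform of a map `f : Z → ℝ^d`: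
`(v, t) ↦ χ(f ⁻¹ {x | ⟨x, v⟩ ≤ t})`. -/
def mapECT {Z : Type} [TopologicalSpace Z] {d : ℕ} (f : Z → EuclideanSpace ℝ (Fin d))
    (v : Direction d) (t : ℝ) : WithTop ℤ :=
  eulerCharacteristic {z : Z // inner ℝ (f z) (v : EuclideanSpace ℝ (Fin d)) ≤ t}

/-- The Euler characteristic transform of a subset `X ⊆ ℝ^d`:
`(v, t) ↦ χ({x ∈ X | ⟨x, v⟩ ≤ t})`. -/
def setECT {d : ℕ} (X : Set (EuclideanSpace ℝ (Fin d)))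
    (v : Direction d) (t : ℝ) : WithTop ℤ :=
  eulerCharacteristic {x : EuclideanSpace ℝ (Fin d) //
    x ∈ X ∧ inner ℝ x (v : EuclideanSpace ℝ (Fin d)) ≤ t}

/-- `|m - n|` for Euler characteristics, with the convention that the difference is infinite as
soon as one of the two is undefined. -/
def absDiff : WithTop ℤ → WithTop ℤ → ℝ≥0∞
  | some m, some n => ENNReal.ofReal |(m : ℝ) - (n : ℝ)|
  | _, _ => ⊤

/-- `‖E₁ - E₂‖ = sup_v ∫ |E₁(v,t) - E₂(v,t)| dt`. The integral is over all of `ℝ`. If `E₁`, `E₂`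
are the transforms of two maps on the same compact space that are bounded by `a`, the integrand
vanishes for `t < -a` and for `a ≤ t` wherever it is defined there, so that the integral over
`[-a, a]` has the same value. -/
def ectDist {d : ℕ} (E₁ E₂ : Direction d → ℝ → WithTop ℤ) : ℝ≥0∞ :=
  ⨆ v, ∫⁻ t, absDiff (E₁ v t) (E₂ v t)

/-- All the integrands in `ectDist E₁ E₂` are (Lebesgue) measurable. -/
def ECTDiffMeasurable {d : ℕ} (E₁ E₂ : Direction d → ℝ → WithTop ℤ) : Prop :=
  ∀ v, AEMeasurable (fun t => absDiff (E₁ v t) (E₂ v t)) volume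

/-! ### Curves on the unit interval -/

/-- The velocity of a curve on `[0,1]` (one-sided at the endpoints). -/
def velocity {d : ℕ} (γ : ℝ → EuclideanSpace ℝ (Fin d)) : ℝ → EuclideanSpace ℝ (Fin d) :=
  derivWithin γ (Set.Icc 0 1)

/-- The acceleration of a curve on `[0,1]` (one-sided at the endpoints). -/
def acceleration {d : ℕ} (γ : ℝ → EuclideanSpace ℝ (Fin d)) : ℝ → EuclideanSpace ℝ (Fin d) :=
  derivWithin (velocity γ) (Set.Icc 0 1)

/-- The arc length `∫₀¹ ‖γ'‖` of a `C¹` curve on `[0,1]`. -/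
def arcLength {d : ℕ} (γ : ℝ → EuclideanSpace ℝ (Fin d)) : ℝ :=
  ∫ t in (0 : ℝ)..1, ‖velocity γ t‖

/-- The curve has constant speed. -/
def HasConstantSpeed {d : ℕ} (γ : ℝ → EuclideanSpace ℝ (Fin d)) : Prop :=
  ∃ c : ℝ, ∀ t ∈ Set.Icc (0 : ℝ) 1, ‖velocity γ t‖ = c

/-- The curvature `√(‖γ'‖² ‖γ''‖² - ⟨γ', γ''⟩²) / ‖γ'‖³` of a regular `C²` curve. -/
def curvature {d : ℕ} (γ : ℝ → EuclideanSpace ℝ (Fin d)) (t : ℝ) : ℝ :=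
  √(‖velocity γ t‖ ^ 2 * ‖acceleration γ t‖ ^ 2 - inner ℝ (velocity γ t) (acceleration γ t) ^ 2)
    / ‖velocity γ t‖ ^ 3

/-- The curvature of the curve is defined (that is, the velocity does not vanish) and at most `M`
at every point of `[0,1]`. -/
def CurvatureBoundedBy {d : ℕ} (γ : ℝ → EuclideanSpace ℝ (Fin d)) (M : ℝ) : Prop :=
  ∀ t ∈ Set.Icc (0 : ℝ) 1, velocity γ t ≠ 0 ∧ curvature γ t ≤ M

/-! ### One-dimensional CW complexes -/

/-- The data of a one-dimensional CW structure with set of 0-cells `Z₀` and 1-cells indexed by `Λ`: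
the attaching map from the endpoints of the intervals to `Z₀`. -/
structure OneDimCW (Z₀ Λ : Type) where
  /-- where the endpoint `0` of each interval is attached -/
  start : Λ → Z₀
  /-- where the endpoint `1` of each interval is attached -/
  finish : Λ → Z₀

namespace OneDimCW

variable {Z₀ Λ : Type}

/-- The disjoint union `Z₀ ⊔ ⨆_λ [0,1]`. -/
def Pieces (_K : OneDimCW Z₀ Λ) : Type := Z₀ ⊕ (Σ _ : Λ, unitInterval)

/-- The disjoint union topology, with `Z₀` discrete. -/
instance (K : OneDimCW Z₀ Λ) : TopologicalSpace K.Pieces :=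
  letI : TopologicalSpace Z₀ := ⊥
  inferInstanceAs (TopologicalSpace (Z₀ ⊕ (Σ _ : Λ, unitInterval)))

/-- The identifications of the endpoints of the intervals with 0-cells. -/
inductive Glue (K : OneDimCW Z₀ Λ) : K.Pieces → K.Pieces → Prop
  | start (l : Λ) : Glue K (Sum.inr ⟨l, 0⟩) (Sum.inl (K.start l))
  | finish (l : Λ) : Glue K (Sum.inr ⟨l, 1⟩) (Sum.inl (K.finish l))

/-- The underlying space `Z = (Z₀ ⊔ ⨆_λ [0,1]) / φ`. -/
def Space (K : OneDimCW Z₀ Λ) : Type := Quot K.Glue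

/-- The quotient topology. -/
instance (K : OneDimCW Z₀ Λ) : TopologicalSpace K.Space :=
  inferInstanceAs (TopologicalSpace (Quot K.Glue))

/-- The characteristic map `Φ_λ : [0,1] → Z` of a 1-cell. -/
def char (K : OneDimCW Z₀ Λ) (l : Λ) (t : unitInterval) : K.Space :=
  Quot.mk K.Glue (Sum.inr ⟨l, t⟩)

/-- The curve `f ∘ Φ_λ` on `[0,1]`, extended to `ℝ` by constants (only its restriction to `[0,1]`
is ever used). -/
def curve (K : OneDimCW Z₀ Λ) {d : ℕ} (f : K.Space → EuclideanSpace ℝ (Fin d)) (l : Λ) :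
    ℝ → EuclideanSpace ℝ (Fin d) :=
  Set.IccExtend (zero_le_one' ℝ) (fun t : unitInterval => f (K.char l t))

/-- `𝓕^r(Z*, d)`: maps `Z → ℝ^d` that are `C^r` on each 1-cell. -/
def smoothMaps (K : OneDimCW Z₀ Λ) (r : ℕ∞) (d : ℕ) :
    Set (K.Space → EuclideanSpace ℝ (Fin d)) :=
  {f | ∀ l, ContDiffOn ℝ r (K.curve f l) (Set.Icc 0 1)}

/-- `𝓔^r(Z*, d)`: the maps in `𝓕^r(Z*, d)` that are homeomorphisms onto their images. -/
def smoothEmbeddings (K : OneDimCW Z₀ Λ) (r : ℕ∞) (d : ℕ) :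
    Set (K.Space → EuclideanSpace ℝ (Fin d)) :=
  {f | f ∈ K.smoothMaps r d ∧ Topology.IsEmbedding f}

/-- `𝓖^r(Z*, d)`: the images of the maps in `𝓔^r(Z*, d)`. -/
def shapes (K : OneDimCW Z₀ Λ) (r : ℕ∞) (d : ℕ) : Set (Set (EuclideanSpace ℝ (Fin d))) :=
  {X | ∃ h ∈ K.smoothEmbeddings r d, Set.range h = X}

/-- The map `f` has curvature bounded by `M` on each 1-cell. -/
def MapCurvatureBoundedBy (K : OneDimCW Z₀ Λ) {d : ℕ}
    (f : K.Space → EuclideanSpace ℝ (Fin d)) (M : ℝ) : Prop :=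
  ∀ l, CurvatureBoundedBy (K.curve f l) M

/-- The shape `X` has curvature bounded by `M` under `Z*`: it is the image of some map in
`𝓔^r(Z*, d)` that has curvature bounded by `M`. -/
def ShapeCurvatureBoundedBy (K : OneDimCW Z₀ Λ) (r : ℕ∞) {d : ℕ}
    (X : Set (EuclideanSpace ℝ (Fin d))) (M : ℝ) : Prop :=
  ∃ h ∈ K.smoothEmbeddings r d, Set.range h = X ∧ K.MapCurvatureBoundedBy h M

/-- On each 1-cell `f` and `g` have arc lengths differing by at most `ε` and constant speeds, and
`‖f - g‖_∞ ≤ ε`. -/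
structure Close (K : OneDimCW Z₀ Λ) {d : ℕ} (f g : K.Space → EuclideanSpace ℝ (Fin d))
    (ε : ℝ) : Prop where
  length : ∀ l, |arcLength (K.curve f l) - arcLength (K.curve g l)| ≤ ε
  speed_left : ∀ l, HasConstantSpeed (K.curve f l)
  speed_right : ∀ l, HasConstantSpeed (K.curve g l)
  sup_norm : ∀ z, ‖f z - g z‖ ≤ ε

/-- `(hX, hY)` is a pair of maps in `𝓔^r(Z*, d)` with images `X`, `Y` that are `ε`-close. -/
def IsMatching (K : OneDimCW Z₀ Λ) (r : ℕ∞) {d : ℕ} (X Y : Set (EuclideanSpace ℝ (Fin d)))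
    (ε : ℝ) (hX hY : K.Space → EuclideanSpace ℝ (Fin d)) : Prop :=
  hX ∈ K.smoothEmbeddings r d ∧ hY ∈ K.smoothEmbeddings r d ∧
    Set.range hX = X ∧ Set.range hY = Y ∧ K.Close hX hY ε

/-- `d_{Z*}(X, Y)`: the infimum of all `ε ≥ 0` for which there are maps in `𝓔^r(Z*, d)` with images
`X`, `Y` that are `ε`-close (infinite if there are none). -/
def shapeDist (K : OneDimCW Z₀ Λ) (r : ℕ∞) {d : ℕ}
    (X Y : Set (EuclideanSpace ℝ (Fin d))) : ℝ≥0∞ :=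
  ⨅ (ε : ℝ≥0) (_ : ∃ hX hY, K.IsMatching r X Y ε hX hY), (ε : ℝ≥0∞)

end OneDimCW

/-! ### The explicit bound -/

/-- `n_λ = max(⌈(M² L³ / (24 ε))^(1/3)⌉, ⌈L M / π⌉)`. -/
def cellCount (M L ε : ℝ) : ℕ :=
  max ⌈(M ^ 2 * L ^ 3 / (24 * ε)) ^ (1 / 3 : ℝ)⌉₊ ⌈L * M / Real.pi⌉₊

open Classical in
/-- `G_λ(ε)`: equal to `8 √(L n ε) + n ε` if `L / n > 2 ε` and to `11 n ε` if `L / n ≤ 2 ε`,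
where `n = n_λ`. -/
def cellBound (M L ε : ℝ) : ℝ :=
  if L / cellCount M L ε > 2 * ε then
    8 * √(L * cellCount M L ε * ε) + cellCount M L ε * ε
  else 11 * cellCount M L ε * ε

end

/-!
Fix a direction `v` and let `h = ⟪f ·, v⟫`. By Sard's theorem on the line (`ae_hasDerivAt_ne_zero`)
and the finiteness of almost all fibres (`ae_fiberCount_ne_top`), almost every level `t` is attained
only finitely often, only in the interior of 1-cells, and transversally. For such a level the
sublevel set is a finite graph, and counting its vertices and edges gives
(`OneDimCW.eulerCharacteristic_sublevel`)

  `χ {h ≤ t} = ∑_v [h v ≤ t] + ∑_λ (N_λ t - [h (Φ_λ 0) ≤ t] - [h (Φ_λ 1) ≤ t]) / 2`,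

where `N_λ t` is the number of interior points of the cell `λ` at level `t`. The right-hand side is
measurable in `t`, and the 0-cells contribute at most `|Z₀| ε` to the difference for two functions
that are `ε`-close. It remains to compare the terms `cellTerm` of the 1-cells.

A 1-cell is cut into `n_λ` pieces of equal length; each subdivision point acts as a new vertex and
costs `ε`. On a piece, `cellTerm` is a step at the larger end value, which again costs `ε`, and half
of the number of level points in excess of the one forced by the intermediate value theorem. By the
Banach indicatrix inequality (`lintegral_fiberCount_le`) the integral of that excess is at most the
variation of `h` minus the absolute increment, and for a piece of length `ℓ` that is longer than its
chord by at most `e` this is at most `2 √(2 ℓ e)` (`excess_variation_le`). The choice of `n_λ` and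
the curvature bound make `e ≤ ε` for the first curve (`length_sub_chord_le`), hence `e ≤ 4 ε` for
the second one. If the pieces are short the length itself is a better bound. This is
`lintegral_cellTerm_inner_le`, and summing over the cells gives `OneDimCW.mapECT_bound`.

The topological input is that the Euler characteristic of a finite graph, in singular homology, is
the number of vertices minus the number of edges (`eulerCharacteristic_graph`). It is proved by
attaching one open arc at a time, with homotopy invariance and inclusion–exclusion for two open sets
(`concreteChains_mayerVietoris`). The latter rests on barycentric subdivision, which shows that
chains that are small with respect to an open cover compute the homology
(`exists_sub_boundary_mem_smallChains`), and on additivity of the Euler characteristic in short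
exact sequences of complexes (`homologyEulerChar_shortExact`).

For shapes, `setECT` is the transform of any embedding with the given image. Two embeddings with the
same image differ, away from finitely many points of the 1-cells, by `C²` changes of parameters.
Hence a curvature bound for one of them holds for every other one of constant speed
(`OneDimCW.mapCurvatureBoundedBy_of_range_eq`), and lengths of cells are bounded by the total length
(`OneDimCW.arcLength_le_sum`). A shape at finite distance from another one has a constant speed
embedding, whose curvature is bounded by compactness, so the quantitative bound is uniform in the
second shape and tends to zero with `ε`, which is continuity.
-/

noncomputable section

section

open CategoryTheory

/-! ### Additivity of the Euler characteristic in short exact sequences -/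

section LinearAlgebra

variable {R : Type} [CommRing R]

theorem finrank_eq_range_add_ker [IsDomain R] {A B : Type} [AddCommGroup A] [Module R A]
    [AddCommGroup B]
    [Module R B] (f : A →ₗ[R] B) [Module.Finite R A] :
    Module.finrank R A = Module.finrank R f.range + Module.finrank R f.ker := by
  rw [← f.quotKerEquivRange.finrank_eq, Submodule.finrank_quotient_add_finrank]

theorem Module.Finite.of_exact_of_finite [IsNoetherianRing R] {A B C : Type} [AddCommGroup A]
    [Module R A]
    [AddCommGroup B] [Module R B] [AddCommGroup C] [Module R C] {f : A →ₗ[R] B} {g : B →ₗ[R] C}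
    (h : Function.Exact f g) (hA : Module.Finite R A) (hC : Module.Finite R C) :
    Module.Finite R B := by
  have h' : Function.Exact f g.rangeRestrict := by
    intro x
    rw [← h x]
    exact Subtype.ext_iff
  exact Module.Finite.of_exact h' (LinearMap.surjective_rangeRestrict _)

/-- The alternating sums of ranks in a truncated long exact sequence
`⋯ → A k → B k → C k → A (k - 1) → ⋯ → C 0 → 0` agree up to the rank of the last connecting map. -/
theorem sum_finrank_of_longExact [IsDomain R] {A B C : ℕ → Type} [∀ k, AddCommGroup (A k)]
    [∀ k, Module R (A k)] [∀ k, AddCommGroup (B k)] [∀ k, Module R (B k)]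
    [∀ k, AddCommGroup (C k)] [∀ k, Module R (C k)]
    [∀ k, Module.Finite R (A k)] [∀ k, Module.Finite R (B k)] [∀ k, Module.Finite R (C k)]
    (f : ∀ k, A k →ₗ[R] B k) (g : ∀ k, B k →ₗ[R] C k) (δ : ∀ k, C (k + 1) →ₗ[R] A k)
    (h₁ : ∀ k, (δ k).range = (f k).ker) (h₂ : ∀ k, (f k).range = (g k).ker)
    (h₃ : ∀ k, (g (k + 1)).range = (δ k).ker) (h₀ : Function.Surjective (g 0)) (N : ℕ) :
    ∑ k ∈ Finset.range (N + 1), (-1 : ℤ) ^ k * (Module.finrank R (A k) + Module.finrank R (C k)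
      - Module.finrank R (B k)) = (-1) ^ N * Module.finrank R (δ N).range := by
  have hA := fun k => finrank_eq_range_add_ker (f k)
  have hB := fun k => finrank_eq_range_add_ker (g k)
  have hC := fun k => finrank_eq_range_add_ker (δ k)
  induction N with
  | zero =>
    have hC0 : Module.finrank R (C 0) = Module.finrank R (g 0).range := by
      rw [LinearMap.range_eq_top.mpr h₀]
      exact (finrank_top R (C 0)).symm
    simp only [zero_add, Finset.range_one, Finset.sum_singleton, pow_zero, one_mul]
    rw [hA 0, hB 0, hC0, h₁, h₂]
    push_cast
    ring
  | succ N ih =>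
    rw [Finset.sum_range_succ, ih, hA (N + 1), hB (N + 1), hC N, h₁ (N + 1), h₂ (N + 1), h₃ N]
    push_cast
    ring

theorem sum_finrank_of_longExact_eq_zero [IsDomain R] {A B C : ℕ → Type} [∀ k, AddCommGroup (A k)]
    [∀ k, Module R (A k)] [∀ k, AddCommGroup (B k)] [∀ k, Module R (B k)]
    [∀ k, AddCommGroup (C k)] [∀ k, Module R (C k)]
    [∀ k, Module.Finite R (A k)] [∀ k, Module.Finite R (B k)] [∀ k, Module.Finite R (C k)]
    (f : ∀ k, A k →ₗ[R] B k) (g : ∀ k, B k →ₗ[R] C k) (δ : ∀ k, C (k + 1) →ₗ[R] A k)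
    (h₁ : ∀ k, (δ k).range = (f k).ker) (h₂ : ∀ k, (f k).range = (g k).ker)
    (h₃ : ∀ k, (g (k + 1)).range = (δ k).ker) (h₀ : Function.Surjective (g 0)) (N : ℕ)
    [Subsingleton (A N)] :
    ∑ k ∈ Finset.range (N + 1), (-1 : ℤ) ^ k * (Module.finrank R (A k) + Module.finrank R (C k)
      - Module.finrank R (B k)) = 0 := by
  rw [sum_finrank_of_longExact f g δ h₁ h₂ h₃ h₀, Module.finrank_zero_of_subsingleton]
  simp

end LinearAlgebra

section ShortExact

variable {R : Type} [CommRing R]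

/-- A chain complex of modules has finitely generated total homology. -/
def HasFGTotalHomology (C : ChainComplex (ModuleCat.{0} R) ℕ) : Prop :=
  (∀ k, Module.Finite R (C.homology k)) ∧ ∃ N, ∀ k, N ≤ k → Subsingleton (C.homology k)

variable {S : ShortComplex (ChainComplex (ModuleCat.{0} R) ℕ)}

theorem homologyEulerChar_eq_sum [Nontrivial R] (C : ChainComplex (ModuleCat.{0} R) ℕ) {N : ℕ}
    (hN : ∀ k, N ≤ k → Subsingleton (C.homology k)) :
    C.homologyEulerChar =
      ∑ k ∈ Finset.range N, (-1 : ℤ) ^ k * Module.finrank R (C.homology k) := by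
  rw [HomologicalComplex.homologyEulerChar_eq_sum_finSet_of_finrankSupport_subset C
    (Finset.range N)]
  · simp
  · rw [GradedObject.finrankSupport_subset_iff]
    intro i hi
    have := hN i (by simpa using hi)
    exact Module.finrank_zero_of_subsingleton

/-- In a short exact sequence of complexes, finiteness of the homology passes from the outer terms
to the middle one. -/
theorem HasFGTotalHomology.middle [IsNoetherianRing R] (hS : S.ShortExact)
    (h₁ : HasFGTotalHomology S.X₁)
    (h₃ : HasFGTotalHomology S.X₃) : HasFGTotalHomology S.X₂ := by
  obtain ⟨f₁, N₁, hN₁⟩ := h₁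
  obtain ⟨f₃, N₃, hN₃⟩ := h₃
  have hex := fun k => (ShortComplex.ShortExact.moduleCat_exact_iff_function_exact _).1
    (hS.homology_exact₂ k)
  refine ⟨fun k => ?_, max N₁ N₃, fun k hk => ?_⟩
  · exact Module.Finite.of_exact_of_finite (hex k) (f₁ k) (f₃ k)
  · have := hN₁ k (le_trans (le_max_left _ _) hk)
    have := hN₃ k (le_trans (le_max_right _ _) hk)
    refine ⟨fun x y => ?_⟩
    have key : ∀ z : S.X₂.homology k, z = 0 := fun z => by
      obtain ⟨w, rfl⟩ := (hex k z).1 (Subsingleton.elim _ _)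
      rw [Subsingleton.elim w 0]
      exact map_zero (HomologicalComplex.homologyMap S.f k).hom
    rw [key x, key y]

theorem surjective_homologyMap_zero (hS : S.ShortExact) :
    Function.Surjective (HomologicalComplex.homologyMap S.g 0).hom := by
  have := hS.epi_g
  have := HomologicalComplex.epi_homologyMap_of_epi_of_not_rel S.g 0 (by simp)
  exact (ModuleCat.epi_iff_surjective _).1 this

/-- In a short exact sequence of complexes, finiteness of the homology passes from the first two
terms to the third. -/
theorem HasFGTotalHomology.right [IsNoetherianRing R] (hS : S.ShortExact)
    (h₁ : HasFGTotalHomology S.X₁)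
    (h₂ : HasFGTotalHomology S.X₂) : HasFGTotalHomology S.X₃ := by
  obtain ⟨f₁, N₁, hN₁⟩ := h₁
  obtain ⟨f₂, N₂, hN₂⟩ := h₂
  have hex := fun k => (ShortComplex.ShortExact.moduleCat_exact_iff_function_exact _).1
    (hS.homology_exact₃ (k + 1) k rfl)
  refine ⟨fun k => ?_, max N₁ N₂ + 1, fun k hk => ?_⟩
  · cases k with
    | zero =>
      have := f₂ 0
      exact Module.Finite.of_surjective _ (surjective_homologyMap_zero hS)
    | succ k =>
      exact Module.Finite.of_exact_of_finite (hex k) (f₂ (k + 1)) (f₁ k)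
  · obtain ⟨k, rfl⟩ : ∃ j, k = j + 1 := ⟨k - 1, by omega⟩
    have := hN₁ k (by omega)
    have := hN₂ (k + 1) (by omega)
    refine ⟨fun x y => ?_⟩
    have key : ∀ z : S.X₃.homology (k + 1), z = 0 := fun z => by
      obtain ⟨w, rfl⟩ := (hex k z).1 (Subsingleton.elim _ _)
      rw [Subsingleton.elim w 0]
      exact map_zero (HomologicalComplex.homologyMap S.g (k + 1)).hom
    rw [key x, key y]

/-- By the long exact homology sequence, the Euler characteristic is additive in short exact
sequences of complexes with finitely generated total homology. -/
theorem homologyEulerChar_shortExact [IsDomain R] (hS : S.ShortExact) (h₁ : HasFGTotalHomology S.X₁)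
    (h₂ : HasFGTotalHomology S.X₂) (h₃ : HasFGTotalHomology S.X₃) :
    S.X₂.homologyEulerChar = S.X₁.homologyEulerChar + S.X₃.homologyEulerChar := by
  obtain ⟨f₁, N₁, hN₁⟩ := h₁
  obtain ⟨f₂, N₂, hN₂⟩ := h₂
  obtain ⟨f₃, N₃, hN₃⟩ := h₃
  set N := max N₁ (max N₂ N₃) with hN
  have := hN₁ N (by omega)
  have key := sum_finrank_of_longExact_eq_zero
    (fun k => (HomologicalComplex.homologyMap S.f k).hom)
    (fun k => (HomologicalComplex.homologyMap S.g k).hom)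
    (fun k => (hS.δ (k + 1) k rfl).hom)
    (fun k => (hS.homology_exact₁ (k + 1) k rfl).moduleCat_range_eq_ker)
    (fun k => (hS.homology_exact₂ k).moduleCat_range_eq_ker)
    (fun k => (hS.homology_exact₃ (k + 1) k rfl).moduleCat_range_eq_ker)
    (surjective_homologyMap_zero hS) N
  rw [homologyEulerChar_eq_sum S.X₁ (N := N + 1) (fun k hk => hN₁ k (by omega)),
    homologyEulerChar_eq_sum S.X₂ (N := N + 1) (fun k hk => hN₂ k (by omega)),
    homologyEulerChar_eq_sum S.X₃ (N := N + 1) (fun k hk => hN₃ k (by omega)),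
    ← sub_eq_zero, ← neg_eq_zero, ← Finset.sum_add_distrib, ← Finset.sum_sub_distrib,
    ← Finset.sum_neg_distrib]
  refine Eq.trans (Finset.sum_congr rfl fun k _ => ?_) key
  ring

theorem HasFGTotalHomology.of_homologyIso {C D : ChainComplex (ModuleCat.{0} R) ℕ}
    (e : ∀ k, C.homology k ≅ D.homology k) (hC : HasFGTotalHomology C) :
    HasFGTotalHomology D := by
  obtain ⟨f, N, hN⟩ := hC
  refine ⟨fun k => ?_, N, fun k hk => ?_⟩
  · have := f k
    exact Module.Finite.equiv (e k).toLinearEquiv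
  · have := hN k hk
    exact (e k).toLinearEquiv.symm.injective.subsingleton

theorem homologyEulerChar_congr {C D : ChainComplex (ModuleCat.{0} R) ℕ}
    (e : ∀ k, C.homology k ≅ D.homology k) : C.homologyEulerChar = D.homologyEulerChar := by
  unfold HomologicalComplex.homologyEulerChar GradedObject.eulerChar
  exact finsum_congr fun k => by rw [(e k).toLinearEquiv.finrank_eq]

theorem HasFGTotalHomology.of_subsingleton [Nontrivial R] {C : ChainComplex (ModuleCat.{0} R) ℕ}
    (h : ∀ k, Subsingleton (C.homology k)) :
    HasFGTotalHomology C ∧ C.homologyEulerChar = 0 := by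
  refine ⟨⟨fun k => ?_, 0, fun k _ => h k⟩, ?_⟩
  · have := h k
    infer_instance
  · simpa using homologyEulerChar_eq_sum C (N := 0) (fun k _ => h k)

end ShortExact

end

section

open CategoryTheory

/-! ### Singular chains as finitely supported functions -/

section ConcreteChains

variable (R : Type) [CommRing R]

/-- The chain complex of a sequence of modules and linear maps composing to zero. -/
def linearChainComplex (M : ℕ → Type) [∀ n, AddCommGroup (M n)] [∀ n, Module R (M n)]
    (d : ∀ n, M (n + 1) →ₗ[R] M n) (h : ∀ n, d n ∘ₗ d (n + 1) = 0) :
    ChainComplex (ModuleCat.{0} R) ℕ :=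
  ChainComplex.of (fun n => ModuleCat.of R (M n)) (fun n => ModuleCat.ofHom (d n))
    (fun n => by rw [← ModuleCat.ofHom_comp, h]; rfl)

/-- Singular `n`-simplices of `X`. -/
abbrev SingularSimplex (X : Type) [TopologicalSpace X] (n : ℕ) : Type :=
  C(stdSimplex ℝ (Fin (n + 1)), X)

/-- Singular `n`-chains of `X`, as finitely supported functions on singular simplices. -/
abbrev SingularChain (X : Type) [TopologicalSpace X] (n : ℕ) : Type :=
  SingularSimplex X n →₀ R

/-- The inclusion of the `i`-th face of a standard simplex. -/
def stdFace (n : ℕ) (i : Fin (n + 2)) :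
    C(stdSimplex ℝ (Fin (n + 1)), stdSimplex ℝ (Fin (n + 2))) :=
  ⟨stdSimplex.map i.succAbove, stdSimplex.continuous_map _⟩

variable {X : Type} [TopologicalSpace X]

variable (X) in
/-- The singular boundary operator. -/
def singularBoundary (n : ℕ) : SingularChain R X (n + 1) →ₗ[R] SingularChain R X n :=
  Finsupp.linearCombination R
    (fun σ => ∑ i : Fin (n + 2), (-1 : R) ^ (i : ℕ) • Finsupp.single (σ.comp (stdFace n i)) 1)

variable {R} in
@[simp]
theorem singularBoundary_single (n : ℕ) (σ : SingularSimplex X (n + 1)) (a : R) :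
    singularBoundary R X n (Finsupp.single σ a) =
      a • ∑ i : Fin (n + 2), (-1 : R) ^ (i : ℕ) • Finsupp.single (σ.comp (stdFace n i)) 1 := by
  simp [singularBoundary]

end ConcreteChains

/-- Simplices of the singular simplicial set as continuous maps. -/
def simplexEquiv (X : Type) [TopologicalSpace X] (n : ℕ) :
    (TopCat.toSSet.obj (TopCat.of X)).obj (Opposite.op (SimplexCategory.mk n)) ≃
      SingularSimplex X n :=
  TopCat.toSSetObjEquiv (TopCat.of X) _

theorem linearCombination_hom_single {R : Type} [Ring R] {ι : Type} {M : ModuleCat.{0} R}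
    (f : ι → M) (x : ι) :
    (ModuleCat.ofHom (Finsupp.linearCombination R f)).hom (Finsupp.single x 1) = f x := by
  simp

theorem hom_sum_smul_apply {ι : Type} [Fintype ι] {M N : ModuleCat.{0} ℤ} (φ : M ⟶ N) (c : ι → ℤ)
    (g : ι → (ModuleCat.of ℤ ℤ ⟶ M)) :
    φ.hom ((∑ i, c i • g i).hom (1 : ℤ)) = ∑ i, c i • φ.hom ((g i).hom (1 : ℤ)) := by
  let Ψ : (ModuleCat.of ℤ ℤ ⟶ M) →+ N :=
    { toFun := fun g => φ.hom (g.hom (1 : ℤ))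
      map_zero' := map_zero φ.hom
      map_add' := fun g h => map_add φ.hom _ _ }
  refine (map_sum Ψ _ _).trans (Finset.sum_congr rfl fun i _ => ?_)
  exact (map_zsmul Ψ _ _).trans rfl

section SimplicialSet

variable (S : SSet.{0})

/-- Expanding an `n`-chain of a simplicial set in terms of its simplices. -/
def chainExpand (n : ℕ) : (S.chainComplex (ModuleCat.of ℤ ℤ)).X n ⟶
    ModuleCat.of ℤ (S.obj (Opposite.op (SimplexCategory.mk n)) →₀ ℤ) :=
  Limits.Cofan.IsColimit.desc (S.isColimitChainComplexXCofan (ModuleCat.of ℤ ℤ) n)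
    (fun x => ModuleCat.ofHom (Finsupp.lsingle x))

theorem ι_chainExpand (n : ℕ) (x : S.obj (Opposite.op (SimplexCategory.mk n))) :
    S.ιChainComplex x ≫ chainExpand S n = ModuleCat.ofHom (Finsupp.lsingle x) :=
  Limits.Cofan.IsColimit.fac (S.isColimitChainComplexXCofan (ModuleCat.of ℤ ℤ) n) _ x

theorem chainExpand_ι_one (n : ℕ) (x : S.obj (Opposite.op (SimplexCategory.mk n))) :
    (chainExpand S n).hom ((S.ιChainComplex (R := ModuleCat.of ℤ ℤ) x).hom (1 : ℤ)) =
      Finsupp.single x 1 :=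
  congrArg (fun f => f.hom (1 : ℤ)) (ι_chainExpand S n x)

/-- The chain with given coefficients. -/
def chainCollect (n : ℕ) : ModuleCat.of ℤ (S.obj (Opposite.op (SimplexCategory.mk n)) →₀ ℤ) ⟶
    (S.chainComplex (ModuleCat.of ℤ ℤ)).X n :=
  ModuleCat.ofHom (Finsupp.linearCombination ℤ
    (fun x => (S.ιChainComplex (R := ModuleCat.of ℤ ℤ) x).hom (1 : ℤ)))

theorem chainCollect_single (n : ℕ) (x : S.obj (Opposite.op (SimplexCategory.mk n))) :
    (chainCollect S n).hom (Finsupp.single x 1) =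
      (S.ιChainComplex (R := ModuleCat.of ℤ ℤ) x).hom (1 : ℤ) :=
  linearCombination_hom_single _ x

theorem hom_ext_int {M : ModuleCat.{0} ℤ} {f g : ModuleCat.of ℤ ℤ ⟶ M}
    (h : f.hom (1 : ℤ) = g.hom (1 : ℤ)) : f = g :=
  ModuleCat.hom_ext (LinearMap.ext_ring h)

/-- The `n`-chains of a simplicial set are the finitely supported functions on its
`n`-simplices. -/
def chainExpandIso (n : ℕ) : (S.chainComplex (ModuleCat.of ℤ ℤ)).X n ≅
    ModuleCat.of ℤ (S.obj (Opposite.op (SimplexCategory.mk n)) →₀ ℤ) where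
  hom := chainExpand S n
  inv := chainCollect S n
  hom_inv_id := by
    refine SSet.chainComplex_hom_ext fun x => hom_ext_int ?_
    rw [ModuleCat.comp_apply, ModuleCat.comp_apply]
    erw [chainExpand_ι_one, chainCollect_single]
    rfl
  inv_hom_id := by
    refine ModuleCat.hom_ext (Finsupp.lhom_ext' fun x => LinearMap.ext_ring ?_)
    refine Eq.trans ?_ (chainExpand_ι_one S n x)
    exact congrArg (chainExpand S n).hom (chainCollect_single S n x)

end SimplicialSet

/-- Mathlib's singular `n`-chains are the finitely supported functions on singular simplices. -/
def singularChainsXIso (X : Type) [TopologicalSpace X] (n : ℕ) :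
    (singularChains X).X n ≅ ModuleCat.of ℤ (SingularChain ℤ X n) :=
  chainExpandIso (TopCat.toSSet.obj (TopCat.of X)) n ≪≫
    (Finsupp.domLCongr (M := ℤ) (R := ℤ) (simplexEquiv X n)).toModuleIso

theorem singularChainsXIso_hom_ι (X : Type) [TopologicalSpace X] (n : ℕ)
    (x : (TopCat.toSSet.obj (TopCat.of X)).obj (Opposite.op (SimplexCategory.mk n))) :
    (singularChainsXIso X n).hom.hom (((TopCat.toSSet.obj (TopCat.of X)).ιChainComplex
      (R := ModuleCat.of ℤ ℤ) x).hom (1 : ℤ)) = Finsupp.single (simplexEquiv X n x) 1 := by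
  refine Eq.trans (congrArg (Finsupp.domLCongr (M := ℤ) (R := ℤ) (simplexEquiv X n))
    (chainExpand_ι_one _ n x)) ?_
  exact Finsupp.domLCongr_single _ _ _

/-- Under the identification of singular chains with finitely supported functions, the differential
of Mathlib's singular chain complex is `singularBoundary`. -/
theorem singularChainsXIso_comm (X : Type) [TopologicalSpace X] (n : ℕ) :
    (singularChainsXIso X (n + 1)).hom ≫ ModuleCat.ofHom (singularBoundary ℤ X n) =
      (singularChains X).d (n + 1) n ≫ (singularChainsXIso X n).hom := by
  refine SSet.chainComplex_hom_ext fun x => hom_ext_int ?_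
  refine Eq.trans (congrArg (singularBoundary ℤ X n) (singularChainsXIso_hom_ι X (n + 1) x)) ?_
  have h := congrArg (fun f => (singularChainsXIso X n).hom.hom (f.hom (1 : ℤ)))
    (SSet.ιChainComplex_d (R := ModuleCat.of ℤ ℤ) (TopCat.toSSet.obj (TopCat.of X)) x)
  refine Eq.trans ?_ h.symm
  rw [singularBoundary_single, one_smul]
  refine Eq.trans ?_ (hom_sum_smul_apply (singularChainsXIso X n).hom _ _).symm
  exact Finset.sum_congr rfl fun i _ =>
    congrArg (fun z => (-1 : ℤ) ^ (i : ℕ) • z)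
      (singularChainsXIso_hom_ι X n ((TopCat.toSSet.obj (TopCat.of X)).δ i x)).symm

end

section

open CategoryTheory

/-! ### Barycentric subdivision of ordered chains -/

section OrderedChains

variable (R : Type) [CommRing R] (V W : Type)

/-- Ordered `m`-chains on a set `V` of vertices: an `m`-simplex is an arbitrary `(m + 1)`-tuple. -/
abbrev OrderedChain (m : ℕ) : Type := (Fin (m + 1) → V) →₀ R

/-- The boundary operator on ordered chains. -/
def orderedBoundary (m : ℕ) : OrderedChain R V (m + 1) →ₗ[R] OrderedChain R V m :=
  Finsupp.linearCombination R
    (fun w => ∑ i : Fin (m + 2), (-1 : R) ^ (i : ℕ) • Finsupp.single (w ∘ i.succAbove) 1)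

/-- The cone over an ordered chain with apex `b`. -/
def orderedCone {V : Type} (b : V) (m : ℕ) : OrderedChain R V m →ₗ[R] OrderedChain R V (m + 1) :=
  Finsupp.lmapDomain R R (fun w => (Fin.cons b w : Fin (m + 2) → V))

/-- The sum of the coefficients of a `0`-chain. -/
def orderedAugmentation : OrderedChain R V 0 →ₗ[R] R :=
  Finsupp.linearCombination R (fun _ => 1)

variable {R V W}

@[simp]
theorem orderedBoundary_single (m : ℕ) (w : Fin (m + 2) → V) :
    orderedBoundary R V m (Finsupp.single w 1) =
      ∑ i : Fin (m + 2), (-1 : R) ^ (i : ℕ) • Finsupp.single (w ∘ i.succAbove) 1 := by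
  simp [orderedBoundary]

@[simp]
theorem orderedCone_single (b : V) (m : ℕ) (w : Fin (m + 1) → V) (a : R) :
    orderedCone R b m (Finsupp.single w a) = Finsupp.single (Fin.cons b w : Fin (m + 2) → V) a := by
  simp [orderedCone]

theorem cons_comp_succ_succAbove {m : ℕ} (b : V) (w : Fin (m + 2) → V) (j : Fin (m + 2)) :
    (Fin.cons b w : Fin (m + 3) → V) ∘ j.succ.succAbove =
      (Fin.cons b (w ∘ j.succAbove) : Fin (m + 2) → V) := by
  funext k
  refine Fin.cases ?_ (fun k => ?_) k
  · simp
  · simp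

theorem linearMap_ext_single {ι M : Type} [AddCommGroup M] [Module R M] {f g : (ι →₀ R) →ₗ[R] M}
    (h : ∀ i, f (Finsupp.single i 1) = g (Finsupp.single i 1)) : f = g :=
  Finsupp.lhom_ext' fun i => LinearMap.ext_ring (h i)

theorem orderedBoundary_cone (b : V) (m : ℕ) (c : OrderedChain R V (m + 1)) :
    orderedBoundary R V (m + 1) (orderedCone R b (m + 1) c) =
      c - orderedCone R b m (orderedBoundary R V m c) := by
  have : orderedBoundary R V (m + 1) ∘ₗ orderedCone R b (m + 1) =
      LinearMap.id - orderedCone R b m ∘ₗ orderedBoundary R V m := by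
    refine linearMap_ext_single fun w => ?_
    simp only [LinearMap.comp_apply, orderedCone_single, orderedBoundary_single,
      LinearMap.sub_apply, LinearMap.id_apply, map_sum, map_smul]
    rw [Fin.sum_univ_succ]
    simp only [cons_comp_succ_succAbove]
    have h0 : (Fin.cons b w : Fin (m + 3) → V) ∘ (0 : Fin (m + 3)).succAbove = w := by
      funext k; simp
    rw [h0]
    simp only [Fin.val_zero, pow_zero, one_smul, Fin.val_succ, pow_succ, mul_neg, mul_one,
      neg_smul, Finset.sum_neg_distrib, sub_eq_add_neg]
  exact LinearMap.congr_fun this c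

theorem orderedBoundary_cone_zero (b : V) (c : OrderedChain R V 0) :
    orderedBoundary R V 0 (orderedCone R b 0 c) =
      c - orderedAugmentation R V c • Finsupp.single (fun _ => b) 1 := by
  have : orderedBoundary R V 0 ∘ₗ orderedCone R b 0 =
      LinearMap.id - (orderedAugmentation R V).smulRight (Finsupp.single (fun _ => b) 1) := by
    refine linearMap_ext_single fun w => ?_
    simp only [LinearMap.comp_apply, orderedCone_single, orderedBoundary_single,
      LinearMap.sub_apply, LinearMap.id_apply, LinearMap.smulRight_apply]
    rw [Fin.sum_univ_two]
    have h0 : (Fin.cons b w : Fin 2 → V) ∘ (0 : Fin 2).succAbove = w := by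
      funext k; simp
    have h1 : (Fin.cons b w : Fin 2 → V) ∘ (1 : Fin 2).succAbove = fun _ => b := by
      funext k
      rw [Subsingleton.elim k 0]
      simp
    rw [h0, h1]
    simp [orderedAugmentation, sub_eq_add_neg]
  exact LinearMap.congr_fun this c

theorem orderedAugmentation_boundary (c : OrderedChain R V 1) :
    orderedAugmentation R V (orderedBoundary R V 0 c) = 0 := by
  have : orderedAugmentation R V ∘ₗ orderedBoundary R V 0 = 0 := by
    refine linearMap_ext_single fun w => ?_
    simp [orderedAugmentation, Fin.sum_univ_two]
  exact LinearMap.congr_fun this c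

theorem single_eq_orderedCone (m : ℕ) (w : Fin (m + 2) → V) :
    (Finsupp.single w 1 : OrderedChain R V (m + 1)) =
      orderedCone R (w 0) m (Finsupp.single (Fin.tail w) 1) := by
  rw [orderedCone_single, Fin.cons_self_tail]

theorem orderedBoundary_boundary (m : ℕ) (c : OrderedChain R V (m + 2)) :
    orderedBoundary R V m (orderedBoundary R V (m + 1) c) = 0 := by
  have : orderedBoundary R V m ∘ₗ orderedBoundary R V (m + 1) = 0 := by
    induction m with
    | zero =>
      refine linearMap_ext_single fun w => ?_
      rw [LinearMap.comp_apply, single_eq_orderedCone, orderedBoundary_cone, map_sub,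
        orderedBoundary_cone_zero, orderedAugmentation_boundary]
      simp only [zero_smul, sub_zero, sub_self, LinearMap.zero_apply]
    | succ m ih =>
      refine linearMap_ext_single fun w => ?_
      rw [LinearMap.comp_apply, single_eq_orderedCone, orderedBoundary_cone, map_sub,
        orderedBoundary_cone]
      have := LinearMap.congr_fun (ih 0)
        (Finsupp.single (Fin.tail w) 1)
      rw [LinearMap.comp_apply] at this
      rw [this, LinearMap.zero_apply, LinearMap.zero_apply, map_zero, sub_zero, sub_self]
  exact LinearMap.congr_fun this c

variable (R) in
/-- Barycentric subdivision of ordered chains, with respect to a choice `β` of barycentres: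
the subdivision of a simplex is the cone from its barycentre over its subdivided boundary. -/
def orderedSd (β : ∀ m, (Fin (m + 1) → V) → V) : ∀ m, OrderedChain R V m →ₗ[R] OrderedChain R V m
  | 0 => LinearMap.id
  | m + 1 => Finsupp.linearCombination R (fun w => orderedCone R (β (m + 1) w) m
      (orderedSd β m (orderedBoundary R V m (Finsupp.single w 1))))

variable (R) in
/-- The chain homotopy from the identity to barycentric subdivision. -/
def orderedSdHomotopy (β : ∀ m, (Fin (m + 1) → V) → V) :
    ∀ m, OrderedChain R V m →ₗ[R] OrderedChain R V (m + 1)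
  | 0 => 0
  | m + 1 => Finsupp.linearCombination R (fun w => orderedCone R (β (m + 1) w) (m + 1)
      (Finsupp.single w 1 - orderedSdHomotopy β m (orderedBoundary R V m (Finsupp.single w 1))))

variable (β : ∀ m, (Fin (m + 1) → V) → V) (γ : ∀ m, (Fin (m + 1) → W) → W)

theorem orderedSd_succ_single (m : ℕ) (w : Fin (m + 2) → V) :
    orderedSd R β (m + 1) (Finsupp.single w 1) = orderedCone R (β (m + 1) w) m
      (orderedSd R β m (orderedBoundary R V m (Finsupp.single w 1))) := by
  rw [orderedSd, Finsupp.linearCombination_single, one_smul]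

theorem orderedSdHomotopy_succ_single (m : ℕ) (w : Fin (m + 2) → V) :
    orderedSdHomotopy R β (m + 1) (Finsupp.single w 1) = orderedCone R (β (m + 1) w) (m + 1)
      (Finsupp.single w 1 -
        orderedSdHomotopy R β m (orderedBoundary R V m (Finsupp.single w 1))) := by
  rw [orderedSdHomotopy, Finsupp.linearCombination_single, one_smul]

theorem orderedBoundary_sd (m : ℕ) (c : OrderedChain R V (m + 1)) :
    orderedBoundary R V m (orderedSd R β (m + 1) c) =
      orderedSd R β m (orderedBoundary R V m c) := by
  have : orderedBoundary R V m ∘ₗ orderedSd R β (m + 1) =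
      orderedSd R β m ∘ₗ orderedBoundary R V m := by
    induction m with
    | zero =>
      refine linearMap_ext_single fun w => ?_
      rw [LinearMap.comp_apply, orderedSd_succ_single, orderedBoundary_cone_zero]
      simp only [orderedSd, LinearMap.id_apply, orderedAugmentation_boundary, zero_smul, sub_zero,
        LinearMap.comp_apply]
    | succ m ih =>
      refine linearMap_ext_single fun w => ?_
      have h := LinearMap.congr_fun (ih 0) (orderedBoundary R V (m + 1) (Finsupp.single w 1))
      rw [LinearMap.comp_apply, LinearMap.comp_apply, orderedBoundary_boundary, map_zero] at h
      rw [LinearMap.comp_apply, orderedSd_succ_single, orderedBoundary_cone, h, map_zero, sub_zero,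
        LinearMap.comp_apply]
  exact LinearMap.congr_fun this c

/-- The subdivision is chain homotopic to the identity: `∂ T + T ∂ = 1 - sd`. -/
theorem orderedBoundary_sdHomotopy (m : ℕ) (c : OrderedChain R V (m + 1)) :
    orderedBoundary R V (m + 1) (orderedSdHomotopy R β (m + 1) c) +
      orderedSdHomotopy R β m (orderedBoundary R V m c) = c - orderedSd R β (m + 1) c := by
  have : orderedBoundary R V (m + 1) ∘ₗ orderedSdHomotopy R β (m + 1) +
      orderedSdHomotopy R β m ∘ₗ orderedBoundary R V m =
        LinearMap.id - orderedSd R β (m + 1) := by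
    induction m with
    | zero =>
      refine linearMap_ext_single fun w => ?_
      simp only [LinearMap.add_apply, LinearMap.comp_apply, LinearMap.sub_apply,
        LinearMap.id_apply]
      rw [orderedSdHomotopy_succ_single, orderedBoundary_cone, orderedSd_succ_single]
      simp only [orderedSdHomotopy, LinearMap.zero_apply, sub_zero, add_zero, orderedSd,
        LinearMap.id_apply]
    | succ m ih =>
      refine linearMap_ext_single fun w => ?_
      have h := LinearMap.congr_fun (ih 0) (orderedBoundary R V (m + 1) (Finsupp.single w 1))
      simp only [LinearMap.add_apply, LinearMap.comp_apply, LinearMap.sub_apply,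
        LinearMap.id_apply, orderedBoundary_boundary, map_zero, add_zero] at h
      simp only [LinearMap.add_apply, LinearMap.comp_apply, LinearMap.sub_apply,
        LinearMap.id_apply]
      rw [orderedSdHomotopy_succ_single, orderedBoundary_cone, map_sub, h,
        orderedSd_succ_single β (m + 1) w, sub_sub_cancel]
      abel
  exact LinearMap.congr_fun this c

/-- The chain map induced by a map of vertices. -/
abbrev orderedMap (φ : V → W) (m : ℕ) : OrderedChain R V m →ₗ[R] OrderedChain R W m :=
  Finsupp.lmapDomain R R (fun w => φ ∘ w)

theorem orderedMap_boundary (φ : V → W) (m : ℕ) (c : OrderedChain R V (m + 1)) :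
    orderedMap φ m (orderedBoundary R V m c) = orderedBoundary R W m (orderedMap φ (m + 1) c) := by
  have : orderedMap (R := R) φ m ∘ₗ orderedBoundary R V m =
      orderedBoundary R W m ∘ₗ orderedMap φ (m + 1) := by
    refine linearMap_ext_single fun w => ?_
    simp [map_sum, Function.comp_assoc]
  exact LinearMap.congr_fun this c

theorem orderedMap_cone (φ : V → W) (b : V) (m : ℕ) (c : OrderedChain R V m) :
    orderedMap φ (m + 1) (orderedCone R b m c) = orderedCone R (φ b) m (orderedMap φ m c) := by
  have : orderedMap (R := R) φ (m + 1) ∘ₗ orderedCone R b m =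
      orderedCone R (φ b) m ∘ₗ orderedMap φ m := by
    refine linearMap_ext_single fun w => ?_
    simp only [LinearMap.comp_apply, orderedCone_single, Finsupp.lmapDomain_apply,
      Finsupp.mapDomain_single]
    congr 1
    funext k
    refine Fin.cases ?_ (fun k => ?_) k <;> simp
  exact LinearMap.congr_fun this c

variable {β γ}

/-- Subdivision is natural for maps of vertices that preserve the chosen barycentres. -/
theorem orderedMap_sd {φ : V → W} (hφ : ∀ m w, φ (β m w) = γ m (φ ∘ w)) (m : ℕ)
    (c : OrderedChain R V m) :
    orderedMap φ m (orderedSd R β m c) = orderedSd R γ m (orderedMap φ m c) := by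
  have : orderedMap (R := R) φ m ∘ₗ orderedSd R β m = orderedSd R γ m ∘ₗ orderedMap φ m := by
    induction m with
    | zero => rfl
    | succ m ih =>
      refine linearMap_ext_single fun w => ?_
      have h := LinearMap.congr_fun (ih 0) (orderedBoundary R V m (Finsupp.single w 1))
      rw [LinearMap.comp_apply, LinearMap.comp_apply] at h
      rw [LinearMap.comp_apply, LinearMap.comp_apply, orderedSd_succ_single, orderedMap_cone, h,
        orderedMap_boundary, Finsupp.lmapDomain_apply, Finsupp.mapDomain_single,
        orderedSd_succ_single, hφ]
  exact LinearMap.congr_fun this c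

theorem orderedMap_sdHomotopy {φ : V → W} (hφ : ∀ m w, φ (β m w) = γ m (φ ∘ w)) (m : ℕ)
    (c : OrderedChain R V m) :
    orderedMap φ (m + 1) (orderedSdHomotopy R β m c) =
      orderedSdHomotopy R γ m (orderedMap φ m c) := by
  have : orderedMap (R := R) φ (m + 1) ∘ₗ orderedSdHomotopy R β m =
      orderedSdHomotopy R γ m ∘ₗ orderedMap φ m := by
    induction m with
    | zero => simp [orderedSdHomotopy]
    | succ m ih =>
      refine linearMap_ext_single fun w => ?_
      have h := LinearMap.congr_fun (ih 0) (orderedBoundary R V m (Finsupp.single w 1))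
      rw [LinearMap.comp_apply, LinearMap.comp_apply] at h
      rw [LinearMap.comp_apply, LinearMap.comp_apply, orderedSdHomotopy_succ_single,
        orderedMap_cone, map_sub, h, orderedMap_boundary, Finsupp.lmapDomain_apply,
        Finsupp.mapDomain_single, orderedSdHomotopy_succ_single, hφ]
  exact LinearMap.congr_fun this c

end OrderedChains

end

section

open CategoryTheory

/-! ### The mesh of barycentric subdivision -/

section Mesh

variable {R : Type} [CommRing R] {V : Type} {E : Type} [NormedAddCommGroup E] [NormedSpace ℝ E]

/-- A linear combination of elements of a submodule given by its values on basis elements. -/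
theorem map_mem_of_mem_supported {ι M : Type} [AddCommGroup M] [Module R M] {A : Set ι}
    {f : (ι →₀ R) →ₗ[R] M} {N : Submodule R M} (h : ∀ i ∈ A, f (Finsupp.single i 1) ∈ N)
    {c : ι →₀ R} (hc : c ∈ Finsupp.supported R R A) : f c ∈ N := by
  rw [Finsupp.supported_eq_span_single] at hc
  refine (Submodule.span_le (p := N.comap f)).2 ?_ hc
  rintro _ ⟨i, hi, rfl⟩
  exact h i hi

/-- The tuples of vertices that lie in a given convex hull and have mutual distances at most `D`. -/
def fineTuples (co : V → E) (K : Set E) (D : ℝ) (m : ℕ) : Set (Fin (m + 1) → V) :=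
  {u | (∀ i, co (u i) ∈ convexHull ℝ K) ∧ ∀ i j, dist (co (u i)) (co (u j)) ≤ D}

theorem fineTuples_mono {co : V → E} {K K' : Set E} {D D' : ℝ} (hK : K ⊆ K') (hD : D ≤ D')
    (m : ℕ) : fineTuples co K D m ⊆ fineTuples co K' D' m :=
  fun _ hu => ⟨fun i => convexHull_mono hK (hu.1 i), fun i j => (hu.2 i j).trans hD⟩

theorem dist_centroid_le {m : ℕ} {w : Fin (m + 1) → E} {D : ℝ}
    (hw : ∀ i j, dist (w i) (w j) ≤ D) {x : E} (hx : x ∈ convexHull ℝ (Set.range w)) :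
    dist x ((m + 1 : ℝ)⁻¹ • ∑ i, w i) ≤ m / (m + 1) * D := by
  have hm : (0 : ℝ) < m + 1 := by positivity
  have key : Set.range w ⊆ Metric.closedBall ((m + 1 : ℝ)⁻¹ • ∑ i, w i) (m / (m + 1) * D) := by
    rintro _ ⟨j, rfl⟩
    rw [Metric.mem_closedBall, dist_eq_norm]
    have h1 : w j - (m + 1 : ℝ)⁻¹ • ∑ i, w i = (m + 1 : ℝ)⁻¹ • ∑ i, (w j - w i) := by
      rw [Finset.sum_sub_distrib, smul_sub, Finset.sum_const, Finset.card_univ, Fintype.card_fin,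
        ← Nat.cast_smul_eq_nsmul ℝ, smul_smul]
      push_cast
      rw [inv_mul_cancel₀ hm.ne', one_smul]
    rw [h1, norm_smul, norm_inv, Real.norm_of_nonneg hm.le]
    have h2 : ‖∑ i, (w j - w i)‖ ≤ m * D := by
      rw [← Finset.sum_erase_add _ _ (Finset.mem_univ j), sub_self, add_zero]
      refine (norm_sum_le _ _).trans ?_
      refine (Finset.sum_le_card_nsmul _ _ D fun i _ => ?_).trans ?_
      · rw [← dist_eq_norm]
        exact hw j i
      · rw [Finset.card_erase_of_mem (Finset.mem_univ j), Finset.card_univ, Fintype.card_fin]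
        simp
    calc (m + 1 : ℝ)⁻¹ * ‖∑ i, (w j - w i)‖ ≤ (m + 1 : ℝ)⁻¹ * (m * D) := by gcongr
      _ = m / (m + 1) * D := by ring
  exact convexHull_min key (convex_closedBall _ _) hx

/-- The simplices of the barycentric subdivision of an `m`-simplex are smaller than the simplex
itself by the factor `m / (m + 1)`. -/
theorem orderedSd_single_mem {β : ∀ m, (Fin (m + 1) → V) → V} {co : V → E}
    (hβ : ∀ m w, co (β m w) = (m + 1 : ℝ)⁻¹ • ∑ i, co (w i)) (m : ℕ) (w : Fin (m + 1) → V) {D : ℝ}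
    (hD : 0 ≤ D) (hw : ∀ i j, dist (co (w i)) (co (w j)) ≤ D) :
    orderedSd R β m (Finsupp.single w 1) ∈
      Finsupp.supported R R (fineTuples co (Set.range (co ∘ w)) (m / (m + 1) * D) m) := by
  induction m with
  | zero =>
    refine Finsupp.single_mem_supported R 1 ⟨fun i => subset_convexHull ℝ _ ⟨i, rfl⟩, fun i j => ?_⟩
    rw [Subsingleton.elim (α := Fin 1) i j]
    simp
  | succ m ih =>
    rw [orderedSd_succ_single]
    have hmem : orderedSd R β m (orderedBoundary R V m (Finsupp.single w 1)) ∈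
        Finsupp.supported R R (fineTuples co (Set.range (co ∘ w)) (m / (m + 1) * D) m) := by
      rw [orderedBoundary_single, map_sum]
      refine Submodule.sum_mem _ fun i _ => ?_
      rw [map_smul]
      refine Submodule.smul_mem _ _ ?_
      refine Finsupp.supported_mono (fineTuples_mono ?_ le_rfl m)
        (ih (w ∘ i.succAbove) (fun a b => hw _ _))
      rintro _ ⟨k, rfl⟩
      exact ⟨_, rfl⟩
    refine map_mem_of_mem_supported (fun u hu => ?_) hmem
    rw [orderedCone_single]
    have hbar : co (β (m + 1) w) ∈ convexHull ℝ (Set.range (co ∘ w)) := by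
      rw [hβ, Finset.smul_sum]
      refine (convex_convexHull ℝ _).sum_mem (fun _ _ => by positivity) ?_
        (fun i _ => subset_convexHull ℝ _ ⟨i, rfl⟩)
      rw [Finset.sum_const, Finset.card_univ, Fintype.card_fin, nsmul_eq_mul]
      push_cast
      field_simp
    have hle : (m : ℝ) / (m + 1) * D ≤ ((m + 1 : ℕ) : ℝ) / ((m + 1 : ℕ) + 1) * D := by
      refine mul_le_mul_of_nonneg_right ?_ hD
      rw [div_le_div_iff₀ (by positivity) (by positivity)]
      push_cast
      nlinarith
    have hdist : ∀ k, dist (co (u k)) (co (β (m + 1) w)) ≤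
        ((m + 1 : ℕ) : ℝ) / ((m + 1 : ℕ) + 1) * D := by
      intro k
      rw [hβ]
      exact dist_centroid_le (w := co ∘ w) hw (hu.1 k)
    refine Finsupp.single_mem_supported R 1 ⟨fun i => ?_, fun i j => ?_⟩
    · refine Fin.cases ?_ (fun i => ?_) i
      · exact hbar
      · exact hu.1 i
    · refine Fin.cases ?_ (fun i => ?_) i <;> refine Fin.cases ?_ (fun j => ?_) j
      · simp only [dist_self]
        positivity
      · simp only [Fin.cons_zero, Fin.cons_succ]
        rw [dist_comm]
        exact hdist j
      · exact hdist i
      · exact (hu.2 i j).trans hle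

theorem orderedSd_mem {β : ∀ m, (Fin (m + 1) → V) → V} {co : V → E}
    (hβ : ∀ m w, co (β m w) = (m + 1 : ℝ)⁻¹ • ∑ i, co (w i)) (m : ℕ) {D : ℝ}
    (hD : 0 ≤ D) {c : OrderedChain R V m}
    (hc : c ∈ Finsupp.supported R R (fineTuples co Set.univ D m)) :
    orderedSd R β m c ∈
      Finsupp.supported R R (fineTuples co Set.univ (m / (m + 1) * D) m) :=
  map_mem_of_mem_supported (fun w hw => Finsupp.supported_mono
    (fineTuples_mono (Set.subset_univ _) le_rfl m) (orderedSd_single_mem hβ m w hD hw.2)) hc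

theorem orderedSd_iterate_mem {β : ∀ m, (Fin (m + 1) → V) → V} {co : V → E}
    (hβ : ∀ m w, co (β m w) = (m + 1 : ℝ)⁻¹ • ∑ i, co (w i)) (m k : ℕ) {D : ℝ}
    (hD : 0 ≤ D) {c : OrderedChain R V m}
    (hc : c ∈ Finsupp.supported R R (fineTuples co Set.univ D m)) :
    (orderedSd R β m)^[k] c ∈
      Finsupp.supported R R (fineTuples co Set.univ ((m / (m + 1)) ^ k * D) m) := by
  induction k with
  | zero => simpa using hc
  | succ k ih =>
    rw [Function.iterate_succ_apply', pow_succ', mul_assoc]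
    exact orderedSd_mem hβ m (by positivity) ih

end Mesh

/-! ### Small simplices -/

section SingularSubdivision

/-- The affine map between standard simplices with prescribed images of the vertices. -/
def affineSimplex {m n : ℕ} (w : Fin (m + 1) → stdSimplex ℝ (Fin (n + 1))) :
    C(stdSimplex ℝ (Fin (m + 1)), stdSimplex ℝ (Fin (n + 1))) where
  toFun t := ⟨∑ i, t.1 i • (w i).1, (convex_stdSimplex ℝ _).sum_mem (fun i _ => t.2.1 i) t.2.2
    (fun i _ => (w i).2)⟩
  continuous_toFun := by
    refine Continuous.subtype_mk ?_ _
    refine continuous_finsetSum _ fun i _ => ?_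
    exact ((continuous_apply i).comp continuous_subtype_val).smul continuous_const

theorem affineSimplex_apply {m n : ℕ} (w : Fin (m + 1) → stdSimplex ℝ (Fin (n + 1)))
    (t : stdSimplex ℝ (Fin (m + 1))) (k : Fin (n + 1)) :
    (affineSimplex w t).1 k = ∑ i, t.1 i * (w i).1 k := by
  simp [affineSimplex]

theorem affineSimplex_comp {l m n : ℕ} (w : Fin (m + 1) → stdSimplex ℝ (Fin (n + 1)))
    (u : Fin (l + 1) → stdSimplex ℝ (Fin (m + 1))) :
    (affineSimplex w).comp (affineSimplex u) = affineSimplex (affineSimplex w ∘ u) := by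
  refine ContinuousMap.ext fun t => Subtype.ext (funext fun k => ?_)
  simp only [ContinuousMap.comp_apply, Function.comp_apply, affineSimplex_apply, Finset.sum_mul,
    Finset.mul_sum, mul_assoc]
  exact Finset.sum_comm

/-- The tuple of vertices of the standard simplex. -/
def stdVertices (n : ℕ) : Fin (n + 1) → stdSimplex ℝ (Fin (n + 1)) := fun i => stdSimplex.vertex i

theorem stdVertices_apply (n : ℕ) (i k : Fin (n + 1)) :
    (stdVertices n i).1 k = if k = i then 1 else 0 :=
  Pi.single_apply (M := ℝ) i 1 k

theorem affineSimplex_stdVertices (n : ℕ) : affineSimplex (stdVertices n) = ContinuousMap.id _ := by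
  refine ContinuousMap.ext fun t => Subtype.ext (funext fun k => ?_)
  simp [affineSimplex_apply, stdVertices_apply]

theorem affineSimplex_vertex {m n : ℕ} (w : Fin (m + 1) → stdSimplex ℝ (Fin (n + 1)))
    (i : Fin (m + 1)) : affineSimplex w (stdVertices m i) = w i := by
  refine Subtype.ext (funext fun k => ?_)
  simp [affineSimplex_apply, stdVertices_apply]

theorem stdFace_eq_affineSimplex (n : ℕ) (i : Fin (n + 2)) :
    stdFace n i = affineSimplex (stdVertices (n + 1) ∘ i.succAbove) := by
  refine ContinuousMap.ext fun t => Subtype.ext (funext fun k => ?_)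
  rw [affineSimplex_apply]
  refine (FunOnFinite.linearMap_apply_apply ℝ ℝ _ _ _).trans ?_
  rw [Finset.sum_filter]
  refine Finset.sum_congr rfl fun j _ => ?_
  rw [Function.comp_apply, stdVertices_apply]
  simp [eq_comm]
  rfl

theorem affineSimplex_comp_stdFace {m n : ℕ} (w : Fin (m + 2) → stdSimplex ℝ (Fin (n + 1)))
    (i : Fin (m + 2)) :
    (affineSimplex w).comp (stdFace m i) = affineSimplex (w ∘ i.succAbove) := by
  rw [stdFace_eq_affineSimplex, affineSimplex_comp]
  congr 1
  funext k
  exact affineSimplex_vertex w _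

/-- The barycentre of a tuple of points of a standard simplex. -/
def simplexBarycenter (n m : ℕ) (w : Fin (m + 1) → stdSimplex ℝ (Fin (n + 1))) :
    stdSimplex ℝ (Fin (n + 1)) :=
  affineSimplex w stdSimplex.barycenter

theorem simplexBarycenter_val (n m : ℕ) (w : Fin (m + 1) → stdSimplex ℝ (Fin (n + 1))) :
    (simplexBarycenter n m w).1 = (m + 1 : ℝ)⁻¹ • ∑ i, (w i).1 := by
  simp [simplexBarycenter, affineSimplex, stdSimplex.barycenter, Finset.smul_sum]

theorem affineSimplex_barycenter {l m n : ℕ} (w : Fin (m + 1) → stdSimplex ℝ (Fin (n + 1)))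
    (u : Fin (l + 1) → stdSimplex ℝ (Fin (m + 1))) :
    affineSimplex w (simplexBarycenter m l u) = simplexBarycenter n l (affineSimplex w ∘ u) := by
  rw [simplexBarycenter, simplexBarycenter, ← affineSimplex_comp]
  rfl

variable (R : Type) [CommRing R] {X : Type} [TopologicalSpace X]

/-- The singular chain in `X` defined by an ordered chain on the points of a standard simplex and
a singular simplex of `X`. -/
def pushChain {n : ℕ} (σ : SingularSimplex X n) (m : ℕ) :
    OrderedChain R (stdSimplex ℝ (Fin (n + 1))) m →ₗ[R] SingularChain R X m :=
  Finsupp.lmapDomain R R (fun w => σ.comp (affineSimplex w))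

variable {R}

@[simp]
theorem pushChain_single {n : ℕ} (σ : SingularSimplex X n) (m : ℕ)
    (w : Fin (m + 1) → stdSimplex ℝ (Fin (n + 1))) (a : R) :
    pushChain R σ m (Finsupp.single w a) = Finsupp.single (σ.comp (affineSimplex w)) a := by
  simp [pushChain]

theorem pushChain_boundary {n : ℕ} (σ : SingularSimplex X n) (m : ℕ)
    (c : OrderedChain R (stdSimplex ℝ (Fin (n + 1))) (m + 1)) :
    pushChain R σ m (orderedBoundary R _ m c) =
      singularBoundary R X m (pushChain R σ (m + 1) c) := by
  have : pushChain R σ m ∘ₗ orderedBoundary R _ m =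
      singularBoundary R X m ∘ₗ pushChain R σ (m + 1) := by
    refine linearMap_ext_single fun w => ?_
    simp [map_sum, ContinuousMap.comp_assoc, affineSimplex_comp_stdFace]
  exact LinearMap.congr_fun this c

theorem pushChain_comp {n k : ℕ} (σ : SingularSimplex X n)
    (w : Fin (k + 1) → stdSimplex ℝ (Fin (n + 1))) (m : ℕ)
    (c : OrderedChain R (stdSimplex ℝ (Fin (k + 1))) m) :
    pushChain R (σ.comp (affineSimplex w)) m c =
      pushChain R σ m (orderedMap (affineSimplex w) m c) := by
  have : pushChain R (σ.comp (affineSimplex w)) m =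
      pushChain R σ m ∘ₗ orderedMap (affineSimplex w) m := by
    refine linearMap_ext_single fun u => ?_
    simp [ContinuousMap.comp_assoc, affineSimplex_comp]
  exact LinearMap.congr_fun this c

theorem pushChain_stdVertices {n : ℕ} (σ : SingularSimplex X n) :
    pushChain R σ n (Finsupp.single (stdVertices n) 1) = Finsupp.single σ 1 := by
  rw [pushChain_single, affineSimplex_stdVertices, ContinuousMap.comp_id]

theorem orderedMap_stdVertices {m n : ℕ} (w : Fin (m + 1) → stdSimplex ℝ (Fin (n + 1))) :
    orderedMap (R := R) (affineSimplex w) m (Finsupp.single (stdVertices m) 1) =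
      Finsupp.single w 1 := by
  rw [Finsupp.lmapDomain_apply, Finsupp.mapDomain_single]
  congr 1
  funext i
  exact affineSimplex_vertex w i

variable (R X) in
theorem singularBoundary_boundary (n : ℕ) :
    singularBoundary R X n ∘ₗ singularBoundary R X (n + 1) = 0 := by
  refine linearMap_ext_single fun σ => ?_
  rw [← pushChain_stdVertices, LinearMap.comp_apply, ← pushChain_boundary, ← pushChain_boundary,
    orderedBoundary_boundary, map_zero, LinearMap.zero_apply]

variable (R X) in
/-- Barycentric subdivision of singular chains. -/
def singularSd (n : ℕ) : SingularChain R X n →ₗ[R] SingularChain R X n :=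
  Finsupp.linearCombination R (fun σ => pushChain R σ n
    (orderedSd R (simplexBarycenter n) n (Finsupp.single (stdVertices n) 1)))

variable (R X) in
/-- The chain homotopy from the identity to barycentric subdivision of singular chains. -/
def singularSdHomotopy (n : ℕ) : SingularChain R X n →ₗ[R] SingularChain R X (n + 1) :=
  Finsupp.linearCombination R (fun σ => pushChain R σ (n + 1)
    (orderedSdHomotopy R (simplexBarycenter n) n (Finsupp.single (stdVertices n) 1)))

theorem singularSd_single {n : ℕ} (σ : SingularSimplex X n) :
    singularSd R X n (Finsupp.single σ 1) = pushChain R σ n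
      (orderedSd R (simplexBarycenter n) n (Finsupp.single (stdVertices n) 1)) := by
  rw [singularSd, Finsupp.linearCombination_single, one_smul]

theorem singularSdHomotopy_single {n : ℕ} (σ : SingularSimplex X n) :
    singularSdHomotopy R X n (Finsupp.single σ 1) = pushChain R σ (n + 1)
      (orderedSdHomotopy R (simplexBarycenter n) n (Finsupp.single (stdVertices n) 1)) := by
  rw [singularSdHomotopy, Finsupp.linearCombination_single, one_smul]

theorem singularSd_pushChain {n : ℕ} (σ : SingularSimplex X n) (m : ℕ)
    (c : OrderedChain R (stdSimplex ℝ (Fin (n + 1))) m) :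
    singularSd R X m (pushChain R σ m c) =
      pushChain R σ m (orderedSd R (simplexBarycenter n) m c) := by
  have : singularSd R X m ∘ₗ pushChain R σ m =
      pushChain R σ m ∘ₗ orderedSd R (simplexBarycenter n) m := by
    refine linearMap_ext_single fun w => ?_
    rw [LinearMap.comp_apply, pushChain_single, singularSd_single, pushChain_comp,
      orderedMap_sd (fun k u => affineSimplex_barycenter w u), orderedMap_stdVertices]
    rfl
  exact LinearMap.congr_fun this c

theorem singularSdHomotopy_pushChain {n : ℕ} (σ : SingularSimplex X n) (m : ℕ)
    (c : OrderedChain R (stdSimplex ℝ (Fin (n + 1))) m) :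
    singularSdHomotopy R X m (pushChain R σ m c) =
      pushChain R σ (m + 1) (orderedSdHomotopy R (simplexBarycenter n) m c) := by
  have : singularSdHomotopy R X m ∘ₗ pushChain R σ m =
      pushChain R σ (m + 1) ∘ₗ orderedSdHomotopy R (simplexBarycenter n) m := by
    refine linearMap_ext_single fun w => ?_
    rw [LinearMap.comp_apply, pushChain_single, singularSdHomotopy_single, pushChain_comp,
      orderedMap_sdHomotopy (fun k u => affineSimplex_barycenter w u), orderedMap_stdVertices]
    rfl
  exact LinearMap.congr_fun this c

theorem singularBoundary_sd (n : ℕ) (c : SingularChain R X (n + 1)) :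
    singularBoundary R X n (singularSd R X (n + 1) c) =
      singularSd R X n (singularBoundary R X n c) := by
  have : singularBoundary R X n ∘ₗ singularSd R X (n + 1) =
      singularSd R X n ∘ₗ singularBoundary R X n := by
    refine linearMap_ext_single fun σ => ?_
    rw [← pushChain_stdVertices, LinearMap.comp_apply, LinearMap.comp_apply, singularSd_pushChain,
      ← pushChain_boundary, ← pushChain_boundary, singularSd_pushChain, orderedBoundary_sd]
  exact LinearMap.congr_fun this c

theorem singularBoundary_sdHomotopy (n : ℕ) (c : SingularChain R X (n + 1)) :
    singularBoundary R X (n + 1) (singularSdHomotopy R X (n + 1) c) +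
      singularSdHomotopy R X n (singularBoundary R X n c) = c - singularSd R X (n + 1) c := by
  have : singularBoundary R X (n + 1) ∘ₗ singularSdHomotopy R X (n + 1) +
      singularSdHomotopy R X n ∘ₗ singularBoundary R X n =
        LinearMap.id - singularSd R X (n + 1) := by
    refine linearMap_ext_single fun σ => ?_
    rw [← pushChain_stdVertices, LinearMap.add_apply, LinearMap.comp_apply, LinearMap.comp_apply,
      LinearMap.sub_apply, singularSd_pushChain, singularSdHomotopy_pushChain,
      ← pushChain_boundary, ← pushChain_boundary, singularSdHomotopy_pushChain, ← map_add,
      orderedBoundary_sdHomotopy, map_sub, LinearMap.id_apply]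
  exact LinearMap.congr_fun this c

variable (R) in
/-- The chains all of whose simplices lie in one of the sets `U i`. -/
def smallChains {ι : Type} (U : ι → Set X) (n : ℕ) : Submodule R (SingularChain R X n) :=
  Finsupp.supported R R {σ : SingularSimplex X n | ∃ i, Set.range σ ⊆ U i}

variable {ι : Type} {U : ι → Set X}

theorem pushChain_mem_smallChains {n : ℕ} {σ : SingularSimplex X n}
    (hσ : ∃ i, Set.range σ ⊆ U i) (m : ℕ) (c : OrderedChain R (stdSimplex ℝ (Fin (n + 1))) m) :
    pushChain R σ m c ∈ smallChains R U m := by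
  obtain ⟨i, hi⟩ := hσ
  refine map_mem_of_mem_supported (A := Set.univ) (fun w _ => ?_) (by simp)
  rw [pushChain_single]
  exact Finsupp.single_mem_supported R 1 ⟨i,
    (Set.range_comp_subset_range (affineSimplex w) σ).trans hi⟩

theorem singularSd_mem_smallChains {n : ℕ} {c : SingularChain R X n}
    (hc : c ∈ smallChains R U n) : singularSd R X n c ∈ smallChains R U n :=
  map_mem_of_mem_supported (fun σ hσ => by
    rw [singularSd_single]
    exact pushChain_mem_smallChains hσ _ _) hc

theorem singularSdHomotopy_mem_smallChains {n : ℕ} {c : SingularChain R X n}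
    (hc : c ∈ smallChains R U n) : singularSdHomotopy R X n c ∈ smallChains R U (n + 1) :=
  map_mem_of_mem_supported (fun σ hσ => by
    rw [singularSdHomotopy_single]
    exact pushChain_mem_smallChains hσ _ _) hc

theorem singularBoundary_mem_smallChains {n : ℕ} {c : SingularChain R X (n + 1)}
    (hc : c ∈ smallChains R U (n + 1)) : singularBoundary R X n c ∈ smallChains R U n :=
  map_mem_of_mem_supported (fun σ hσ => by
    rw [← pushChain_stdVertices, ← pushChain_boundary]
    exact pushChain_mem_smallChains hσ _ _) hc

theorem iterate_singularSd_mem_smallChains_of_le {n k l : ℕ} (hkl : k ≤ l)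
    {c : SingularChain R X n} (hc : (singularSd R X n)^[k] c ∈ smallChains R U n) :
    (singularSd R X n)^[l] c ∈ smallChains R U n := by
  induction l, hkl using Nat.le_induction with
  | base => exact hc
  | succ l _ ih =>
    rw [Function.iterate_succ_apply']
    exact singularSd_mem_smallChains ih

theorem dist_affineSimplex_le {m n : ℕ} {w : Fin (m + 1) → stdSimplex ℝ (Fin (n + 1))} {D : ℝ}
    (hw : ∀ i j, dist (w i).1 (w j).1 ≤ D) (t : stdSimplex ℝ (Fin (m + 1))) :
    dist (affineSimplex w t) (w 0) ≤ D := by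
  have h : (affineSimplex w t).1 ∈ Metric.closedBall (w 0).1 D :=
    (convex_closedBall _ _).sum_mem (fun i _ => t.2.1 i) t.2.2 (fun i _ => hw i 0)
  exact h

/-- Iterated barycentric subdivision makes every chain small with respect to an open cover. -/
theorem exists_iterate_singularSd_mem_smallChains (hU : ∀ i, IsOpen (U i))
    (hcov : ⋃ i, U i = Set.univ) {n : ℕ} (c : SingularChain R X n) :
    ∃ k, (singularSd R X n)^[k] c ∈ smallChains R U n := by
  induction c using Finsupp.induction_linear with
  | zero => exact ⟨0, Submodule.zero_mem _⟩
  | add f g hf hg =>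
    obtain ⟨k, hk⟩ := hf
    obtain ⟨l, hl⟩ := hg
    refine ⟨max k l, ?_⟩
    rw [iterate_map_add]
    exact Submodule.add_mem _ (iterate_singularSd_mem_smallChains_of_le (le_max_left _ _) hk)
      (iterate_singularSd_mem_smallChains_of_le (le_max_right _ _) hl)
  | single σ a =>
    -- `σ` maps simplices smaller than the Lebesgue number `δ` into a set of the cover
    obtain ⟨δ, hδ, hball⟩ := lebesgue_number_lemma_of_metric (s := Set.univ)
      (c := fun i => σ ⁻¹' U i) isCompact_univ (fun i => (hU i).preimage σ.continuous)
      (by rw [← Set.preimage_iUnion, hcov, Set.preimage_univ])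
    have hlt : (n : ℝ) / (n + 1) < 1 := by
      rw [div_lt_one (by positivity)]
      linarith
    obtain ⟨k, hk⟩ := exists_pow_lt_of_lt_one (half_pos hδ) hlt
    refine ⟨k, ?_⟩
    have hpush : ∀ j, (singularSd R X n)^[j] (Finsupp.single σ a) =
        a • pushChain R σ n
          ((orderedSd R (simplexBarycenter n) n)^[j] (Finsupp.single (stdVertices n) 1)) := by
      intro j
      induction j with
      | zero =>
        rw [Function.iterate_zero, Function.iterate_zero, id, id, pushChain_stdVertices,
          Finsupp.smul_single_one]
      | succ j ih =>
        rw [Function.iterate_succ_apply', Function.iterate_succ_apply', ih, map_smul,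
          singularSd_pushChain]
    rw [hpush]
    refine Submodule.smul_mem _ _ ?_
    have hmem := orderedSd_iterate_mem (R := R) (β := simplexBarycenter n) (co := Subtype.val)
      (fun m w => simplexBarycenter_val n m w) n k (D := 2) zero_le_two
      (c := Finsupp.single (stdVertices n) 1)
      (Finsupp.single_mem_supported R 1 ⟨fun i => subset_convexHull ℝ _ (Set.mem_univ _),
        fun i j => by
          have h1 := stdSimplex_subset_closedBall (stdVertices n i).2
          have h2 := stdSimplex_subset_closedBall (stdVertices n j).2
          rw [Metric.mem_closedBall] at h1 h2
          have := dist_triangle_right (stdVertices n i).1 (stdVertices n j).1 0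
          linarith⟩)
    refine map_mem_of_mem_supported (fun w hw => ?_) hmem
    rw [pushChain_single]
    obtain ⟨i, hi⟩ := hball (w 0) (Set.mem_univ _)
    refine Finsupp.single_mem_supported R 1 ⟨i, ?_⟩
    rintro _ ⟨t, rfl⟩
    refine hi ?_
    rw [Metric.mem_ball]
    refine (dist_affineSimplex_le hw.2 t).trans_lt ?_
    linarith

/-- Modulo chains that are small with respect to an open cover, the singular chain complex is
exact. -/
theorem exists_sub_boundary_mem_smallChains (hU : ∀ i, IsOpen (U i))
    (hcov : ⋃ i, U i = Set.univ) {n : ℕ} (c : SingularChain R X (n + 1))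
    (hc : singularBoundary R X n c ∈ smallChains R U n) :
    ∃ e, c - singularBoundary R X (n + 1) e ∈ smallChains R U (n + 1) := by
  obtain ⟨k, hk⟩ := exists_iterate_singularSd_mem_smallChains hU hcov c
  induction k generalizing c with
  | zero => exact ⟨0, by simpa using hk⟩
  | succ k ih =>
    obtain ⟨e, he⟩ := ih (singularSd R X (n + 1) c)
      (by rw [singularBoundary_sd]; exact singularSd_mem_smallChains hc) hk
    refine ⟨e + singularSdHomotopy R X (n + 1) c, ?_⟩
    have h := singularBoundary_sdHomotopy n c
    have : c - singularBoundary R X (n + 1) (e + singularSdHomotopy R X (n + 1) c) =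
        (singularSd R X (n + 1) c - singularBoundary R X (n + 1) e) +
          singularSdHomotopy R X n (singularBoundary R X n c) := by
      rw [map_add, eq_sub_of_add_eq h]
      abel
    rw [this]
    exact Submodule.add_mem _ he (singularSdHomotopy_mem_smallChains hc)

theorem smallChains_zero (hcov : ⋃ i, U i = Set.univ) : smallChains R U 0 = ⊤ := by
  rw [eq_top_iff]
  intro c _
  refine map_mem_of_mem_supported (f := (LinearMap.id : SingularChain R X 0 →ₗ[R] _))
    (A := Set.univ) (fun σ _ => ?_) (by simp)
  obtain ⟨i, hi⟩ := Set.mem_iUnion.1 (hcov.ge (Set.mem_univ (σ (stdVertices 0 0))))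
  refine Finsupp.single_mem_supported R 1 ⟨i, ?_⟩
  rintro _ ⟨t, rfl⟩
  have : t = stdVertices 0 0 := Subsingleton.elim (α := stdSimplex ℝ (Fin 1)) _ _
  rw [this]
  exact hi

end SingularSubdivision

end

section

open CategoryTheory

/-! ### Complexes of modules and subcomplexes -/

section LinearComplexes

variable {R : Type} [CommRing R]

theorem linearChainComplex_d (M : ℕ → Type) [∀ n, AddCommGroup (M n)] [∀ n, Module R (M n)]
    (d : ∀ n, M (n + 1) →ₗ[R] M n) (h : ∀ n, d n ∘ₗ d (n + 1) = 0) (n : ℕ) :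
    (linearChainComplex R M d h).d (n + 1) n = ModuleCat.ofHom (d n) :=
  ChainComplex.of_d (fun n => ModuleCat.of R (M n)) (fun n => ModuleCat.ofHom (d n)) n

theorem linearChainComplex_subsingleton_homology (M : ℕ → Type) [∀ n, AddCommGroup (M n)]
    [∀ n, Module R (M n)] (d : ∀ n, M (n + 1) →ₗ[R] M n) (h : ∀ n, d n ∘ₗ d (n + 1) = 0)
    (h₀ : Function.Surjective (d 0)) (h₁ : ∀ n x, d n x = 0 → ∃ y, d (n + 1) y = x) (k : ℕ) :
    Subsingleton ((linearChainComplex R M d h).homology k) := by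
  refine ModuleCat.subsingleton_of_isZero
    ((HomologicalComplex.exactAt_iff_isZero_homology _ _).1 ?_)
  cases k with
  | zero =>
    rw [HomologicalComplex.exactAt_iff' _ 1 0 0 (by simp) (by simp),
      ShortComplex.moduleCat_exact_iff]
    intro x _
    obtain ⟨y, hy⟩ := h₀ x
    refine ⟨y, Eq.trans ?_ hy⟩
    exact congrArg (fun f => f.hom y) (linearChainComplex_d M d h 0)
  | succ k =>
    rw [HomologicalComplex.exactAt_iff' _ (k + 2) (k + 1) k (by simp) (by simp),
      ShortComplex.moduleCat_exact_iff]
    intro x hx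
    obtain ⟨y, hy⟩ := h₁ k x
      (Eq.trans (congrArg (fun f => f.hom x) (linearChainComplex_d M d h k)).symm hx)
    refine ⟨y, Eq.trans ?_ hy⟩
    exact congrArg (fun f => f.hom y) (linearChainComplex_d M d h (k + 1))

variable {A B C : ℕ → Type} [∀ n, AddCommGroup (A n)] [∀ n, Module R (A n)]
    [∀ n, AddCommGroup (B n)] [∀ n, Module R (B n)] [∀ n, AddCommGroup (C n)]
    [∀ n, Module R (C n)]
    {dA : ∀ n, A (n + 1) →ₗ[R] A n} {hA : ∀ n, dA n ∘ₗ dA (n + 1) = 0}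
    {dB : ∀ n, B (n + 1) →ₗ[R] B n} {hB : ∀ n, dB n ∘ₗ dB (n + 1) = 0}
    {dC : ∀ n, C (n + 1) →ₗ[R] C n} {hC : ∀ n, dC n ∘ₗ dC (n + 1) = 0}

/-- The chain map given by linear maps commuting with the boundary operators. -/
def linearChainMap (f : ∀ n, A n →ₗ[R] B n) (hf : ∀ n x, dB n (f (n + 1) x) = f n (dA n x)) :
    linearChainComplex R A dA hA ⟶ linearChainComplex R B dB hB where
  f n := ModuleCat.ofHom (f n)
  comm' := by
    rintro i j (rfl : j + 1 = i)
    rw [linearChainComplex_d, linearChainComplex_d]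
    exact ModuleCat.hom_ext (LinearMap.ext fun x => hf j x)

theorem exists_linear_shortExact (f : ∀ n, A n →ₗ[R] B n)
    (hf : ∀ n x, dB n (f (n + 1) x) = f n (dA n x)) (g : ∀ n, B n →ₗ[R] C n)
    (hg : ∀ n x, dC n (g (n + 1) x) = g n (dB n x)) (hinj : ∀ n, Function.Injective (f n))
    (hex : ∀ n, Function.Exact (f n) (g n)) (hsurj : ∀ n, Function.Surjective (g n)) :
    ∃ S : ShortComplex (ChainComplex (ModuleCat.{0} R) ℕ), S.ShortExact ∧
      S.X₁ = linearChainComplex R A dA hA ∧ S.X₂ = linearChainComplex R B dB hB ∧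
      S.X₃ = linearChainComplex R C dC hC := by
  refine ⟨ShortComplex.mk (linearChainMap (hA := hA) (hB := hB) f hf)
    (linearChainMap (hA := hB) (hB := hC) g hg) ?_, ?_, rfl, rfl, rfl⟩
  · refine HomologicalComplex.hom_ext _ _ fun n =>
      ModuleCat.hom_ext (LinearMap.ext fun x => ?_)
    exact (hex n).apply_apply_eq_zero x
  · refine HomologicalComplex.shortExact_of_degreewise_shortExact _ fun n => ?_
    refine ShortComplex.ShortExact.mk' ?_ ((ModuleCat.mono_iff_injective _).2 (hinj n))
      ((ModuleCat.epi_iff_surjective _).2 (hsurj n))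
    rw [ShortComplex.ShortExact.moduleCat_exact_iff_function_exact]
    exact hex n

/-- A subcomplex modulo which every relative cycle is a boundary has the same finiteness
properties and Euler characteristic as the whole complex. -/
theorem hasFGTotalHomology_of_subcomplex [IsDomain R] [IsNoetherianRing R]
    (hB : ∀ n, dB n ∘ₗ dB (n + 1) = 0) (N : ∀ n, Submodule R (B n))
    (hN : ∀ n x, x ∈ N (n + 1) → dB n x ∈ N n) (h₀ : N 0 = ⊤)
    (h₁ : ∀ n x, dB n x ∈ N n → ∃ y, x - dB (n + 1) y ∈ N (n + 1))
    {d : ∀ n, N (n + 1) →ₗ[R] N n} (hd : ∀ n x, (d n x : B n) = dB n x)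
    (hdd : ∀ n, d n ∘ₗ d (n + 1) = 0)
    (h : HasFGTotalHomology (linearChainComplex R (fun n => N n) d hdd)) :
    HasFGTotalHomology (linearChainComplex R B dB hB) ∧
      (linearChainComplex R B dB hB).homologyEulerChar =
        (linearChainComplex R (fun n => N n) d hdd).homologyEulerChar := by
  let dQ : ∀ n, (B (n + 1) ⧸ N (n + 1)) →ₗ[R] (B n ⧸ N n) := fun n =>
    Submodule.mapQ _ _ (dB n) fun x hx => hN n x hx
  have hQ : ∀ n, dQ n ∘ₗ dQ (n + 1) = 0 := by
    intro n
    refine Submodule.linearMap_qext _ (LinearMap.ext fun x => ?_)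
    have := LinearMap.congr_fun (hB n) x
    simp only [LinearMap.comp_apply, LinearMap.zero_apply] at this
    simp [dQ, this]
  obtain ⟨S, hS, e₁, e₂, e₃⟩ := exists_linear_shortExact (hA := hdd) (hB := hB) (hC := hQ)
    (fun n => (N n).subtype) (fun n x => (hd n x).symm)
    (fun n => (N n).mkQ) (fun n x => rfl)
    (fun n => Subtype.val_injective)
    (fun n => LinearMap.exact_subtype_mkQ _)
    (fun n => Submodule.mkQ_surjective _)
  have hzero := HasFGTotalHomology.of_subsingleton (R := R)
    (linearChainComplex_subsingleton_homology (R := R) (fun n => B n ⧸ N n) dQ hQ (by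
      have : Subsingleton (B 0 ⧸ N 0) := by
        rw [h₀]
        infer_instance
      exact fun x => ⟨0, Subsingleton.elim _ _⟩) (by
      intro n x hx
      obtain ⟨c, rfl⟩ := Submodule.mkQ_surjective _ x
      have hc : dB n c ∈ N n := by
        rw [← Submodule.Quotient.mk_eq_zero]
        exact hx
      obtain ⟨e, he⟩ := h₁ n c hc
      refine ⟨Submodule.Quotient.mk e, ?_⟩
      refine ((Submodule.Quotient.eq (N (n + 1))).2 ?_ :
        Submodule.Quotient.mk (dB (n + 1) e) = Submodule.Quotient.mk c)
      rw [← neg_mem_iff, neg_sub]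
      exact he))
  rw [← e₁] at h
  rw [← e₃] at hzero
  have hmid := HasFGTotalHomology.middle hS h hzero.1
  have hχ := homologyEulerChar_shortExact hS h hmid hzero.1
  rw [hzero.2, add_zero] at hχ
  rw [← e₁, ← e₂]
  exact ⟨hmid, hχ⟩

end LinearComplexes

/-! ### The Mayer–Vietoris principle -/

section MayerVietoris

variable (R : Type) [CommRing R]

/-- The singular chain complex on finitely supported functions. -/
def concreteChains (X : Type) [TopologicalSpace X] : ChainComplex (ModuleCat.{0} R) ℕ :=
  linearChainComplex R (SingularChain R X) (singularBoundary R X) (singularBoundary_boundary R X)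

/-- Mathlib's singular chain complex is isomorphic to the one on finitely supported functions. -/
def singularChainsIso (X : Type) [TopologicalSpace X] : singularChains X ≅ concreteChains ℤ X :=
  HomologicalComplex.Hom.isoOfComponents (fun n => singularChainsXIso X n) (by
    rintro i j (rfl : j + 1 = i)
    refine Eq.trans ?_ (singularChainsXIso_comm X j)
    congr 1
    exact (ChainComplex.of_d (fun n => ModuleCat.of ℤ (SingularChain ℤ X n))
      (fun n => ModuleCat.ofHom (singularBoundary ℤ X n)) j))

variable {X Y : Type} [TopologicalSpace X] [TopologicalSpace Y]

/-- The map on singular chains induced by a continuous map. -/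
def singularMap (f : C(X, Y)) (n : ℕ) : SingularChain R X n →ₗ[R] SingularChain R Y n :=
  Finsupp.lmapDomain R R (fun σ => f.comp σ)

variable {R}

@[simp]
theorem singularMap_single (f : C(X, Y)) (n : ℕ) (σ : SingularSimplex X n) (a : R) :
    singularMap R f n (Finsupp.single σ a) = Finsupp.single (f.comp σ) a := by
  simp [singularMap]

theorem singularBoundary_map (f : C(X, Y)) (n : ℕ) (c : SingularChain R X (n + 1)) :
    singularBoundary R Y n (singularMap R f (n + 1) c) =
      singularMap R f n (singularBoundary R X n c) := by
  have : singularBoundary R Y n ∘ₗ singularMap R f (n + 1) =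
      singularMap R f n ∘ₗ singularBoundary R X n := by
    refine linearMap_ext_single fun σ => ?_
    simp [map_sum, ContinuousMap.comp_assoc]
  exact LinearMap.congr_fun this c

/-- The inclusion of a subset as a continuous map. -/
abbrev subsetIncl (A : Set X) : C(A, X) := ⟨Subtype.val, continuous_subtype_val⟩

theorem singularMap_subsetIncl_injective (A : Set X) (n : ℕ) :
    Function.Injective (singularMap R (subsetIncl A) n) := by
  refine Finsupp.mapDomain_injective fun σ τ h => ContinuousMap.ext fun t => Subtype.ext ?_
  exact congrArg (fun f => f t) h

theorem singularMap_subsetIncl_range (A : Set X) (n : ℕ) :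
    (singularMap R (subsetIncl A) n).range =
      Finsupp.supported R R {σ : SingularSimplex X n | Set.range σ ⊆ A} := by
  apply le_antisymm
  · rintro _ ⟨c, rfl⟩
    refine map_mem_of_mem_supported (A := Set.univ) (fun σ _ => ?_) (by simp)
    rw [singularMap_single]
    refine Finsupp.single_mem_supported R 1 ?_
    rintro _ ⟨t, rfl⟩
    exact (σ t).2
  · intro c hc
    refine map_mem_of_mem_supported (f := (LinearMap.id : SingularChain R X n →ₗ[R] _))
      (fun σ hσ => ?_) hc
    refine ⟨Finsupp.single ⟨fun t => ⟨σ t, hσ ⟨t, rfl⟩⟩, by fun_prop⟩ 1, ?_⟩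
    rw [singularMap_single]
    rfl

theorem singularMap_comp {Z : Type} [TopologicalSpace Z] (f : C(X, Y)) (g : C(Y, Z)) (n : ℕ)
    (c : SingularChain R X n) :
    singularMap R g n (singularMap R f n c) = singularMap R (g.comp f) n c := by
  have : singularMap R g n ∘ₗ singularMap R f n = singularMap R (g.comp f) n := by
    refine linearMap_ext_single fun σ => ?_
    simp [ContinuousMap.comp_assoc]
  exact LinearMap.congr_fun this c

variable (R)

/-- Inclusion–exclusion for two open sets. The chains that are small with respect to the cover are
the sum of the chains of `U` and of `V`, hence the cokernel of the chains of `U ∩ V` in their direct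
sum, and they compute the homology of `X`. The direct sum is built from its two summands by another
short exact sequence. -/
theorem concreteChains_mayerVietoris [IsDomain R] [IsNoetherianRing R] {U V : Set X}
    (hU : IsOpen U) (hV : IsOpen V) (hUV : U ∪ V = Set.univ)
    (fU : HasFGTotalHomology (concreteChains R U)) (fV : HasFGTotalHomology (concreteChains R V))
    (fI : HasFGTotalHomology (concreteChains R (U ∩ V : Set X))) :
    HasFGTotalHomology (concreteChains R X) ∧
      (concreteChains R X).homologyEulerChar + (concreteChains R (U ∩ V : Set X)).homologyEulerChar
        = (concreteChains R U).homologyEulerChar + (concreteChains R V).homologyEulerChar := by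
  let cov : Bool → Set X := fun b => cond b U V
  have hcov : ⋃ b, cov b = Set.univ := by
    rw [← hUV, Set.union_eq_iUnion]
  have hopen : ∀ b, IsOpen (cov b) := fun b => by cases b <;> assumption
  have hsmall : ∀ n, smallChains R cov n = (singularMap R (subsetIncl U) n).range ⊔
      (singularMap R (subsetIncl V) n).range := by
    intro n
    rw [singularMap_subsetIncl_range, singularMap_subsetIncl_range, ← Finsupp.supported_union]
    refine congrArg (Finsupp.supported R R) (Set.ext fun σ => ?_)
    simp [cov, or_comm]
  -- the complex of small chains
  let dS : ∀ n, smallChains R cov (n + 1) →ₗ[R] smallChains R cov n := fun n =>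
    (singularBoundary R X n).restrict fun _ hc => singularBoundary_mem_smallChains hc
  have hdS : ∀ n, dS n ∘ₗ dS (n + 1) = 0 := fun n => LinearMap.ext fun x => Subtype.ext
    (LinearMap.congr_fun (singularBoundary_boundary R X n) x.1)
  -- the direct sum of the complexes of `U` and `V`
  let dP : ∀ n, (SingularChain R U (n + 1) × SingularChain R V (n + 1)) →ₗ[R]
      (SingularChain R U n × SingularChain R V n) := fun n =>
    (singularBoundary R U n).prodMap (singularBoundary R V n)
  have hdP : ∀ n, dP n ∘ₗ dP (n + 1) = 0 := fun n => LinearMap.ext fun x => Prod.ext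
    (LinearMap.congr_fun (singularBoundary_boundary R U n) x.1)
    (LinearMap.congr_fun (singularBoundary_boundary R V n) x.2)
  obtain ⟨S, hS, h₁, h₂, h₃⟩ := exists_linear_shortExact (A := SingularChain R U)
    (B := fun n => SingularChain R U n × SingularChain R V n) (C := SingularChain R V)
    (hA := singularBoundary_boundary R U) (hB := hdP) (hC := singularBoundary_boundary R V)
    (fun n => LinearMap.inl R _ _) (fun n x => Prod.ext rfl (map_zero (singularBoundary R V n)))
    (fun n => LinearMap.snd R _ _) (fun n x => rfl)
    (fun n => LinearMap.inl_injective) (fun n => Function.Exact.inl_snd)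
    (fun n => LinearMap.snd_surjective)
  have e₁ : S.X₁ = concreteChains R U := h₁
  have e₃ : S.X₃ = concreteChains R V := h₃
  rw [← e₁] at fU
  rw [← e₃] at fV
  have fP := HasFGTotalHomology.middle hS fU fV
  have χP := homologyEulerChar_shortExact hS fU fP fV
  rw [← e₁, ← e₃, ← χP]
  clear χP fU fV e₁ e₃
  rw [h₂] at fP ⊢
  clear h₁ h₂ h₃ hS S
  -- the Mayer–Vietoris sequence
  let iU : C((U ∩ V : Set X), U) := ⟨Set.inclusion Set.inter_subset_left, by fun_prop⟩
  let iV : C((U ∩ V : Set X), V) := ⟨Set.inclusion Set.inter_subset_right, by fun_prop⟩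
  have hiU : ∀ n c, singularMap R (subsetIncl U) n (singularMap R iU n c) =
      singularMap R (subsetIncl (U ∩ V)) n c := fun n c => singularMap_comp iU _ n c
  have hiV : ∀ n c, singularMap R (subsetIncl V) n (singularMap R iV n c) =
      singularMap R (subsetIncl (U ∩ V)) n c := fun n c => singularMap_comp iV _ n c
  have injU := singularMap_subsetIncl_injective (R := R) U
  have injV := singularMap_subsetIncl_injective (R := R) V
  let g : ∀ n, (SingularChain R U n × SingularChain R V n) →ₗ[R] smallChains R cov n := fun n =>
    LinearMap.codRestrict _ ((singularMap R (subsetIncl U) n).coprod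
      (-singularMap R (subsetIncl V) n)) (by
        rintro ⟨a, b⟩
        rw [hsmall, LinearMap.coprod_apply]
        exact Submodule.add_mem_sup ⟨a, rfl⟩ (Submodule.neg_mem _ ⟨b, rfl⟩))
  obtain ⟨S, hS, h₁, h₂, h₃⟩ := exists_linear_shortExact
    (A := SingularChain R (U ∩ V : Set X)) (B := fun n => SingularChain R U n × SingularChain R V n)
    (C := fun n => smallChains R cov n)
    (hA := singularBoundary_boundary R (U ∩ V : Set X)) (hB := hdP) (hC := hdS)
    (fun n => (singularMap R iU n).prod (singularMap R iV n))
    (fun n x => Prod.ext (singularBoundary_map iU n x) (singularBoundary_map iV n x))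
    g
    (fun n x => Subtype.ext (by
      obtain ⟨a, b⟩ := x
      simp [g, dS, dP, singularBoundary_map]))
    (fun n a b hab => singularMap_subsetIncl_injective (R := R) (U ∩ V) n (by
      rw [← hiU, ← hiU]
      exact congrArg (singularMap R (subsetIncl U) n) (congrArg Prod.fst hab)))
    (fun n => by
      rintro ⟨a, b⟩
      constructor
      · intro h
        have hab : singularMap R (subsetIncl U) n a = singularMap R (subsetIncl V) n b := by
          have := congrArg Subtype.val h
          simpa [g, ← sub_eq_add_neg, sub_eq_zero] using this
        have hmem : singularMap R (subsetIncl U) n a ∈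
            (singularMap R (subsetIncl (U ∩ V)) n).range := by
          have h1 : singularMap R (subsetIncl U) n a ∈ (singularMap R (subsetIncl U) n).range :=
            ⟨a, rfl⟩
          have h2 : singularMap R (subsetIncl U) n a ∈ (singularMap R (subsetIncl V) n).range :=
            ⟨b, hab.symm⟩
          rw [singularMap_subsetIncl_range] at h1 h2 ⊢
          have h3 := Submodule.mem_inf.2 ⟨h1, h2⟩
          rw [← Finsupp.supported_inter] at h3
          refine Finsupp.supported_mono ?_ h3
          rintro σ ⟨hσ, hσ'⟩
          exact Set.subset_inter hσ hσ'
        obtain ⟨c, hc⟩ := hmem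
        exact ⟨c, Prod.ext (injU n (by rw [← hc]; exact hiU n c))
          (injV n (by rw [← hab, ← hc]; exact hiV n c))⟩
      · rintro ⟨c, hc⟩
        obtain ⟨rfl, rfl⟩ := Prod.ext_iff.1 hc
        refine Subtype.ext ?_
        simp [g, hiU, hiV])
    (fun n => by
      rintro ⟨x, hx⟩
      rw [hsmall] at hx
      obtain ⟨_, ⟨a, rfl⟩, _, ⟨b, rfl⟩, rfl⟩ := Submodule.mem_sup.1 hx
      exact ⟨(a, -b), Subtype.ext (by simp [g])⟩)
  have e₁ : S.X₁ = concreteChains R (U ∩ V : Set X) := h₁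
  rw [← h₂] at fP ⊢
  rw [← e₁] at fI ⊢
  have fS := HasFGTotalHomology.right hS fI fP
  have χS := homologyEulerChar_shortExact hS fI fP fS
  rw [h₃] at fS χS
  obtain ⟨fX, χX⟩ := hasFGTotalHomology_of_subcomplex
    (singularBoundary_boundary R X) (smallChains R cov)
    (fun _ _ hx => singularBoundary_mem_smallChains hx) (smallChains_zero hcov)
    (fun _ _ hx => exists_sub_boundary_mem_smallChains hopen hcov _ hx) (fun _ _ => rfl) hdS fS
  exact ⟨fX, by rw [concreteChains, χX, χS, add_comm]⟩

end MayerVietoris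

end

section

open CategoryTheory

/-! ### The Euler characteristic of a topological space -/

section EulerCharacteristic

variable {X Y : Type} [TopologicalSpace X] [TopologicalSpace Y]

theorem eulerCharacteristic_eq_coe_iff {n : ℤ} :
    eulerCharacteristic X = (n : WithTop ℤ) ↔
      HasFGTotalHomology (singularChains X) ∧ (singularChains X).homologyEulerChar = n := by
  unfold eulerCharacteristic
  have h : HasFGHomology X ↔ HasFGTotalHomology (singularChains X) := Iff.rfl
  split_ifs with hX
  · rw [WithTop.coe_inj]
    exact ⟨fun e => ⟨h.1 hX, e⟩, fun e => e.2⟩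
  · exact ⟨fun e => absurd e.symm (WithTop.coe_ne_top), fun e => absurd (h.2 e.1) hX⟩

theorem eulerCharacteristic_congr (e : ∀ k, (singularChains X).homology k ≅
    (singularChains Y).homology k) : eulerCharacteristic X = eulerCharacteristic Y := by
  have h : HasFGHomology X ↔ HasFGHomology Y :=
    ⟨fun h => HasFGTotalHomology.of_homologyIso e h,
      fun h => HasFGTotalHomology.of_homologyIso (fun k => (e k).symm) h⟩
  unfold eulerCharacteristic
  rw [homologyEulerChar_congr e]
  by_cases hX : HasFGHomology X
  · rw [if_pos hX, if_pos (h.1 hX)]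
  · rw [if_neg hX, if_neg fun hY => hX (h.2 hY)]

theorem ContinuousMap.HomotopyEquiv.eulerCharacteristic_eq (e : ContinuousMap.HomotopyEquiv X Y) :
    eulerCharacteristic X = eulerCharacteristic Y := by
  let F := (AlgebraicTopology.singularChainComplexFunctor (ModuleCat.{0} ℤ)).obj (ModuleCat.of ℤ ℤ)
  have key : ∀ {X Y : Type} [TopologicalSpace X] [TopologicalSpace Y] (f : C(X, Y)) (g : C(Y, X))
      (h : (g.comp f).Homotopic (ContinuousMap.id X)) (k : ℕ),
      HomologicalComplex.homologyMap (F.map (TopCat.ofHom f)) k ≫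
        HomologicalComplex.homologyMap (F.map (TopCat.ofHom g)) k = 𝟙 _ := by
    intro X Y _ _ f g h k
    obtain ⟨H⟩ := h
    have H' : TopCat.Homotopy (TopCat.ofHom f ≫ TopCat.ofHom g) (𝟙 (TopCat.of X)) := H
    rw [← HomologicalComplex.homologyMap_comp, ← F.map_comp,
      H'.congr_homologyMap_singularChainComplexFunctor, CategoryTheory.Functor.map_id,
      HomologicalComplex.homologyMap_id]
  exact eulerCharacteristic_congr fun k =>
    { hom := HomologicalComplex.homologyMap (F.map (TopCat.ofHom e.toFun)) k
      inv := HomologicalComplex.homologyMap (F.map (TopCat.ofHom e.invFun)) k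
      hom_inv_id := key _ _ e.left_inv k
      inv_hom_id := key _ _ e.right_inv k }

theorem Homeomorph.eulerCharacteristic_eq (e : X ≃ₜ Y) :
    eulerCharacteristic X = eulerCharacteristic Y :=
  e.toHomotopyEquiv.eulerCharacteristic_eq

theorem eulerCharacteristic_of_totallyDisconnected [Finite X] [TotallyDisconnectedSpace X] :
    eulerCharacteristic X = ((Nat.card X : ℤ) : WithTop ℤ) := by
  classical
  have : TotallyDisconnectedSpace (TopCat.of X) := ‹TotallyDisconnectedSpace X›
  have := Fintype.ofFinite X
  have h0 : (singularChains X).homology 0 ≅ ModuleCat.of ℤ (DirectSum X fun _ => ℤ) :=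
    AlgebraicTopology.singularHomologyFunctorZeroOfTotallyDisconnectedSpace (ModuleCat.{0} ℤ)
      (ModuleCat.of ℤ ℤ) (TopCat.of X) ≪≫ ModuleCat.coprodIsoDirectSum _
  have hk : ∀ k, k ≠ 0 → Subsingleton ((singularChains X).homology k) := fun k hk =>
    ModuleCat.subsingleton_of_isZero
      (AlgebraicTopology.isZero_singularHomologyFunctor_of_totallyDisconnectedSpace
        (ModuleCat.{0} ℤ) k (ModuleCat.of ℤ ℤ) (TopCat.of X) hk)
  rw [eulerCharacteristic_eq_coe_iff]
  have hk' : ∀ k, 1 ≤ k → Subsingleton ((singularChains X).homology k) :=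
    fun k h => hk k (by omega)
  have hfin : Module.Finite ℤ (DirectSum X fun _ => ℤ) := by
    infer_instance
  refine ⟨⟨fun k => ?_, 1, hk'⟩, ?_⟩
  · rcases eq_or_ne k 0 with rfl | h
    · exact Module.Finite.equiv h0.toLinearEquiv.symm
    · have := hk k h
      infer_instance
  · rw [homologyEulerChar_eq_sum _ hk', Finset.sum_range_one, pow_zero, one_mul,
      h0.toLinearEquiv.finrank_eq]
    simp

/-- Inclusion–exclusion for two open sets whose Euler characteristics and that of whose intersection
are finite. -/
theorem eulerCharacteristic_mayerVietoris {U V : Set X} (hU : IsOpen U) (hV : IsOpen V)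
    (hUV : U ∪ V = Set.univ) {a b c : ℤ} (ha : eulerCharacteristic U = (a : WithTop ℤ))
    (hb : eulerCharacteristic V = (b : WithTop ℤ))
    (hc : eulerCharacteristic (U ∩ V : Set X) = (c : WithTop ℤ)) :
    eulerCharacteristic X = ((a + b - c : ℤ) : WithTop ℤ) := by
  have key : ∀ (Y : Type) [TopologicalSpace Y] (n : ℤ), eulerCharacteristic Y = (n : WithTop ℤ) ↔
      HasFGTotalHomology (concreteChains ℤ Y) ∧ (concreteChains ℤ Y).homologyEulerChar = n := by
    intro Y _ n
    have e : ∀ k, (singularChains Y).homology k ≅ (concreteChains ℤ Y).homology k := fun k =>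
      (HomologicalComplex.homologyFunctor _ _ k).mapIso (singularChainsIso Y)
    rw [eulerCharacteristic_eq_coe_iff, homologyEulerChar_congr e]
    exact and_congr_left fun _ => ⟨fun h => h.of_homologyIso e,
      fun h => h.of_homologyIso fun k => (e k).symm⟩
  rw [key] at ha hb hc ⊢
  obtain ⟨h, h'⟩ := concreteChains_mayerVietoris ℤ hU hV hUV ha.1 hb.1 hc.1
  rw [ha.2, hb.2, hc.2] at h'
  exact ⟨h, by omega⟩

end EulerCharacteristic

end

section

open CategoryTheory

/-! ### Attaching arcs -/

section Arcs

variable {X : Type} [TopologicalSpace X]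

/-- A subset `B` of `A`, seen as a subset of the subspace `A`, is homeomorphic to `B`. -/
def preimageValHomeomorph {A B : Set X} (h : B ⊆ A) : (Subtype.val ⁻¹' B : Set A) ≃ₜ B where
  toFun x := ⟨x.1.1, x.2⟩
  invFun x := ⟨⟨x.1, h x.2⟩, x.2⟩
  left_inv _ := rfl
  right_inv _ := rfl
  continuous_toFun := by fun_prop
  continuous_invFun := by fun_prop

/-- Inclusion–exclusion inside a subspace `A`, for two relatively open subsets that cover it. -/
theorem eulerCharacteristic_mayerVietoris_set {A O₁ O₂ : Set X} (h₁ : IsOpen O₁) (h₂ : IsOpen O₂)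
    (hA : A ⊆ O₁ ∪ O₂) {a b c : ℤ} (ha : eulerCharacteristic (A ∩ O₁ : Set X) = (a : WithTop ℤ))
    (hb : eulerCharacteristic (A ∩ O₂ : Set X) = (b : WithTop ℤ))
    (hc : eulerCharacteristic (A ∩ (O₁ ∩ O₂) : Set X) = (c : WithTop ℤ)) :
    eulerCharacteristic A = ((a + b - c : ℤ) : WithTop ℤ) := by
  have e : ∀ B : Set X, eulerCharacteristic (Subtype.val ⁻¹' B : Set A) =
      eulerCharacteristic (A ∩ B : Set X) := by
    intro B
    rw [← (preimageValHomeomorph (Set.inter_subset_left : A ∩ B ⊆ A)).eulerCharacteristic_eq,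
      Subtype.preimage_coe_self_inter]
  refine eulerCharacteristic_mayerVietoris (U := Subtype.val ⁻¹' O₁) (V := Subtype.val ⁻¹' O₂)
    (h₁.preimage continuous_subtype_val) (h₂.preimage continuous_subtype_val) ?_
    ((e _).trans ha) ((e _).trans hb) ?_
  · rw [← Set.preimage_union, Set.eq_univ_iff_forall]
    exact fun x => hA x.2
  · rw [← Set.preimage_inter]
    exact (e _).trans hc

theorem eulerCharacteristic_of_finite [T2Space X] {P : Set X} (hP : P.Finite) :
    eulerCharacteristic P = ((P.ncard : ℤ) : WithTop ℤ) := by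
  have := hP.to_subtype
  rw [eulerCharacteristic_of_totallyDisconnected]
  rfl

theorem eulerCharacteristic_of_contractible [ContractibleSpace X] :
    eulerCharacteristic X = ((1 : ℤ) : WithTop ℤ) := by
  obtain ⟨e⟩ := ContractibleSpace.hequiv_unit X
  rw [e.eulerCharacteristic_eq, eulerCharacteristic_of_totallyDisconnected]
  simp

/-- The inverse of a continuous map from a compact set to a Hausdorff space is continuous on every
set over which the map is injective. -/
theorem continuousOn_of_leftInverse_of_isCompact [T2Space X] {j : ℝ → X} {K : Set ℝ}
    (hK : IsCompact K) (hj : ContinuousOn j K) {A : Set X} {τ : X → ℝ}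
    (hτ : ∀ y ∈ A, τ y ∈ K ∧ j (τ y) = y) (hτ' : ∀ s ∈ K, j s ∈ A → τ (j s) = s) :
    ContinuousOn τ A := by
  rw [continuousOn_iff_isClosed]
  intro t ht
  refine ⟨j '' (K ∩ t), ((hK.inter_right ht).image_of_continuousOn
    (hj.mono Set.inter_subset_left)).isClosed, ?_⟩
  ext y
  constructor
  · rintro ⟨hy, hyA⟩
    exact ⟨⟨τ y, ⟨(hτ y hyA).1, hy⟩, (hτ y hyA).2⟩, hyA⟩
  · rintro ⟨⟨s, ⟨hs, hst⟩, rfl⟩, hyA⟩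
    refine ⟨?_, hyA⟩
    rw [Set.mem_preimage, hτ' s hs hyA]
    exact hst

variable {S : Set X} {j : ℝ → X}

/-- The data of an arc attached to a closed set `S` along its endpoints. -/
structure IsAttachedArc (S : Set X) (j : ℝ → X) : Prop where
  continuousOn : ContinuousOn j (Set.Icc 0 1)
  injOn : Set.InjOn j (Set.Ioo 0 1)
  start_mem : j 0 ∈ S
  finish_mem : j 1 ∈ S
  notMem : ∀ s ∈ Set.Ioo (0 : ℝ) 1, j s ∉ S

theorem IsAttachedArc.reverse (h : IsAttachedArc S j) : IsAttachedArc S (fun s => j (1 - s)) where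
  continuousOn := h.continuousOn.comp (by fun_prop) fun s hs =>
    ⟨by linarith [hs.2], by linarith [hs.1]⟩
  injOn := fun s hs t ht hst => by
    have := h.injOn (x₁ := 1 - s) ⟨by linarith [hs.2], by linarith [hs.1]⟩
      (x₂ := 1 - t) ⟨by linarith [ht.2], by linarith [ht.1]⟩ hst
    linarith
  start_mem := by simpa using h.finish_mem
  finish_mem := by simpa using h.start_mem
  notMem := fun s hs => h.notMem _ ⟨by linarith [hs.2], by linarith [hs.1]⟩

theorem IsAttachedArc.eq_of_eq (h : IsAttachedArc S j) {s t : ℝ} (hs : s ∈ Set.Ioo (0 : ℝ) 1)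
    (ht : t ∈ Set.Icc (0 : ℝ) 1) (hst : j s = j t) : s = t := by
  rcases eq_or_lt_of_le ht.1 with rfl | h0
  · exact absurd (hst ▸ h.start_mem) (h.notMem s hs)
  rcases eq_or_lt_of_le ht.2 with rfl | h1
  · exact absurd (hst ▸ h.finish_mem) (h.notMem s hs)
  exact h.injOn hs ⟨h0, h1⟩ hst

theorem IsAttachedArc.eulerCharacteristic_image_Ioo [T2Space X] (h : IsAttachedArc S j) {a b : ℝ}
    (hab : a < b)
    (ha : 0 ≤ a) (hb : b ≤ 1) :
    eulerCharacteristic (j '' Set.Ioo a b) = ((1 : ℤ) : WithTop ℤ) := by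
  have hsub : Set.Ioo a b ⊆ Set.Ioo 0 1 := Set.Ioo_subset_Ioo ha hb
  have hinv : ∀ s ∈ Set.Ioo a b, Function.invFunOn j (Set.Ioo a b) (j s) = s := fun s hs =>
    (h.injOn.mono hsub).leftInvOn_invFunOn hs
  have hmem : ∀ y ∈ j '' Set.Ioo a b, Function.invFunOn j (Set.Ioo a b) y ∈ Set.Ioo a b ∧
      j (Function.invFunOn j (Set.Ioo a b) y) = y := fun y hy =>
    ⟨Function.invFunOn_mem hy, Function.invFunOn_eq hy⟩
  have hcont : ContinuousOn (Function.invFunOn j (Set.Ioo a b)) (j '' Set.Ioo a b) := by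
    refine continuousOn_of_leftInverse_of_isCompact isCompact_Icc h.continuousOn
      (fun y hy => ⟨Set.Ioo_subset_Icc_self (hsub (hmem y hy).1), (hmem y hy).2⟩) ?_
    rintro s hs ⟨t, ht, hts⟩
    rw [← hts, hinv t ht]
    exact h.eq_of_eq (hsub ht) hs hts
  let e : j '' Set.Ioo a b ≃ₜ Set.Ioo a b :=
    { toFun := fun y => ⟨Function.invFunOn j (Set.Ioo a b) y, (hmem y y.2).1⟩
      invFun := fun s => ⟨j s, s, s.2, rfl⟩
      left_inv := fun y => Subtype.ext (hmem y y.2).2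
      right_inv := fun s => Subtype.ext (hinv s s.2)
      continuous_toFun := (continuousOn_iff_continuous_domRestrict.1 hcont).subtype_mk _
      continuous_invFun := (continuousOn_iff_continuous_domRestrict.1 (h.continuousOn.mono
        (hsub.trans Set.Ioo_subset_Icc_self))).subtype_mk _ }
  have := (convex_Ioo a b).contractibleSpace ⟨(a + b) / 2, by constructor <;> linarith⟩
  rw [e.eulerCharacteristic_eq, eulerCharacteristic_of_contractible]

open Classical in
/-- The contraction of the half-open arc `j '' [0, 1/2)` to its starting point, at time `θ`. -/
def arcContraction (S : Set X) (j : ℝ → X) (θ : ℝ) (y : X) : X :=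
  if y ∈ S then y else
    let s := Function.invFunOn j (Set.Ioo 0 1) y
    if s ≤ 1 / 2 then j ((1 - θ) * s) else j (1 - (1 - θ) * (1 - s))

theorem IsAttachedArc.arcContraction_apply_of_le (h : IsAttachedArc S j) {s θ : ℝ}
    (hs : s ∈ Set.Icc (0 : ℝ) (1 / 2)) : arcContraction S j θ (j s) = j ((1 - θ) * s) := by
  rcases eq_or_lt_of_le hs.1 with rfl | h0
  · rw [arcContraction, if_pos h.start_mem, mul_zero]
  · have hs' : s ∈ Set.Ioo (0 : ℝ) 1 := ⟨h0, by linarith [hs.2]⟩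
    rw [arcContraction, if_neg (h.notMem s hs')]
    simp only [h.injOn.leftInvOn_invFunOn hs']
    rw [if_pos hs.2]

theorem IsAttachedArc.arcContraction_apply_of_lt (h : IsAttachedArc S j) {s θ : ℝ}
    (hs : s ∈ Set.Ioc (1 / 2 : ℝ) 1) :
    arcContraction S j θ (j s) = j (1 - (1 - θ) * (1 - s)) := by
  rcases eq_or_lt_of_le hs.2 with rfl | h1
  · rw [arcContraction, if_pos h.finish_mem, sub_self, mul_zero, sub_zero]
  · have hs' : s ∈ Set.Ioo (0 : ℝ) 1 := ⟨by linarith [hs.1], h1⟩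
    rw [arcContraction, if_neg (h.notMem s hs')]
    simp only [h.injOn.leftInvOn_invFunOn hs']
    rw [if_neg (not_le.2 hs.1)]

/-- Continuity of a map defined along the half `[0, 1/2]` of an attached arc. -/
theorem IsAttachedArc.continuousOn_half [T2Space X] (h : IsAttachedArc S j) {F : X × ℝ → X}
    (hF : ∀ s ∈ Set.Icc (0 : ℝ) (1 / 2), ∀ θ ∈ Set.Icc (0 : ℝ) 1, j s ≠ j (1 / 2) →
      F (j s, θ) = j ((1 - θ) * s)) :
    ContinuousOn F ((j '' Set.Icc 0 (1 / 2) \ {j (1 / 2)}) ×ˢ Set.Icc 0 1) := by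
  have hinj : Set.InjOn j (Set.Icc 0 (1 / 2)) := by
    intro s hs t ht hst
    rcases eq_or_lt_of_le hs.1 with rfl | hs0
    · rcases eq_or_lt_of_le ht.1 with rfl | ht0
      · rfl
      · exact (h.eq_of_eq ⟨ht0, by linarith [ht.2]⟩ ⟨le_rfl, zero_le_one⟩ hst.symm).symm
    · exact h.eq_of_eq ⟨hs0, by linarith [hs.2]⟩ ⟨ht.1, by linarith [ht.2]⟩ hst
  have hsub : Set.Icc (0 : ℝ) (1 / 2) ⊆ Set.Icc 0 1 := Set.Icc_subset_Icc_right (by norm_num)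
  have hτ : ContinuousOn (Function.invFunOn j (Set.Icc 0 (1 / 2))) (j '' Set.Icc 0 (1 / 2)) :=
    continuousOn_of_leftInverse_of_isCompact isCompact_Icc (h.continuousOn.mono hsub)
      (fun y hy => ⟨Function.invFunOn_mem hy, Function.invFunOn_eq hy⟩)
      (fun s hs _ => hinj.leftInvOn_invFunOn hs)
  have hcomp : ContinuousOn (fun p : X × ℝ =>
      j ((1 - p.2) * Function.invFunOn j (Set.Icc 0 (1 / 2)) p.1))
      ((j '' Set.Icc 0 (1 / 2) \ {j (1 / 2)}) ×ˢ Set.Icc 0 1) := by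
    refine h.continuousOn.comp ?_ ?_
    · refine ContinuousOn.mul (by fun_prop) ?_
      exact hτ.comp continuousOn_fst fun p hp => hp.1.1
    · rintro ⟨y, θ⟩ ⟨⟨hy, _⟩, hθ⟩
      have := Function.invFunOn_mem hy
      have h1 : 0 ≤ 1 - θ := by linarith [hθ.2]
      exact ⟨mul_nonneg h1 this.1, by nlinarith [this.1, this.2, hθ.1]⟩
  refine hcomp.congr ?_
  rintro ⟨y, θ⟩ ⟨⟨⟨s, hs, rfl⟩, hne⟩, hθ⟩
  simp only
  rw [hF s hs θ hθ hne, hinj.leftInvOn_invFunOn hs]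

/-- Removing an interior point from an attached arc does not change the homotopy type of the
complement of the arc. -/
theorem IsAttachedArc.eulerCharacteristic_diff_point [T2Space X] (h : IsAttachedArc S j)
    (hS : IsClosed S) :
    eulerCharacteristic ((S ∪ j '' Set.Ioo 0 1) ∩ {j (1 / 2)}ᶜ : Set X) =
      eulerCharacteristic S := by
  set U : Set X := (S ∪ j '' Set.Ioo 0 1) ∩ {j (1 / 2)}ᶜ with hU
  have hhalf : (1 / 2 : ℝ) ∈ Set.Ioo (0 : ℝ) 1 := by constructor <;> norm_num
  have hSU : S ⊆ U := fun y hy => ⟨Or.inl hy, fun hy' => h.notMem _ hhalf (hy' ▸ hy)⟩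
  -- the homotopy
  have hH0 : ∀ y ∈ U, arcContraction S j 0 y = y := by
    rintro y ⟨hy | ⟨s, hs, rfl⟩, _⟩
    · rw [arcContraction, if_pos hy]
    · rcases le_or_gt s (1 / 2) with hle | hlt
      · rw [h.arcContraction_apply_of_le ⟨hs.1.le, hle⟩]
        simp
      · rw [h.arcContraction_apply_of_lt ⟨hlt, hs.2.le⟩]
        simp
  have hH1 : ∀ y ∈ U, arcContraction S j 1 y ∈ S := by
    rintro y ⟨hy | ⟨s, hs, rfl⟩, _⟩
    · rw [arcContraction, if_pos hy]
      exact hy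
    · rcases le_or_gt s (1 / 2) with hle | hlt
      · rw [h.arcContraction_apply_of_le ⟨hs.1.le, hle⟩]
        simpa using h.start_mem
      · rw [h.arcContraction_apply_of_lt ⟨hlt, hs.2.le⟩]
        simpa using h.finish_mem
  have hmem : ∀ s ∈ Set.Icc (0 : ℝ) 1, s ≠ 1 / 2 → j s ∈ U := by
    intro s hs hne
    refine ⟨?_, fun he => hne (h.eq_of_eq hhalf hs (Eq.symm he)).symm⟩
    rcases eq_or_lt_of_le hs.1 with rfl | h0
    · exact Or.inl h.start_mem
    rcases eq_or_lt_of_le hs.2 with rfl | h1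
    · exact Or.inl h.finish_mem
    exact Or.inr ⟨s, ⟨h0, h1⟩, rfl⟩
  have hHU : ∀ θ ∈ Set.Icc (0 : ℝ) 1, ∀ y ∈ U, arcContraction S j θ y ∈ U := by
    rintro θ hθ y ⟨hy | ⟨s, hs, rfl⟩, hne⟩
    · rw [arcContraction, if_pos hy]
      exact hSU hy
    · have hs2 : s ≠ 1 / 2 := fun he => hne (by rw [he]; rfl)
      have h1 : 0 ≤ 1 - θ := by linarith [hθ.2]
      rcases lt_or_gt_of_ne hs2 with hlt | hgt
      · rw [h.arcContraction_apply_of_le ⟨hs.1.le, hlt.le⟩]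
        have : (1 - θ) * s < 1 / 2 := by nlinarith [hs.1, hθ.1]
        exact hmem _ ⟨mul_nonneg h1 hs.1.le, by linarith⟩ this.ne
      · rw [h.arcContraction_apply_of_lt ⟨hgt, hs.2.le⟩]
        have h2 : (1 - θ) * (1 - s) < 1 / 2 := by nlinarith [hs.2, hθ.1]
        have h3 : 0 ≤ (1 - θ) * (1 - s) := mul_nonneg h1 (by linarith [hs.2])
        exact hmem _ ⟨by linarith, by linarith⟩ (by linarith)
  have hcl : ∀ {a b : ℝ}, 0 ≤ a → b ≤ 1 → IsClosed (j '' Set.Icc a b) := fun ha hb =>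
    (isCompact_Icc.image_of_continuousOn (h.continuousOn.mono (Set.Icc_subset_Icc ha hb))).isClosed
  have hcont : Continuous (fun p : unitInterval × U => arcContraction S j p.1 p.2) := by
    have c1 : ContinuousOn (fun p : X × ℝ => arcContraction S j p.2 p.1) (S ×ˢ Set.Icc 0 1) :=
      continuousOn_fst.congr fun p hp => by rw [arcContraction, if_pos hp.1]
    have c2 : ContinuousOn (fun p : X × ℝ => arcContraction S j p.2 p.1)
        ((j '' Set.Icc 0 (1 / 2) \ {j (1 / 2)}) ×ˢ Set.Icc 0 1) :=
      h.continuousOn_half fun s hs θ _ _ => h.arcContraction_apply_of_le hs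
    have c3 : ContinuousOn (fun p : X × ℝ => arcContraction S j p.2 p.1)
        ((j '' Set.Icc (1 / 2) 1 \ {j (1 / 2)}) ×ˢ Set.Icc 0 1) := by
      have := h.reverse.continuousOn_half (F := fun p : X × ℝ => arcContraction S j p.2 p.1)
        (fun s hs θ _ hne => by
          have hs2 : s ≠ 1 / 2 := by
            rintro rfl
            exact hne rfl
          have hlt : s < 1 / 2 := lt_of_le_of_ne hs.2 hs2
          simp only
          rw [h.arcContraction_apply_of_lt ⟨by linarith, by linarith [hs.1]⟩]
          congr 1
          ring)
      have e1 : (fun s => j (1 - s)) '' Set.Icc 0 (1 / 2) = j '' Set.Icc (1 / 2) 1 := by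
        rw [show (fun s => j (1 - s)) = j ∘ (fun s => 1 - s) from rfl, Set.image_comp]
        rw [Set.image_const_sub_Icc]
        norm_num
      rw [e1] at this
      norm_num at this ⊢
      exact this
    have hcov : (Set.univ : Set (unitInterval × U)) =
        (fun p : unitInterval × U => (p.2 : X)) ⁻¹' S ∪
          ((fun p : unitInterval × U => (p.2 : X)) ⁻¹' (j '' Set.Icc 0 (1 / 2)) ∪
            (fun p : unitInterval × U => (p.2 : X)) ⁻¹' (j '' Set.Icc (1 / 2) 1)) := by
      symm
      rw [Set.eq_univ_iff_forall]
      rintro ⟨θ, y, hy | ⟨s, hs, rfl⟩, _⟩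
      · exact Or.inl hy
      · rcases le_total s (1 / 2) with hle | hle
        · exact Or.inr (Or.inl ⟨s, ⟨hs.1.le, hle⟩, rfl⟩)
        · exact Or.inr (Or.inr ⟨s, ⟨hle, hs.2.le⟩, rfl⟩)
    have hpr : Continuous (fun p : unitInterval × U => (p.2 : X)) := by fun_prop
    have hswap : Continuous (fun p : unitInterval × U => ((p.2 : X), (p.1 : ℝ))) := by fun_prop
    rw [← continuousOn_univ, hcov]
    refine ContinuousOn.union_of_isClosed ?_ (ContinuousOn.union_of_isClosed ?_ ?_
      ((hcl le_rfl (by norm_num)).preimage hpr) ((hcl (by norm_num) le_rfl).preimage hpr))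
      (hS.preimage hpr) (((hcl le_rfl (by norm_num)).preimage hpr).union
        ((hcl (by norm_num) le_rfl).preimage hpr))
    · exact c1.comp hswap.continuousOn fun p hp => ⟨hp, p.1.2⟩
    · exact c2.comp hswap.continuousOn fun p hp => ⟨⟨hp, p.2.2.2⟩, p.1.2⟩
    · exact c3.comp hswap.continuousOn fun p hp => ⟨⟨hp, p.2.2.2⟩, p.1.2⟩
  let r : C(U, S) := ⟨fun y => ⟨arcContraction S j 1 y, hH1 y y.2⟩,
    (hcont.comp (Continuous.prodMk_right (1 : unitInterval))).subtype_mk _⟩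
  let i : C(S, U) := ⟨fun y => ⟨y, hSU y.2⟩, by fun_prop⟩
  have hri : r.comp i = ContinuousMap.id S := by
    ext y
    change arcContraction S j 1 y = y
    rw [arcContraction, if_pos y.2]
  let H : ContinuousMap.Homotopy (ContinuousMap.id U) (i.comp r) :=
    { toFun := fun p => ⟨arcContraction S j p.1 p.2, hHU p.1 p.1.2 p.2 p.2.2⟩
      continuous_toFun := hcont.subtype_mk _
      map_zero_left := fun y => Subtype.ext (hH0 y y.2)
      map_one_left := fun y => rfl }
  exact (ContinuousMap.HomotopyEquiv.mk r i ⟨H.symm⟩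
    (by rw [hri])).eulerCharacteristic_eq

/-- Attaching an open arc lowers the Euler characteristic by one. -/
theorem IsAttachedArc.eulerCharacteristic_union [T2Space X] (h : IsAttachedArc S j)
    (hS : IsClosed S) {n : ℤ} (hn : eulerCharacteristic S = (n : WithTop ℤ)) :
    eulerCharacteristic (S ∪ j '' Set.Ioo 0 1 : Set X) = ((n - 1 : ℤ) : WithTop ℤ) := by
  have hhalf : (1 / 2 : ℝ) ∈ Set.Ioo (0 : ℝ) 1 := by constructor <;> norm_num
  have hcl : ∀ {a b : ℝ}, 0 ≤ a → b ≤ 1 → IsClosed (j '' Set.Icc a b) := fun ha hb =>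
    (isCompact_Icc.image_of_continuousOn (h.continuousOn.mono (Set.Icc_subset_Icc ha hb))).isClosed
  -- the arc without its midpoint has Euler characteristic two
  have hB : eulerCharacteristic (j '' (Set.Ioo 0 1 \ {1 / 2}) : Set X) =
      ((1 + 1 - 0 : ℤ) : WithTop ℤ) := by
    have hl : ∀ s ∈ Set.Ioo (0 : ℝ) 1, j s ∈ j '' Set.Icc (1 / 2) 1 ↔ 1 / 2 ≤ s := by
      refine fun s hs => ⟨?_, fun hle => ⟨s, ⟨hle, hs.2.le⟩, rfl⟩⟩
      rintro ⟨t, ht, hts⟩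
      rw [h.eq_of_eq hs ⟨by linarith [ht.1], ht.2⟩ hts.symm]
      exact ht.1
    have hr : ∀ s ∈ Set.Ioo (0 : ℝ) 1, j s ∈ j '' Set.Icc 0 (1 / 2) ↔ s ≤ 1 / 2 := by
      refine fun s hs => ⟨?_, fun hle => ⟨s, ⟨hs.1.le, hle⟩, rfl⟩⟩
      rintro ⟨t, ht, hts⟩
      rw [h.eq_of_eq hs ⟨ht.1, by linarith [ht.2]⟩ hts.symm]
      exact ht.2
    have e1 : j '' (Set.Ioo 0 1 \ {1 / 2}) ∩ (j '' Set.Icc (1 / 2) 1)ᶜ =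
        j '' Set.Ioo 0 (1 / 2) := by
      ext y
      constructor
      · rintro ⟨⟨s, ⟨hs, _⟩, rfl⟩, hy⟩
        rw [Set.mem_compl_iff, hl s hs, not_le] at hy
        exact ⟨s, ⟨hs.1, hy⟩, rfl⟩
      · rintro ⟨s, hs, rfl⟩
        have hs' : s ∈ Set.Ioo (0 : ℝ) 1 := ⟨hs.1, by linarith [hs.2]⟩
        exact ⟨⟨s, ⟨hs', hs.2.ne⟩, rfl⟩, by rw [Set.mem_compl_iff, hl s hs', not_le]; exact hs.2⟩
    have e2 : j '' (Set.Ioo 0 1 \ {1 / 2}) ∩ (j '' Set.Icc 0 (1 / 2))ᶜ =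
        j '' Set.Ioo (1 / 2) 1 := by
      ext y
      constructor
      · rintro ⟨⟨s, ⟨hs, _⟩, rfl⟩, hy⟩
        rw [Set.mem_compl_iff, hr s hs, not_le] at hy
        exact ⟨s, ⟨hy, hs.2⟩, rfl⟩
      · rintro ⟨s, hs, rfl⟩
        have hs' : s ∈ Set.Ioo (0 : ℝ) 1 := ⟨by linarith [hs.1], hs.2⟩
        exact ⟨⟨s, ⟨hs', hs.1.ne'⟩, rfl⟩, by rw [Set.mem_compl_iff, hr s hs', not_le]; exact hs.1⟩
    have e3 : j '' (Set.Ioo 0 1 \ {1 / 2}) ∩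
        ((j '' Set.Icc (1 / 2) 1)ᶜ ∩ (j '' Set.Icc 0 (1 / 2))ᶜ) = ∅ := by
      rw [Set.eq_empty_iff_forall_notMem]
      rintro _ ⟨⟨s, ⟨hs, _⟩, rfl⟩, h1, h2⟩
      rw [Set.mem_compl_iff, hl s hs] at h1
      rw [Set.mem_compl_iff, hr s hs] at h2
      exact (le_total s (1 / 2)).elim h2 h1
    refine eulerCharacteristic_mayerVietoris_set
      (hcl (a := 1 / 2) (b := 1) (by norm_num) le_rfl).isOpen_compl
      (hcl (a := 0) (b := 1 / 2) le_rfl (by norm_num)).isOpen_compl ?_ ?_ ?_ ?_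
    · rintro _ ⟨s, ⟨hs, hne⟩, rfl⟩
      rcases lt_or_gt_of_ne hne with hlt | hgt
      · exact Or.inl fun hy => absurd ((hl s hs).1 hy) (not_le.2 hlt)
      · exact Or.inr fun hy => absurd ((hr s hs).1 hy) (not_le.2 hgt)
    · rw [e1]
      exact h.eulerCharacteristic_image_Ioo (by norm_num) le_rfl (by norm_num)
    · rw [e2]
      exact h.eulerCharacteristic_image_Ioo (by norm_num) (by norm_num) le_rfl
    · rw [e3, eulerCharacteristic_of_finite Set.finite_empty]
      simp
  have key := eulerCharacteristic_mayerVietoris_set (A := S ∪ j '' Set.Ioo 0 1)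
    (O₁ := {j (1 / 2)}ᶜ) (O₂ := Sᶜ) isOpen_compl_singleton hS.isOpen_compl ?_
    ((h.eulerCharacteristic_diff_point hS).trans hn) (b := 1) ?_ (c := 2) ?_
  · rw [key]
    congr 1
    ring
  · intro y _
    by_cases hy : y ∈ S
    · exact Or.inl fun hy' => h.notMem _ hhalf (hy' ▸ hy)
    · exact Or.inr hy
  · have e : (S ∪ j '' Set.Ioo 0 1) ∩ Sᶜ = j '' Set.Ioo 0 1 := by
      ext y
      constructor
      · rintro ⟨hy | hy, hyS⟩
        · exact absurd hy hyS
        · exact hy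
      · rintro ⟨s, hs, rfl⟩
        exact ⟨Or.inr ⟨s, hs, rfl⟩, h.notMem s hs⟩
    rw [e]
    exact h.eulerCharacteristic_image_Ioo one_pos le_rfl le_rfl
  · have e : (S ∪ j '' Set.Ioo 0 1) ∩ ({j (1 / 2)}ᶜ ∩ Sᶜ) = j '' (Set.Ioo 0 1 \ {1 / 2}) := by
      ext y
      constructor
      · rintro ⟨hy | ⟨s, hs, rfl⟩, hne, hyS⟩
        · exact absurd hy hyS
        · exact ⟨s, ⟨hs, fun he => hne (by rw [he]; rfl)⟩, rfl⟩
      · rintro ⟨s, ⟨hs, hne⟩, rfl⟩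
        exact ⟨Or.inr ⟨s, hs, rfl⟩, fun he => hne (h.injOn hs hhalf he), h.notMem s hs⟩
    rw [e, hB]
    rfl

/-- The Euler characteristic of a finite graph embedded in a Hausdorff space is the number of
vertices minus the number of edges. -/
theorem eulerCharacteristic_graph [T2Space X] {ι : Type} {P : Set X} (hP : P.Finite)
    {j : ι → ℝ → X} (I : Finset ι) (hj : ∀ i ∈ I, IsAttachedArc P (j i))
    (hdisj : ∀ i ∈ I, ∀ k ∈ I, ∀ s ∈ Set.Ioo (0 : ℝ) 1, ∀ t ∈ Set.Ioo (0 : ℝ) 1,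
      j i s = j k t → i = k) :
    eulerCharacteristic (P ∪ ⋃ i ∈ I, j i '' Set.Ioo 0 1 : Set X) =
      ((P.ncard - I.card : ℤ) : WithTop ℤ) := by
  classical
  induction I using Finset.induction_on with
  | empty =>
    have e : P ∪ ⋃ i ∈ (∅ : Finset ι), j i '' Set.Ioo 0 1 = P := by simp
    rw [e, eulerCharacteristic_of_finite hP]
    simp
  | insert i I hi ih =>
    have ih' := ih (fun k hk => hj k (Finset.mem_insert_of_mem hk))
      (fun k hk l hl => hdisj k (Finset.mem_insert_of_mem hk) l (Finset.mem_insert_of_mem hl))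
    have hclosed : IsClosed (P ∪ ⋃ k ∈ I, j k '' Set.Ioo 0 1) := by
      have e : P ∪ ⋃ k ∈ I, j k '' Set.Ioo 0 1 = P ∪ ⋃ k ∈ I, j k '' Set.Icc 0 1 := by
        apply subset_antisymm
        · gcongr
          exact Set.Ioo_subset_Icc_self
        · refine Set.union_subset Set.subset_union_left (Set.iUnion₂_subset fun k hk => ?_)
          rintro _ ⟨s, hs, rfl⟩
          have hk' := hj k (Finset.mem_insert_of_mem hk)
          rcases eq_or_lt_of_le hs.1 with rfl | h0
          · exact Or.inl hk'.start_mem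
          rcases eq_or_lt_of_le hs.2 with rfl | h1
          · exact Or.inl hk'.finish_mem
          exact Or.inr (Set.mem_iUnion₂.2 ⟨k, hk, s, ⟨h0, h1⟩, rfl⟩)
      rw [e]
      refine hP.isClosed.union (Set.Finite.isClosed_biUnion I.finite_toSet fun k hk => ?_)
      exact (isCompact_Icc.image_of_continuousOn
        (hj k (Finset.mem_insert_of_mem hk)).continuousOn).isClosed
    have hi' := hj i (Finset.mem_insert_self i I)
    have harc : IsAttachedArc (P ∪ ⋃ k ∈ I, j k '' Set.Ioo 0 1) (j i) :=
      { continuousOn := hi'.continuousOn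
        injOn := hi'.injOn
        start_mem := Or.inl hi'.start_mem
        finish_mem := Or.inl hi'.finish_mem
        notMem := by
          rintro s hs (hP' | hU)
          · exact hi'.notMem s hs hP'
          · obtain ⟨k, hk, t, ht, hts⟩ := Set.mem_iUnion₂.1 hU
            have := hdisj i (Finset.mem_insert_self i I) k (Finset.mem_insert_of_mem hk) s hs t ht
              hts.symm
            exact hi (this ▸ hk) }
    have e : P ∪ ⋃ k ∈ insert i I, j k '' Set.Ioo 0 1 =
        (P ∪ ⋃ k ∈ I, j k '' Set.Ioo 0 1) ∪ j i '' Set.Ioo 0 1 := by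
      rw [Finset.set_biUnion_insert, Set.union_assoc, Set.union_comm (j i '' _)]
    rw [e, harc.eulerCharacteristic_union hclosed ih', Finset.card_insert_of_notMem hi,
      Nat.cast_succ, sub_add_eq_sub_sub]

end Arcs

end

/-! ### The space of a one-dimensional complex -/

namespace OneDimCW

variable {Z₀ Λ : Type}

/-- The point of the complex given by a 0-cell. -/
def vertex (K : OneDimCW Z₀ Λ) (v : Z₀) : K.Space := Quot.mk K.Glue (Sum.inl v)

/-- The characteristic map of a 1-cell, extended to `ℝ` by constants. -/
def edge (K : OneDimCW Z₀ Λ) (l : Λ) : ℝ → K.Space := Set.IccExtend (zero_le_one' ℝ) (K.char l)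

variable (K : OneDimCW Z₀ Λ)

theorem curve_eq_comp {d : ℕ} (f : K.Space → EuclideanSpace ℝ (Fin d)) (l : Λ) :
    K.curve f l = f ∘ K.edge l := rfl

theorem edge_of_mem (l : Λ) {s : ℝ} (hs : s ∈ Set.Icc (0 : ℝ) 1) :
    K.edge l s = K.char l ⟨s, hs⟩ :=
  Set.IccExtend_of_mem _ _ hs

theorem edge_zero (l : Λ) : K.edge l 0 = K.vertex (K.start l) := by
  rw [K.edge_of_mem l ⟨le_rfl, zero_le_one⟩]
  exact Quot.sound (Glue.start l)

theorem edge_one (l : Λ) : K.edge l 1 = K.vertex (K.finish l) := by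
  rw [K.edge_of_mem l ⟨zero_le_one, le_rfl⟩]
  exact Quot.sound (Glue.finish l)

theorem continuous_char (l : Λ) : Continuous (K.char l) := by
  let _ : TopologicalSpace Z₀ := ⊥
  have h1 : Continuous (fun p : Z₀ ⊕ (Σ _ : Λ, unitInterval) => (Quot.mk K.Glue p : K.Space)) :=
    continuous_quot_mk
  exact h1.comp (continuous_inr.comp continuous_sigmaMk)

theorem continuous_edge (l : Λ) : Continuous (K.edge l) :=
  (K.continuous_char l).Icc_extend'

theorem continuous_of_char {Y : Type*} [TopologicalSpace Y] {f : K.Space → Y}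
    (hf : ∀ l, Continuous fun s => f (K.char l s)) : Continuous f := by
  let _ : TopologicalSpace Z₀ := ⊥
  have : DiscreteTopology Z₀ := ⟨rfl⟩
  have h1 : Continuous (fun p : Z₀ ⊕ (Σ _ : Λ, unitInterval) => f (Quot.mk K.Glue p)) := by
    rw [continuous_sum_dom]
    exact ⟨continuous_of_discreteTopology, continuous_sigma hf⟩
  exact continuous_coinduced_dom.2 h1

theorem continuous_of_mem_smoothMaps {r : ℕ∞} {d : ℕ} {f : K.Space → EuclideanSpace ℝ (Fin d)}
    (hf : f ∈ K.smoothMaps r d) : Continuous f := by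
  refine K.continuous_of_char fun l => ?_
  have h := continuousOn_iff_continuous_domRestrict.1 (hf l).continuousOn
  refine h.congr fun s => ?_
  change f (K.edge l s) = _
  rw [K.edge_of_mem l s.2]

/-- Every point is a 0-cell or an interior point of a 1-cell. -/
theorem exists_rep (z : K.Space) :
    (∃ v, K.vertex v = z) ∨ ∃ l, ∃ s ∈ Set.Ioo (0 : ℝ) 1, K.edge l s = z := by
  obtain ⟨p, rfl⟩ := Quot.exists_rep z
  rcases p with v | ⟨l, s⟩
  · exact Or.inl ⟨v, rfl⟩
  · have e : (Quot.mk K.Glue (Sum.inr ⟨l, s⟩) : K.Space) = K.edge l s :=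
      (K.edge_of_mem l s.2).symm
    rw [e]
    rcases eq_or_lt_of_le s.2.1 with h0 | h0
    · exact Or.inl ⟨K.start l, by rw [← h0, K.edge_zero]⟩
    rcases eq_or_lt_of_le s.2.2 with h1 | h1
    · exact Or.inl ⟨K.finish l, by rw [h1, K.edge_one]⟩
    exact Or.inr ⟨l, s, ⟨h0, h1⟩, rfl⟩

open Classical in
/-- The barycentric coordinate of a point with respect to a 0-cell. -/
def vertexCoord (v : Z₀) : K.Space → ℝ :=
  Quot.lift (Sum.elim (fun w => if w = v then 1 else 0) fun p =>
    (1 - (p.2 : ℝ)) * (if K.start p.1 = v then 1 else 0) +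
      p.2 * (if K.finish p.1 = v then 1 else 0)) (by
    rintro _ _ (l | l) <;> simp)

open Classical in
/-- A function of the position on the 1-cell `l` that vanishes at both of its ends, extended by
zero. -/
def edgeCoord (l : Λ) (b : ℝ → ℝ) : K.Space → ℝ :=
  Quot.lift (Sum.elim (fun _ => 0) fun p => if p.1 = l then p.2 * (1 - p.2) * b p.2 else 0) (by
    rintro _ _ (l | l) <;> simp)

theorem vertexCoord_vertex_self (v : Z₀) : K.vertexCoord v (K.vertex v) = 1 := by
  simp [vertexCoord, vertex]

theorem vertexCoord_vertex_of_ne {v w : Z₀} (h : w ≠ v) : K.vertexCoord v (K.vertex w) = 0 := by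
  simp [vertexCoord, vertex, h]

theorem edgeCoord_vertex (l : Λ) (b : ℝ → ℝ) (v : Z₀) : K.edgeCoord l b (K.vertex v) = 0 := rfl

theorem edgeCoord_edge_self (l : Λ) (b : ℝ → ℝ) {s : ℝ} (hs : s ∈ Set.Icc (0 : ℝ) 1) :
    K.edgeCoord l b (K.edge l s) = s * (1 - s) * b s := by
  rw [K.edge_of_mem l hs]
  simp [edgeCoord, char]

theorem edgeCoord_edge_of_ne {l m : Λ} (h : m ≠ l) (b : ℝ → ℝ) {s : ℝ}
    (hs : s ∈ Set.Icc (0 : ℝ) 1) : K.edgeCoord l b (K.edge m s) = 0 := by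
  rw [K.edge_of_mem m hs]
  simp [edgeCoord, char, h]

theorem continuous_vertexCoord (v : Z₀) : Continuous (K.vertexCoord v) := by
  refine K.continuous_of_char fun l => ?_
  simp only [vertexCoord, char, Sum.elim_inr]
  by_cases h1 : K.start l = v <;> by_cases h2 : K.finish l = v <;>
    simp only [h1, h2, if_true, if_false] <;> fun_prop

theorem continuous_edgeCoord (l : Λ) {b : ℝ → ℝ} (hb : Continuous b) :
    Continuous (K.edgeCoord l b) := by
  refine K.continuous_of_char fun m => ?_
  simp only [edgeCoord, char, Sum.elim_inr]
  by_cases h : m = l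
  · simp only [if_pos h]
    fun_prop
  · simp only [if_neg h]
    fun_prop

theorem vertex_injective : Function.Injective K.vertex := by
  intro v w h
  by_contra hne
  have := K.vertexCoord_vertex_of_ne (Ne.symm hne)
  rw [← h, K.vertexCoord_vertex_self] at this
  exact one_ne_zero this

theorem edge_ne_vertex (l : Λ) {s : ℝ} (hs : s ∈ Set.Ioo (0 : ℝ) 1) (v : Z₀) :
    K.edge l s ≠ K.vertex v := by
  intro h
  have := K.edgeCoord_edge_self l (fun _ => 1) (Set.Ioo_subset_Icc_self hs)
  rw [h, K.edgeCoord_vertex] at this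
  have h2 : 0 < s * (1 - s) := mul_pos hs.1 (by linarith [hs.2])
  linarith

theorem edge_inj {l m : Λ} {s t : ℝ} (hs : s ∈ Set.Ioo (0 : ℝ) 1) (ht : t ∈ Set.Icc (0 : ℝ) 1)
    (h : K.edge l s = K.edge m t) : l = m ∧ s = t := by
  have h1 := K.edgeCoord_edge_self l (fun _ => 1) (Set.Ioo_subset_Icc_self hs)
  have h2 := K.edgeCoord_edge_self l (fun x => x) (Set.Ioo_subset_Icc_self hs)
  have h3 : 0 < s * (1 - s) := mul_pos hs.1 (by linarith [hs.2])
  have hlm : l = m := by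
    by_contra hne
    rw [h, K.edgeCoord_edge_of_ne (Ne.symm hne) _ ht] at h1
    linarith
  subst hlm
  refine ⟨rfl, ?_⟩
  rw [h, K.edgeCoord_edge_self _ _ ht] at h1 h2
  have : s * (1 - s) * (s - t) = 0 := by linear_combination t * h1 - h2
  rcases mul_eq_zero.1 this with h0 | h0 <;> linarith

instance : T2Space K.Space := by
  let F : K.Space → (Z₀ → ℝ) × (Λ → ℝ × ℝ) := fun z =>
    (fun v => K.vertexCoord v z, fun l => (K.edgeCoord l (fun _ => 1) z, K.edgeCoord l id z))
  have hF : Continuous F :=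
    (continuous_pi fun v => K.continuous_vertexCoord v).prodMk (continuous_pi fun l =>
      (K.continuous_edgeCoord l continuous_const).prodMk (K.continuous_edgeCoord l continuous_id))
  refine T2Space.of_injective_continuous (f := F) ?_ hF
  intro z w h
  have hv : ∀ v, K.vertexCoord v z = K.vertexCoord v w := fun v => congrFun (congrArg Prod.fst h) v
  have he1 : ∀ l, K.edgeCoord l (fun _ => 1) z = K.edgeCoord l (fun _ => 1) w := fun l =>
    congrArg Prod.fst (congrFun (congrArg Prod.snd h) l)
  have he2 : ∀ l, K.edgeCoord l id z = K.edgeCoord l id w := fun l =>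
    congrArg Prod.snd (congrFun (congrArg Prod.snd h) l)
  rcases K.exists_rep z with ⟨v, rfl⟩ | ⟨l, s, hs, rfl⟩ <;>
    rcases K.exists_rep w with ⟨v', rfl⟩ | ⟨l', s', hs', rfl⟩
  · by_contra hne
    have hne' : v' ≠ v := fun e => hne (by rw [e])
    have := hv v
    rw [K.vertexCoord_vertex_self, K.vertexCoord_vertex_of_ne hne'] at this
    exact one_ne_zero this
  · have h1 := he1 l'
    rw [K.edgeCoord_vertex, K.edgeCoord_edge_self _ _ (Set.Ioo_subset_Icc_self hs')] at h1
    have h3 : 0 < s' * (1 - s') := mul_pos hs'.1 (by linarith [hs'.2])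
    linarith
  · have h1 := he1 l
    rw [K.edgeCoord_vertex, K.edgeCoord_edge_self _ _ (Set.Ioo_subset_Icc_self hs)] at h1
    have h3 : 0 < s * (1 - s) := mul_pos hs.1 (by linarith [hs.2])
    linarith
  · have h1 := he1 l
    have h2 := he2 l
    have h3 : 0 < s * (1 - s) := mul_pos hs.1 (by linarith [hs.2])
    rw [K.edgeCoord_edge_self _ _ (Set.Ioo_subset_Icc_self hs)] at h1 h2
    have hl : l' = l := by
      by_contra hne
      rw [K.edgeCoord_edge_of_ne hne _ (Set.Ioo_subset_Icc_self hs')] at h1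
      linarith
    subst hl
    rw [K.edgeCoord_edge_self _ _ (Set.Ioo_subset_Icc_self hs')] at h1 h2
    simp only [id] at h2
    have : s * (1 - s) * (s - s') = 0 := by linear_combination h2 - s' * h1
    have h4 : s = s' := by rcases mul_eq_zero.1 this with h0 | h0 <;> linarith
    rw [h4]

end OneDimCW

/-! ### Transversal zeros of a function on an interval -/

/-- The points of a finite subset of the open unit interval, listed in increasing order between
`0` and `1`. -/
theorem exists_strictMono_enumeration (C : Finset ℝ) (hC : ∀ c ∈ C, c ∈ Set.Ioo (0 : ℝ) 1) :
    ∃ x : ℕ → ℝ, StrictMono x ∧ x 0 = 0 ∧ x (C.card + 1) = 1 ∧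
      ∀ c, c ∈ C ↔ ∃ i < C.card, x (i + 1) = c := by
  classical
  set D : Finset ℝ := insert 0 (insert 1 C) with hD
  have h1C : (1 : ℝ) ∉ C := fun h => lt_irrefl _ (hC 1 h).2
  have h0C : (0 : ℝ) ∉ insert 1 C := by
    rw [Finset.mem_insert, not_or]
    exact ⟨zero_ne_one, fun h => lt_irrefl _ (hC 0 h).1⟩
  have hcard : D.card = C.card + 2 := by
    rw [hD, Finset.card_insert_of_notMem h0C, Finset.card_insert_of_notMem h1C]
  have hD01 : ∀ c ∈ D, c ∈ Set.Icc (0 : ℝ) 1 := by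
    intro c hc
    rw [hD, Finset.mem_insert, Finset.mem_insert] at hc
    rcases hc with rfl | rfl | hc
    · simp
    · simp
    · exact Set.Ioo_subset_Icc_self (hC c hc)
  set e := D.orderEmbOfFin hcard
  have hemem : ∀ i, e i ∈ D := fun i => D.orderEmbOfFin_mem hcard i
  have hsurj : ∀ c ∈ D, ∃ i, e i = c := by
    intro c hc
    have : c ∈ Set.range e := by
      rw [Finset.range_orderEmbOfFin]
      exact hc
    exact this
  let x : ℕ → ℝ := fun i => if h : i < C.card + 2 then e ⟨i, h⟩ else i
  have hx : ∀ (i : ℕ) (h : i < C.card + 2), x i = e ⟨i, h⟩ := fun i h => dif_pos h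
  have hmono : StrictMono x := by
    intro i k hik
    by_cases hk : k < C.card + 2
    · rw [hx k hk, hx i (hik.trans hk)]
      exact e.strictMono hik
    · have hk' : x k = k := dif_neg hk
      by_cases hi : i < C.card + 2
      · rw [hx i hi, hk']
        have h1 := (hD01 _ (hemem ⟨i, hi⟩)).2
        have h2 : (2 : ℝ) ≤ k := by
          have : 2 ≤ k := by omega
          exact_mod_cast this
        linarith
      · have hi' : x i = i := dif_neg hi
        rw [hi', hk']
        exact_mod_cast hik
  have hx0 : x 0 = 0 := by
    obtain ⟨i, hi⟩ := hsurj 0 (by simp [hD])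
    have h1 : x 0 ≤ x i := hmono.monotone (Nat.zero_le _)
    rw [hx i i.2] at h1
    have h2 : (0 : ℝ) ≤ x 0 := by
      rw [hx 0 (by omega)]
      exact (hD01 _ (hemem _)).1
    exact le_antisymm (h1.trans hi.le) h2
  have hx1 : x (C.card + 1) = 1 := by
    obtain ⟨i, hi⟩ := hsurj 1 (by simp [hD])
    have h1 : x i ≤ x (C.card + 1) := hmono.monotone (by omega)
    rw [hx i i.2] at h1
    have h2 : x (C.card + 1) ≤ 1 := by
      rw [hx (C.card + 1) (by omega)]
      exact (hD01 _ (hemem _)).2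
    exact le_antisymm h2 (hi.symm.le.trans h1)
  refine ⟨x, hmono, hx0, hx1, fun c => ⟨fun hc => ?_, ?_⟩⟩
  · obtain ⟨i, hi⟩ := hsurj c (by simp [hD, hc])
    have hxi : x i = c := (hx i i.2).trans hi
    have h0 : (i : ℕ) ≠ 0 := by
      intro h
      rw [h, hx0] at hxi
      exact absurd (hC c hc).1 (by rw [hxi]; exact lt_irrefl _)
    have h1 : (i : ℕ) ≠ C.card + 1 := by
      intro h
      rw [h, hx1] at hxi
      exact absurd (hC c hc).2 (by rw [hxi]; exact lt_irrefl _)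
    obtain ⟨k, hk⟩ := Nat.exists_eq_succ_of_ne_zero h0
    have := i.2
    exact ⟨k, by omega, by rw [← Nat.succ_eq_add_one, ← hk, hxi]⟩
  · rintro ⟨i, hi, rfl⟩
    have hmem : x (i + 1) ∈ D := by
      rw [hx (i + 1) (by omega)]
      exact hemem _
    rw [hD, Finset.mem_insert, Finset.mem_insert] at hmem
    rcases hmem with h | h | h
    · rw [← hx0] at h
      exact absurd (hmono.injective h) (by omega)
    · rw [← hx1] at h
      exact absurd (hmono.injective h) (by omega)
    · exact h

theorem exists_lt_le_succ {x : ℕ → ℝ} {s : ℝ} (h0 : x 0 < s) {k : ℕ} (hk : s ≤ x k) :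
    ∃ i < k, x i < s ∧ s ≤ x (i + 1) := by
  induction k with
  | zero => exact absurd h0 (not_lt.2 hk)
  | succ k ih =>
    rcases le_or_gt s (x k) with h | h
    · obtain ⟨i, hi, hi'⟩ := ih h
      exact ⟨i, by omega, hi'⟩
    · exact ⟨k, by omega, h, hk⟩

/-- A continuous function without zeros on a connected set does not change sign. -/
theorem lt_zero_of_isPreconnected {g : ℝ → ℝ} {A : Set ℝ} (hA : IsPreconnected A)
    (hg : ContinuousOn g A) (h0 : ∀ s ∈ A, g s ≠ 0) {s t : ℝ} (hs : s ∈ A) (ht : t ∈ A)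
    (h : g s < 0) : g t < 0 := by
  by_contra hle
  obtain ⟨u, hu, hu0⟩ := hA.intermediate_value hs ht hg ⟨h.le, not_lt.1 hle⟩
  exact h0 u hu hu0

theorem eventually_mul_pos_of_hasDerivAt {g : ℝ → ℝ} {g' c : ℝ} (h : HasDerivAt g g' c)
    (hc : g c = 0) (h0 : g' ≠ 0) : ∀ᶠ s in nhdsWithin c {c}ᶜ, 0 < (s - c) * g s * g' := by
  have h1 : Filter.Tendsto (fun s => slope g c s * g') (nhdsWithin c {c}ᶜ) (nhds (g' * g')) :=
    (hasDerivAt_iff_tendsto_slope.1 h).mul_const _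
  have h2 := h1.eventually (lt_mem_nhds (mul_self_pos.2 h0))
  filter_upwards [h2, self_mem_nhdsWithin] with s hs hsc
  have hne : s - c ≠ 0 := sub_ne_zero.2 hsc
  have h3 : (s - c) * g s * g' = (s - c) ^ 2 * (slope g c s * g') := by
    rw [slope_def_field, hc]
    field_simp
    ring
  rw [h3]
  positivity

/-- At a transversal zero exactly one of the two adjacent intervals without zeros carries negative
values. -/
theorem lt_zero_iff_not_lt_zero_of_transversal {g : ℝ → ℝ} {a c b g' : ℝ} (hac : a < c)
    (hcb : c < b) (hg : ContinuousOn g (Set.Ioo a b)) (hc : g c = 0)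
    (h0 : ∀ s ∈ Set.Ioo a b, s ≠ c → g s ≠ 0) (h : HasDerivAt g g' c) (hg' : g' ≠ 0)
    {s t : ℝ} (hs : s ∈ Set.Ioo a c) (ht : t ∈ Set.Ioo c b) : g s < 0 ↔ ¬ g t < 0 := by
  have hev := eventually_mul_pos_of_hasDerivAt h hc hg'
  have hL : ∀ᶠ u in nhdsWithin c (Set.Iio c), 0 < (u - c) * g u * g' :=
    hev.filter_mono (nhdsWithin_mono _ fun u hu => ne_of_lt hu)
  have hR : ∀ᶠ u in nhdsWithin c (Set.Ioi c), 0 < (u - c) * g u * g' :=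
    hev.filter_mono (nhdsWithin_mono _ fun u hu => ne_of_gt hu)
  obtain ⟨p, hp, hpI⟩ := (hL.and (Ioo_mem_nhdsLT hac)).exists
  obtain ⟨q, hq, hqI⟩ := (hR.and (Ioo_mem_nhdsGT hcb)).exists
  have hsubL : Set.Ioo a c ⊆ Set.Ioo a b := Set.Ioo_subset_Ioo_right hcb.le
  have hsubR : Set.Ioo c b ⊆ Set.Ioo a b := Set.Ioo_subset_Ioo_left hac.le
  have hsp : g s < 0 ↔ g p < 0 :=
    ⟨lt_zero_of_isPreconnected isPreconnected_Ioo (hg.mono hsubL)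
      (fun u hu => h0 u (hsubL hu) hu.2.ne) hs hpI,
    lt_zero_of_isPreconnected isPreconnected_Ioo (hg.mono hsubL)
      (fun u hu => h0 u (hsubL hu) hu.2.ne) hpI hs⟩
  have htq : g t < 0 ↔ g q < 0 :=
    ⟨lt_zero_of_isPreconnected isPreconnected_Ioo (hg.mono hsubR)
      (fun u hu => h0 u (hsubR hu) hu.1.ne') ht hqI,
    lt_zero_of_isPreconnected isPreconnected_Ioo (hg.mono hsubR)
      (fun u hu => h0 u (hsubR hu) hu.1.ne') hqI ht⟩
  rw [hsp, htq]
  have hpc : p - c < 0 := by linarith [hpI.2]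
  have hqc : 0 < q - c := by linarith [hqI.1]
  have hp2 : g p * g' < 0 := by
    by_contra hcon
    nlinarith [mul_nonneg (neg_nonneg.2 hpc.le) (not_lt.1 hcon)]
  have hq2 : 0 < g q * g' := by
    by_contra hcon
    nlinarith [mul_nonneg hqc.le (neg_nonneg.2 (not_lt.1 hcon))]
  rcases lt_or_gt_of_ne hg' with hneg | hpos
  · have h1 : 0 < g p := by
      by_contra hcon
      nlinarith [mul_nonneg (neg_nonneg.2 (not_lt.1 hcon)) (neg_nonneg.2 hneg.le)]
    have h2 : g q < 0 := by
      by_contra hcon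
      nlinarith [mul_nonneg (not_lt.1 hcon) (neg_nonneg.2 hneg.le)]
    exact ⟨fun hp' => absurd hp' (not_lt.2 h1.le), fun hq' => absurd h2 hq'⟩
  · have h1 : g p < 0 := by
      by_contra hcon
      nlinarith [mul_nonneg (not_lt.1 hcon) hpos.le]
    have h2 : 0 < g q := by
      by_contra hcon
      nlinarith [mul_nonneg (neg_nonneg.2 (not_lt.1 hcon)) hpos.le]
    exact ⟨fun _ => not_lt.2 h2.le, fun _ => h1⟩

/-- The set where a function on the unit interval with transversal zeros is negative is a disjoint
union of open intervals. As every zero is an end of exactly one of them, twice their number is the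
number of zeros plus the number of ends of the unit interval with a negative value. -/
theorem exists_negative_intervals {g : ℝ → ℝ} (hg : ContinuousOn g (Set.Icc 0 1)) (h0 : g 0 ≠ 0)
    (h1 : g 1 ≠ 0) (C : Finset ℝ) (hC : ∀ s, s ∈ C ↔ s ∈ Set.Ioo (0 : ℝ) 1 ∧ g s = 0)
    (htr : ∀ c ∈ C, ∃ g', g' ≠ 0 ∧ HasDerivAt g g' c) :
    ∃ (x : ℕ → ℝ) (I : Finset ℕ), StrictMono x ∧ (∀ i ∈ I, 0 ≤ x i ∧ x (i + 1) ≤ 1) ∧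
      (∀ i ∈ I, x i ∈ C ∨ x i = 0 ∧ g 0 < 0) ∧
      (∀ i ∈ I, x (i + 1) ∈ C ∨ x (i + 1) = 1 ∧ g 1 < 0) ∧
      (∀ i ∈ I, ∀ s ∈ Set.Ioo (x i) (x (i + 1)), g s < 0) ∧
      (∀ s ∈ Set.Ioo (0 : ℝ) 1, g s < 0 → ∃ i ∈ I, s ∈ Set.Ioo (x i) (x (i + 1))) ∧
      2 * I.card = C.card + (if g 0 < 0 then 1 else 0) + (if g 1 < 0 then 1 else 0) := by
  classical
  obtain ⟨x, hx, hx0, hx1, hxC⟩ := exists_strictMono_enumeration C fun c hc => ((hC c).1 hc).1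
  set m := C.card with hm
  have hxpos : ∀ i, 0 ≤ x i := fun i => hx0 ▸ hx.monotone (Nat.zero_le i)
  have hxle : ∀ i ≤ m + 1, x i ≤ 1 := fun i hi => hx1 ▸ hx.monotone hi
  have hgap0 : ∀ i ≤ m, ∀ s ∈ Set.Ioo (x i) (x (i + 1)), g s ≠ 0 := by
    intro i hi s hs hs0
    have hsC : s ∈ C := (hC s).2
      ⟨⟨(hxpos i).trans_lt hs.1, hs.2.trans_le (hxle _ (by omega))⟩, hs0⟩
    obtain ⟨k, hk, rfl⟩ := (hxC s).1 hsC
    have h2 := hx.lt_iff_lt.1 hs.1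
    have h3 := hx.lt_iff_lt.1 hs.2
    omega
  let p : ℕ → ℝ := fun i => (x i + x (i + 1)) / 2
  have hp : ∀ i, p i ∈ Set.Ioo (x i) (x (i + 1)) := fun i => by
    have := hx (Nat.lt_succ_self i)
    constructor <;> simp only [p] <;> linarith
  have hsub : ∀ i ≤ m, Set.Ioo (x i) (x (i + 1)) ⊆ Set.Icc 0 1 := fun i hi s hs =>
    ⟨(hxpos i).trans hs.1.le, hs.2.le.trans (hxle _ (by omega))⟩
  have hgap : ∀ i ≤ m, ∀ s ∈ Set.Ioo (x i) (x (i + 1)), (g s < 0 ↔ g (p i) < 0) := by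
    intro i hi s hs
    exact ⟨lt_zero_of_isPreconnected isPreconnected_Ioo (hg.mono (hsub i hi)) (hgap0 i hi) hs
      (hp i), lt_zero_of_isPreconnected isPreconnected_Ioo (hg.mono (hsub i hi)) (hgap0 i hi)
      (hp i) hs⟩
  have hfirst : g 0 < 0 ↔ g (p 0) < 0 := by
    have hz : ∀ s ∈ Set.Ico 0 (x 1), g s ≠ 0 := by
      intro s hs
      rcases eq_or_lt_of_le hs.1 with rfl | hlt
      · exact h0
      · exact hgap0 0 (Nat.zero_le _) s ⟨hx0 ▸ hlt, hs.2⟩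
    have hc : ContinuousOn g (Set.Ico 0 (x 1)) :=
      hg.mono fun s hs => ⟨hs.1, hs.2.le.trans (hxle 1 (by omega))⟩
    have hpm : p 0 ∈ Set.Ico 0 (x 1) := ⟨hx0 ▸ (hp 0).1.le, (hp 0).2⟩
    have h0m : (0 : ℝ) ∈ Set.Ico 0 (x 1) := ⟨le_rfl, hx0 ▸ hx zero_lt_one⟩
    exact ⟨lt_zero_of_isPreconnected isPreconnected_Ico hc hz h0m hpm,
      lt_zero_of_isPreconnected isPreconnected_Ico hc hz hpm h0m⟩
  have hlast : g 1 < 0 ↔ g (p m) < 0 := by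
    have hz : ∀ s ∈ Set.Ioc (x m) 1, g s ≠ 0 := by
      intro s hs
      rcases eq_or_lt_of_le hs.2 with rfl | hlt
      · exact h1
      · exact hgap0 m le_rfl s ⟨hs.1, hx1 ▸ hlt⟩
    have hc : ContinuousOn g (Set.Ioc (x m) 1) :=
      hg.mono fun s hs => ⟨(hxpos m).trans hs.1.le, hs.2⟩
    have hpm : p m ∈ Set.Ioc (x m) 1 := ⟨(hp m).1, hx1 ▸ (hp m).2.le⟩
    have h1m : (1 : ℝ) ∈ Set.Ioc (x m) 1 := ⟨hx1 ▸ hx (Nat.lt_succ_self m), le_rfl⟩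
    exact ⟨lt_zero_of_isPreconnected isPreconnected_Ioc hc hz h1m hpm,
      lt_zero_of_isPreconnected isPreconnected_Ioc hc hz hpm h1m⟩
  have halt : ∀ i < m, (g (p i) < 0 ↔ ¬ g (p (i + 1)) < 0) := by
    intro i hi
    have hcC : x (i + 1) ∈ C := (hxC _).2 ⟨i, hi, rfl⟩
    obtain ⟨g', hg', hd⟩ := htr _ hcC
    refine lt_zero_iff_not_lt_zero_of_transversal (hx (Nat.lt_succ_self i))
      (hx (Nat.lt_succ_self (i + 1))) (hg.mono ?_) ((hC _).1 hcC).2 ?_ hd hg' (hp i) (hp (i + 1))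
    · exact fun s hs => ⟨(hxpos i).trans hs.1.le, hs.2.le.trans (hxle _ (by omega))⟩
    · intro s hs hne
      rcases lt_or_gt_of_ne hne with hlt | hgt
      · exact hgap0 i hi.le s ⟨hs.1, hlt⟩
      · exact hgap0 (i + 1) hi s ⟨hgt, hs.2⟩
  let σ : ℕ → ℕ := fun i => if g (p i) < 0 then 1 else 0
  have hσ : ∀ i < m, σ i + σ (i + 1) = 1 := by
    intro i hi
    simp only [σ]
    have := halt i hi
    by_cases h : g (p i) < 0
    · rw [if_pos h, if_neg (this.1 h)]
    · rw [if_neg h, if_pos (by tauto)]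
  have hsum : 2 * ∑ i ∈ Finset.range (m + 1), σ i = m + σ 0 + σ m := by
    have e1 := Finset.sum_range_succ σ m
    have e2 := Finset.sum_range_succ' σ m
    have e3 : ∑ i ∈ Finset.range m, (σ i + σ (i + 1)) = m := by
      rw [Finset.sum_congr rfl fun i hi => hσ i (Finset.mem_range.1 hi)]
      simp
    rw [Finset.sum_add_distrib] at e3
    omega
  refine ⟨x, (Finset.range (m + 1)).filter fun i => g (p i) < 0, hx, ?_, ?_, ?_, ?_, ?_, ?_⟩
  · intro i hi
    rw [Finset.mem_filter, Finset.mem_range] at hi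
    exact ⟨hxpos i, hxle _ (by omega)⟩
  · intro i hi
    rw [Finset.mem_filter, Finset.mem_range] at hi
    rcases i with _ | i
    · exact Or.inr ⟨hx0, hfirst.2 hi.2⟩
    · exact Or.inl ((hxC _).2 ⟨i, by omega, rfl⟩)
  · intro i hi
    rw [Finset.mem_filter, Finset.mem_range] at hi
    rcases Nat.lt_or_ge i m with h | h
    · exact Or.inl ((hxC _).2 ⟨i, h, rfl⟩)
    · have : i = m := by omega
      subst this
      exact Or.inr ⟨hx1, hlast.2 hi.2⟩
  · intro i hi s hs
    rw [Finset.mem_filter, Finset.mem_range] at hi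
    exact (hgap i (by omega) s hs).2 hi.2
  · intro s hs hneg
    obtain ⟨i, hi, hsi⟩ := exists_lt_le_succ (x := x) (hx0 ▸ hs.1) (hx1.symm ▸ hs.2.le)
    have hne : s ≠ x (i + 1) := by
      rintro rfl
      rcases Nat.lt_or_ge i m with h | h
      · exact hneg.ne ((hC _).1 ((hxC _).2 ⟨i, h, rfl⟩)).2
      · have : i = m := by omega
        subst this
        exact hs.2.ne hx1
    have hsI : s ∈ Set.Ioo (x i) (x (i + 1)) := ⟨hsi.1, lt_of_le_of_ne hsi.2 hne⟩
    refine ⟨i, ?_, hsI⟩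
    rw [Finset.mem_filter, Finset.mem_range]
    exact ⟨hi, (hgap i (by omega) s hsI).1 hneg⟩
  · rw [Finset.card_filter, hsum]
    simp only [σ, hfirst, hlast]

/-! ### Sublevel sets as graphs -/

namespace OneDimCW

variable {Z₀ Λ : Type} (K : OneDimCW Z₀ Λ)

/-- The Euler characteristic of a sublevel set at a level that is not attained at 0-cells and is
attained finitely often, and only transversally, inside the 1-cells. The sublevel set is a finite
graph, whose vertices are the 0-cells and level points in it. -/
theorem eulerCharacteristic_sublevel [Fintype Z₀] [Fintype Λ] {h : K.Space → ℝ}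
    (hh : Continuous h) (t : ℝ) (hv : ∀ v, h (K.vertex v) ≠ t)
    (hfin : ∀ l, (Set.Ioo (0 : ℝ) 1 ∩ {s | h (K.edge l s) = t}).Finite)
    (htr : ∀ l, ∀ s ∈ Set.Ioo (0 : ℝ) 1, h (K.edge l s) = t →
      ∃ h', h' ≠ 0 ∧ HasDerivAt (fun s => h (K.edge l s)) h' s) :
    ∃ n : ℤ, eulerCharacteristic {z // h z ≤ t} = (n : WithTop ℤ) ∧
      (n : ℝ) = ∑ v, (if h (K.vertex v) ≤ t then (1 : ℝ) else 0) +
        ∑ l, (((Set.Ioo (0 : ℝ) 1 ∩ {s | h (K.edge l s) = t}).ncard : ℝ) -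
          (if h (K.edge l 0) ≤ t then 1 else 0) - (if h (K.edge l 1) ≤ t then 1 else 0)) / 2 := by
  classical
  let C : Λ → Finset ℝ := fun l => (hfin l).toFinset
  have hC : ∀ l s, s ∈ C l ↔ s ∈ Set.Ioo (0 : ℝ) 1 ∧ h (K.edge l s) - t = 0 := by
    intro l s
    simp only [C, Set.Finite.mem_toFinset, Set.mem_inter_iff, Set.mem_ofPred_eq, sub_eq_zero]
  have hCcard : ∀ l, (Set.Ioo (0 : ℝ) 1 ∩ {s | h (K.edge l s) = t}).ncard = (C l).card := fun l =>
    Set.ncard_eq_toFinset_card _ (hfin l)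
  have hcont : ∀ l, Continuous fun s => h (K.edge l s) - t := fun l =>
    (hh.comp (K.continuous_edge l)).sub continuous_const
  have h0 : ∀ l, h (K.edge l 0) - t ≠ 0 := fun l => by
    rw [K.edge_zero]
    exact sub_ne_zero.2 (hv _)
  have h1 : ∀ l, h (K.edge l 1) - t ≠ 0 := fun l => by
    rw [K.edge_one]
    exact sub_ne_zero.2 (hv _)
  choose x I hx hx01 hleft hright hneg hcov hcard using fun l =>
    exists_negative_intervals (hcont l).continuousOn (h0 l) (h1 l) (C l) (hC l) fun c hc => by
      obtain ⟨h', hne, hd⟩ := htr l c ((hC l c).1 hc).1 (sub_eq_zero.1 ((hC l c).1 hc).2)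
      exact ⟨h', hne, hd.sub_const t⟩
  -- the vertices of the graph
  let V : Finset (Z₀ ⊕ (Σ _ : Λ, ℝ)) :=
    (Finset.univ.filter fun v => h (K.vertex v) < t).disjSum (Finset.univ.sigma C)
  let π : Z₀ ⊕ (Σ _ : Λ, ℝ) → K.Space := Sum.elim K.vertex fun q => K.edge q.1 q.2
  have hVl : ∀ v, Sum.inl v ∈ V ↔ h (K.vertex v) < t := fun v => by simp [V]
  have hVr : ∀ l s, Sum.inr ⟨l, s⟩ ∈ V ↔ s ∈ C l := fun l s => by simp [V]
  have hπ : Set.InjOn π V := by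
    rintro (v | ⟨l, s⟩) hp (w | ⟨m, u⟩) hq hpq
    · rw [K.vertex_injective hpq]
    · exact absurd hpq.symm (K.edge_ne_vertex m ((hC m u).1 ((hVr m u).1 hq)).1 v)
    · exact absurd hpq (K.edge_ne_vertex l ((hC l s).1 ((hVr l s).1 hp)).1 w)
    · obtain ⟨rfl, rfl⟩ := K.edge_inj ((hC l s).1 ((hVr l s).1 hp)).1
        (Set.Ioo_subset_Icc_self ((hC m u).1 ((hVr m u).1 hq)).1) hpq
      rfl
  set P : Set K.Space := π '' V with hP
  have hPv : ∀ v, h (K.vertex v) < t → K.vertex v ∈ P := fun v hlt =>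
    ⟨Sum.inl v, (hVl v).2 hlt, rfl⟩
  have hPe : ∀ l, ∀ s ∈ C l, K.edge l s ∈ P := fun l s hs => ⟨Sum.inr ⟨l, s⟩, (hVr l s).2 hs, rfl⟩
  have hPcard : P.ncard = V.card := by
    rw [hP, Set.InjOn.ncard_image hπ, Set.ncard_coe_finset]
  -- the edges of the graph
  let u : (Σ _ : Λ, ℕ) → ℝ → ℝ := fun i s => x i.1 i.2 + s * (x i.1 (i.2 + 1) - x i.1 i.2)
  let j : (Σ _ : Λ, ℕ) → ℝ → K.Space := fun i s => K.edge i.1 (u i s)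
  let J : Finset (Σ _ : Λ, ℕ) := Finset.univ.sigma I
  have hJ : ∀ i, i ∈ J ↔ i.2 ∈ I i.1 := fun i => by simp [J]
  have hlen : ∀ i : Σ _ : Λ, ℕ, 0 < x i.1 (i.2 + 1) - x i.1 i.2 := fun i =>
    sub_pos.2 (hx i.1 (Nat.lt_succ_self i.2))
  have hu : ∀ i, ∀ s ∈ Set.Ioo (0 : ℝ) 1, u i s ∈ Set.Ioo (x i.1 i.2) (x i.1 (i.2 + 1)) := by
    intro i s hs
    have := hlen i
    constructor <;> simp only [u] <;> nlinarith [hs.1, hs.2]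
  have hu01 : ∀ i ∈ J, ∀ s ∈ Set.Ioo (0 : ℝ) 1, u i s ∈ Set.Ioo (0 : ℝ) 1 := by
    intro i hi s hs
    have h2 := hx01 i.1 i.2 ((hJ i).1 hi)
    exact ⟨h2.1.trans_lt (hu i s hs).1, (hu i s hs).2.trans_le h2.2⟩
  have hedge : ∀ i ∈ J, ∀ k ∈ J, ∀ s ∈ Set.Ioo (0 : ℝ) 1, ∀ s' ∈ Set.Ioo (0 : ℝ) 1,
      j i s = j k s' → i = k ∧ s = s' := by
    rintro ⟨l, i⟩ hi ⟨m, k⟩ hk s hs s' hs' hss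
    obtain ⟨hlm, he⟩ := K.edge_inj (hu01 _ hi s hs) (Set.Ioo_subset_Icc_self (hu01 _ hk s' hs')) hss
    simp only at hlm
    subst hlm
    have hs1 := hu ⟨l, i⟩ s hs
    have hs2 := hu ⟨l, k⟩ s' hs'
    rw [he] at hs1
    have a1 := (hx l).lt_iff_lt.1 (hs1.1.trans hs2.2)
    have a2 := (hx l).lt_iff_lt.1 (hs2.1.trans hs1.2)
    simp only at a1 a2
    have hik : i = k := by omega
    subst hik
    refine ⟨rfl, ?_⟩
    have := hlen ⟨l, i⟩
    simp only [u] at he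
    have h3 : (s - s') * (x l (i + 1) - x l i) = 0 := by linarith
    rcases mul_eq_zero.1 h3 with h4 | h4
    · linarith
    · simp only at this
      exact absurd h4 this.ne'
  have hjarc : ∀ i ∈ J, IsAttachedArc P (j i) := by
    rintro ⟨l, i⟩ hi
    have hi' : i ∈ I l := (hJ _).1 hi
    refine ⟨((K.continuous_edge l).comp (by fun_prop)).continuousOn, ?_, ?_, ?_, ?_⟩
    · exact fun s hs s' hs' hss => (hedge _ hi _ hi s hs s' hs' hss).2
    · have e : j ⟨l, i⟩ 0 = K.edge l (x l i) := by simp [j, u]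
      rw [e]
      rcases hleft l i hi' with hc | ⟨hx0, hlt⟩
      · exact hPe l _ hc
      · rw [hx0, K.edge_zero]
        rw [K.edge_zero] at hlt
        exact hPv _ (by linarith)
    · have e : j ⟨l, i⟩ 1 = K.edge l (x l (i + 1)) := by simp [j, u]
      rw [e]
      rcases hright l i hi' with hc | ⟨hx0, hlt⟩
      · exact hPe l _ hc
      · rw [hx0, K.edge_one]
        rw [K.edge_one] at hlt
        exact hPv _ (by linarith)
    · rintro s hs ⟨v | ⟨m, c⟩, hp, hps⟩
      · exact K.edge_ne_vertex l (hu01 _ hi s hs) v hps.symm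
      · have hc := (hC m c).1 ((hVr m c).1 hp)
        obtain ⟨hml, hcu⟩ := K.edge_inj hc.1 (Set.Ioo_subset_Icc_self (hu01 _ hi s hs)) hps
        simp only at hml hcu
        subst hml
        have hc2 := hc.2
        rw [hcu] at hc2
        exact (hneg m i hi' _ (hu ⟨m, i⟩ s hs)).ne hc2
  have hset : {z | h z ≤ t} = P ∪ ⋃ i ∈ J, j i '' Set.Ioo 0 1 := by
    apply subset_antisymm
    · intro z hz
      have hz' : h z ≤ t := hz
      rcases K.exists_rep z with ⟨v, rfl⟩ | ⟨l, s, hs, rfl⟩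
      · exact Or.inl (hPv v (lt_of_le_of_ne hz' (hv v)))
      · rcases eq_or_lt_of_le hz' with he | hlt
        · exact Or.inl (hPe l s ((hC l s).2 ⟨hs, sub_eq_zero.2 he⟩))
        · obtain ⟨i, hi, hsi⟩ := hcov l s hs (sub_neg.2 hlt)
          refine Or.inr (Set.mem_iUnion₂.2 ⟨⟨l, i⟩, (hJ _).2 hi,
            (s - x l i) / (x l (i + 1) - x l i), ?_, ?_⟩)
          · have := hlen ⟨l, i⟩
            simp only at this
            exact ⟨div_pos (by linarith [hsi.1]) this, (div_lt_one this).2 (by linarith [hsi.2])⟩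
          · have := (hlen ⟨l, i⟩).ne'
            simp only at this
            simp only [j, u]
            rw [div_mul_cancel₀ _ this]
            congr 1
            ring
    · refine Set.union_subset ?_ (Set.iUnion₂_subset ?_)
      · rintro _ ⟨v | ⟨l, c⟩, hp, rfl⟩
        · exact ((hVl v).1 hp).le
        · have := ((hC l c).1 ((hVr l c).1 hp)).2
          exact (sub_eq_zero.1 this).le
      · rintro ⟨l, i⟩ hi _ ⟨s, hs, rfl⟩
        have := hneg l i ((hJ _).1 hi) _ (hu ⟨l, i⟩ s hs)
        exact (sub_neg.1 this).le
  have hχ := eulerCharacteristic_graph (P := P) (V.finite_toSet.image π) J hjarc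
    fun i hi k hk s hs s' hs' hss => (hedge i hi k hk s hs s' hs' hss).1
  rw [← hset] at hχ
  refine ⟨_, hχ, ?_⟩
  rw [hPcard, Finset.card_disjSum, Finset.card_sigma, Finset.card_sigma, Finset.card_filter]
  have hle : ∀ z : K.Space, h z ≠ t → (h z ≤ t ↔ h z < t) := fun z hz =>
    ⟨fun hz' => lt_of_le_of_ne hz' hz, le_of_lt⟩
  have hI : ∀ l, ((I l).card : ℝ) = ((C l).card + (if h (K.edge l 0) ≤ t then 1 else 0) +
      (if h (K.edge l 1) ≤ t then 1 else 0)) / 2 := by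
    intro l
    have e := hcard l
    have e' : (2 : ℝ) * (I l).card = (C l).card + (if h (K.edge l 0) - t < 0 then 1 else 0) +
      (if h (K.edge l 1) - t < 0 then 1 else 0) := by exact_mod_cast e
    simp only [sub_neg, ← hle _ (sub_ne_zero.1 (h0 l)), ← hle _ (sub_ne_zero.1 (h1 l))] at e'
    linarith
  push_cast
  simp only [hI, hCcard, ← hle _ (hv _)]
  rw [add_sub_assoc, ← Finset.sum_sub_distrib]
  congr 1
  refine Finset.sum_congr rfl fun l _ => ?_
  ring

end OneDimCW

/-! ### Counting level points of a function on an interval -/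

/-- The number of points of the open interval at which the function takes the value `t`. -/
def fiberCount (g : ℝ → ℝ) (a b t : ℝ) : ℝ≥0∞ := ((Set.Ioo a b ∩ {s | g s = t}).encard : ℝ≥0∞)

/-- The points of `(a, b)` with `⌊s * n⌋ = i`, an interval of length at most `1 / n`. -/
def floorPiece (a b : ℝ) (n : ℕ) (i : ℤ) : Set ℝ := Set.Ioo a b ∩ {s | ⌊s * n⌋ = i}

theorem ordConnected_floorPiece (a b : ℝ) (n : ℕ) (i : ℤ) : (floorPiece a b n i).OrdConnected := by
  refine Set.ordConnected_Ioo.inter ⟨fun x hx y hy z hz => ?_⟩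
  have h1 : ⌊x * n⌋ ≤ ⌊z * n⌋ := Int.floor_le_floor (by gcongr; exact hz.1)
  have h2 : ⌊z * n⌋ ≤ ⌊y * n⌋ := Int.floor_le_floor (by gcongr; exact hz.2)
  have hx' : ⌊x * n⌋ = i := hx
  have hy' : ⌊y * n⌋ = i := hy
  change ⌊z * n⌋ = i
  omega

/-- Level points counted with precision `1 / n`. -/
def coarseCount (g : ℝ → ℝ) (a b : ℝ) (n : ℕ) (t : ℝ) : ℝ≥0∞ :=
  ∑' i : ℤ, (g '' floorPiece a b n i).indicator 1 t

theorem coarseCount_eq_encard (g : ℝ → ℝ) (a b : ℝ) (n : ℕ) (t : ℝ) :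
    coarseCount g a b n t =
      (((fun s : ℝ => ⌊s * n⌋) '' (Set.Ioo a b ∩ {s | g s = t})).encard : ℝ≥0∞) := by
  rw [← ENNReal.tsum_set_one, tsum_subtype (f := fun _ : ℤ => (1 : ℝ≥0∞)), coarseCount]
  refine tsum_congr fun i => ?_
  by_cases h : t ∈ g '' floorPiece a b n i
  · rw [Set.indicator_of_mem h, Set.indicator_of_mem]
    · rfl
    · obtain ⟨s, hs, rfl⟩ := h
      exact ⟨s, ⟨hs.1, rfl⟩, hs.2⟩
  · rw [Set.indicator_of_notMem h, Set.indicator_of_notMem]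
    rintro ⟨s, hs, rfl⟩
    exact h ⟨s, ⟨hs.1, rfl⟩, hs.2⟩

theorem eventually_injOn_floor {F : Set ℝ} (hF : F.Finite) :
    ∀ᶠ n : ℕ in Filter.atTop, Set.InjOn (fun s : ℝ => ⌊s * n⌋) F := by
  have key : ∀ p ∈ F ×ˢ F, ∀ᶠ n : ℕ in Filter.atTop,
      ⌊p.1 * n⌋ = ⌊p.2 * n⌋ → p.1 = p.2 := by
    rintro ⟨s, t⟩ -
    by_cases hst : s = t
    · exact Filter.Eventually.of_forall fun _ _ => hst
    have hpos : 0 < |s - t| := abs_pos.2 (sub_ne_zero.2 hst)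
    filter_upwards [Filter.eventually_gt_atTop ⌈1 / |s - t|⌉₊] with n hn hfl
    exfalso
    have h1 : 1 / |s - t| < n := (Nat.le_ceil _).trans_lt (by exact_mod_cast hn)
    rw [div_lt_iff₀ hpos] at h1
    have h2 : |s * n - t * n| < 1 := Int.abs_sub_lt_one_of_floor_eq_floor hfl
    rw [← sub_mul, abs_mul, Nat.abs_cast] at h2
    linarith
  have := (Filter.eventually_all_finite (hF.prod hF)).2 key
  filter_upwards [this] with n hn s hs t ht hst
  exact hn (s, t) ⟨hs, ht⟩ hst

/-- The counts with finite precision recover the number of level points, also where it is infinite.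
They are countable sums of indicators of intervals, so this makes the number of level points
measurable. -/
theorem liminf_coarseCount (g : ℝ → ℝ) (a b t : ℝ) :
    Filter.liminf (fun n => coarseCount g a b n t) Filter.atTop = fiberCount g a b t := by
  apply le_antisymm
  · refine Filter.liminf_le_of_frequently_le' (Filter.Frequently.of_forall fun n => ?_)
    rw [coarseCount_eq_encard, fiberCount]
    exact_mod_cast Set.encard_image_le _ _
  · refine ENNReal.le_of_forall_nnreal_lt fun r hr => ?_
    obtain ⟨G, hG, hGfin, hrG⟩ : ∃ G ⊆ Set.Ioo a b ∩ {s | g s = t}, G.Finite ∧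
        (r : ℝ≥0∞) ≤ (G.encard : ℝ≥0∞) := by
      by_cases hfin : (Set.Ioo a b ∩ {s | g s = t}).Finite
      · exact ⟨_, subset_rfl, hfin, hr.le⟩
      · obtain ⟨G, hG, hGfin, hcard⟩ :=
          (Set.not_finite.1 hfin : Set.Infinite _).exists_subset_ncard_eq ⌈r⌉₊
        refine ⟨G, hG, hGfin, ?_⟩
        rw [← hGfin.cast_ncard_eq, hcard, ENat.toENNReal_coe]
        exact_mod_cast Nat.le_ceil r
    refine Filter.le_liminf_of_le (by isBoundedDefault) ?_
    filter_upwards [eventually_injOn_floor hGfin] with n hn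
    rw [coarseCount_eq_encard]
    refine hrG.trans ?_
    rw [← hn.encard_image]
    exact_mod_cast Set.encard_le_encard (Set.image_mono hG)

variable {g g' : ℝ → ℝ} {a b : ℝ}

theorem measurableSet_image_floorPiece (hg : ContinuousOn g (Set.Icc a b)) (n : ℕ) (i : ℤ) :
    MeasurableSet (g '' floorPiece a b n i) := by
  refine Set.OrdConnected.measurableSet ?_
  refine IsPreconnected.ordConnected ?_
  exact (ordConnected_floorPiece a b n i).isPreconnected.image _
    (hg.mono (Set.inter_subset_left.trans Set.Ioo_subset_Icc_self))

theorem measurable_coarseCount (hg : ContinuousOn g (Set.Icc a b)) (n : ℕ) :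
    Measurable (coarseCount g a b n) :=
  Measurable.tsum fun i => measurable_one.indicator (measurableSet_image_floorPiece hg n i)

theorem measurable_fiberCount (hg : ContinuousOn g (Set.Icc a b)) :
    Measurable (fiberCount g a b) := by
  have : fiberCount g a b = fun t => Filter.liminf (fun n => coarseCount g a b n t)
      Filter.atTop := funext fun t => (liminf_coarseCount g a b t).symm
  rw [this]
  exact Measurable.liminf (measurable_coarseCount hg)

/-- One half of the Banach indicatrix formula: the integral of the number of level points is at
most the total variation. -/
theorem lintegral_fiberCount_le (hg : ContinuousOn g (Set.Icc a b))
    (hd : ∀ s ∈ Set.Ioo a b, HasDerivAt g (g' s) s) :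
    ∫⁻ t, fiberCount g a b t ≤ ∫⁻ s in Set.Ioo a b, ENNReal.ofReal |g' s| := by
  have hmeas : ∀ n i, MeasurableSet (floorPiece a b n i) := fun n i =>
    (ordConnected_floorPiece a b n i).measurableSet
  have h1 : ∀ n, ∫⁻ t, coarseCount g a b n t ≤ ∫⁻ s in Set.Ioo a b, ENNReal.ofReal |g' s| := by
    intro n
    calc ∫⁻ t, coarseCount g a b n t = ∑' i : ℤ, volume (g '' floorPiece a b n i) := by
          unfold coarseCount
          rw [lintegral_tsum fun i =>
            (measurable_one.indicator (measurableSet_image_floorPiece hg n i)).aemeasurable]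
          exact tsum_congr fun i => lintegral_indicator_one (measurableSet_image_floorPiece hg n i)
      _ ≤ ∑' i : ℤ, ∫⁻ s in floorPiece a b n i, ENNReal.ofReal |g' s| := by
          refine ENNReal.tsum_le_tsum fun i => ?_
          have := addHaar_image_le_lintegral_abs_det_fderiv volume (hmeas n i) (f := g)
            (f' := fun s => ContinuousLinearMap.toSpanSingleton ℝ (g' s))
            fun s hs => (hd s hs.1).hasFDerivAt.hasFDerivWithinAt
          simpa using this
      _ = ∫⁻ s in ⋃ i, floorPiece a b n i, ENNReal.ofReal |g' s| := by
          rw [lintegral_iUnion (hmeas n)]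
          intro i k hik
          rw [Function.onFun, Set.disjoint_left]
          rintro s ⟨_, hs⟩ ⟨_, hs'⟩
          exact hik (Eq.trans (Eq.symm hs) hs')
      _ ≤ _ := lintegral_mono_set (Set.iUnion_subset fun i => Set.inter_subset_left)
  calc ∫⁻ t, fiberCount g a b t
      = ∫⁻ t, Filter.liminf (fun n => coarseCount g a b n t) Filter.atTop := by
        simp only [liminf_coarseCount]
    _ ≤ Filter.liminf (fun n => ∫⁻ t, coarseCount g a b n t) Filter.atTop :=
        lintegral_liminf_le (measurable_coarseCount hg)
    _ ≤ _ := Filter.liminf_le_of_frequently_le' (Filter.Frequently.of_forall h1)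

/-- The one-dimensional Sard theorem. -/
theorem ae_hasDerivAt_ne_zero (hd : ∀ s ∈ Set.Ioo a b, HasDerivAt g (g' s) s) :
    ∀ᵐ t, ∀ s ∈ Set.Ioo a b, g s = t → g' s ≠ 0 := by
  have h := addHaar_image_eq_zero_of_det_fderivWithin_eq_zero (volume : Measure ℝ) (f := g)
    (s := Set.Ioo a b ∩ {s | g' s = 0})
    (f' := fun s => ContinuousLinearMap.toSpanSingleton ℝ (g' s))
    (fun s hs => (hd s hs.1).hasFDerivAt.hasFDerivWithinAt) (fun s hs => by
      have : g' s = 0 := hs.2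
      simp [this])
  filter_upwards [compl_mem_ae_iff.2 h] with t ht s hs hst h0
  exact ht ⟨s, ⟨hs, h0⟩, hst⟩

/-! ### Steps and defects -/

/-- The indicator function of `[p, ∞)`. -/
def stepAt (p t : ℝ) : ℝ := if p ≤ t then 1 else 0

theorem measurable_stepAt (p : ℝ) : Measurable (stepAt p) :=
  Measurable.ite measurableSet_Ici measurable_const measurable_const

theorem lintegral_abs_stepAt_sub (p q : ℝ) :
    ∫⁻ t, ENNReal.ofReal |stepAt p t - stepAt q t| = ENNReal.ofReal |p - q| := by
  have h : (fun t => ENNReal.ofReal |stepAt p t - stepAt q t|) =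
      (Set.Ico (min p q) (max p q)).indicator 1 := by
    funext t
    by_cases ht : t ∈ Set.Ico (min p q) (max p q)
    · rw [Set.indicator_of_mem ht]
      simp only [Set.mem_Ico, min_le_iff, lt_max_iff] at ht
      by_cases hp : p ≤ t <;> by_cases hq : q ≤ t
      · exact absurd ht.2 (by simp [hp, hq])
      · simp [stepAt, hp, hq]
      · simp [stepAt, hp, hq]
      · exact absurd ht.1 (by simp only [hp, hq, or_self, not_false_eq_true])
    · rw [Set.indicator_of_notMem ht]
      simp only [Set.mem_Ico, min_le_iff, lt_max_iff, not_and, not_or, not_lt] at ht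
      by_cases hp : p ≤ t <;> by_cases hq : q ≤ t
      · simp [stepAt, hp, hq]
      · exact absurd (ht (Or.inl hp)).2 hq
      · exact absurd (ht (Or.inr hq)).1 hp
      · simp [stepAt, hp, hq]
  rw [h, lintegral_indicator_one measurableSet_Ico, Real.volume_Ico, max_sub_min_eq_abs']

theorem measurableSet_uIoo {p q : ℝ} : MeasurableSet (Set.uIoo p q) := isOpen_Ioo.measurableSet

/-- The number of level points in an open interval in excess of the one that exists, for levels
strictly between the values at the ends, by the intermediate value theorem. -/
def fiberDefect (g : ℝ → ℝ) (a b t : ℝ) : ℝ≥0∞ :=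
  fiberCount g a b t - (Set.uIoo (g a) (g b)).indicator 1 t

theorem measurable_fiberDefect (hg : ContinuousOn g (Set.Icc a b)) :
    Measurable (fiberDefect g a b) :=
  (measurable_fiberCount hg).sub (measurable_one.indicator measurableSet_uIoo)

theorem indicator_uIoo_le_fiberCount (hab : a ≤ b) (hg : ContinuousOn g (Set.Icc a b)) (t : ℝ) :
    (Set.uIoo (g a) (g b)).indicator 1 t ≤ fiberCount g a b t := by
  by_cases ht : t ∈ Set.uIoo (g a) (g b)
  · rw [Set.indicator_of_mem ht]
    have hex : ∃ s ∈ Set.Ioo a b, g s = t := by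
      rcases le_total (g a) (g b) with h | h
      · rw [Set.uIoo_of_le h] at ht
        exact intermediate_value_Ioo hab hg ht
      · rw [Set.uIoo_of_ge h] at ht
        exact intermediate_value_Ioo' hab hg ht
    have hne : (Set.Ioo a b ∩ {s | g s = t}).Nonempty := hex
    rw [fiberCount, Pi.one_apply]
    exact_mod_cast Set.one_le_encard_iff_nonempty.2 hne
  · rw [Set.indicator_of_notMem ht]
    exact zero_le

/-- The integral of the defect is at most the variation in excess of the increment. -/
theorem lintegral_fiberDefect_le (hab : a ≤ b) (hg : ContinuousOn g (Set.Icc a b))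
    (hd : ∀ s ∈ Set.Ioo a b, HasDerivAt g (g' s) s) (hg' : ContinuousOn g' (Set.Icc a b)) :
    ∫⁻ t, fiberDefect g a b t ≤ ENNReal.ofReal ((∫ s in a..b, |g' s|) - |g b - g a|) := by
  have h1 : ∫⁻ s in Set.Ioo a b, ENNReal.ofReal |g' s| = ENNReal.ofReal (∫ s in a..b, |g' s|) := by
    rw [intervalIntegral.integral_of_le hab, integral_Ioc_eq_integral_Ioo,
      ofReal_integral_eq_lintegral_ofReal]
    · exact (hg'.abs.integrableOn_Icc).mono_set Set.Ioo_subset_Icc_self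
    · exact Filter.Eventually.of_forall fun s => abs_nonneg _
  have h2 : ∫⁻ t, (Set.uIoo (g a) (g b)).indicator (1 : ℝ → ℝ≥0∞) t =
      ENNReal.ofReal |g b - g a| := by
    rw [lintegral_indicator_one measurableSet_uIoo, Real.volume_uIoo]
  unfold fiberDefect
  rw [lintegral_sub (measurable_one.indicator measurableSet_uIoo)
    (by rw [h2]; exact ENNReal.ofReal_ne_top)
    (Filter.Eventually.of_forall (indicator_uIoo_le_fiberCount hab hg)), h2,
    ENNReal.ofReal_sub _ (abs_nonneg _), ← h1]
  exact tsub_le_tsub_right (lintegral_fiberCount_le hg hd) _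

theorem ae_fiberCount_ne_top (hg : ContinuousOn g (Set.Icc a b))
    (hd : ∀ s ∈ Set.Ioo a b, HasDerivAt g (g' s) s) (hg' : ContinuousOn g' (Set.Icc a b)) :
    ∀ᵐ t, (Set.Ioo a b ∩ {s | g s = t}).Finite := by
  have h1 : ∫⁻ s in Set.Ioo a b, ENNReal.ofReal |g' s| ≠ ⊤ := by
    have hi : IntegrableOn (fun s => |g' s|) (Set.Ioo a b) :=
      (hg'.abs.integrableOn_Icc).mono_set Set.Ioo_subset_Icc_self
    rw [← ofReal_integral_eq_lintegral_ofReal hi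
      (Filter.Eventually.of_forall fun s => abs_nonneg _)]
    exact ENNReal.ofReal_ne_top
  have h2 := ae_lt_top (measurable_fiberCount hg)
    ((lintegral_fiberCount_le hg hd).trans_lt h1.lt_top).ne
  filter_upwards [h2] with t ht
  rw [← Set.encard_lt_top_iff]
  simpa [fiberCount] using ht

/-- The contribution to the Euler characteristic of a sublevel set of the part of a 1-cell over
`[a, b]`, at a generic level. -/
def cellTerm (g : ℝ → ℝ) (a b t : ℝ) : ℝ :=
  ((Set.Ioo a b ∩ {s | g s = t}).ncard - stepAt (g a) t - stepAt (g b) t) / 2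

/-- For levels other than `p` and `q`, twice the step at `max p q` is the sum of the steps at `p`
and `q` minus the indicator function of the open interval between them. This splits the contribution
of a piece into a defect, which is non-negative, and a single step. -/
theorem cellTerm_eq (hab : a ≤ b) (hg : ContinuousOn g (Set.Icc a b)) {t : ℝ} (ha : g a ≠ t)
    (hb : g b ≠ t) (hfin : (Set.Ioo a b ∩ {s | g s = t}).Finite) :
    cellTerm g a b t = (fiberDefect g a b t).toReal / 2 - stepAt (max (g a) (g b)) t := by
  have h1 : fiberCount g a b t = ((Set.Ioo a b ∩ {s | g s = t}).ncard : ℝ≥0∞) := by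
    rw [fiberCount, ← hfin.cast_ncard_eq, ENat.toENNReal_coe]
  have h2 : (fiberDefect g a b t).toReal = (Set.Ioo a b ∩ {s | g s = t}).ncard -
      (Set.uIoo (g a) (g b)).indicator (1 : ℝ → ℝ) t := by
    rw [fiberDefect, ENNReal.toReal_sub_of_le (indicator_uIoo_le_fiberCount hab hg t)
      (by rw [h1]; exact ENNReal.natCast_ne_top _), h1, ENNReal.toReal_natCast]
    congr 1
    by_cases ht : t ∈ Set.uIoo (g a) (g b)
    · rw [Set.indicator_of_mem ht, Set.indicator_of_mem ht]
      simp
    · rw [Set.indicator_of_notMem ht, Set.indicator_of_notMem ht]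
      simp
  have h3 : stepAt (g a) t + stepAt (g b) t = (Set.uIoo (g a) (g b)).indicator (1 : ℝ → ℝ) t +
      2 * stepAt (max (g a) (g b)) t := by
    simp only [Set.indicator_apply, Set.uIoo, Set.mem_Ioo, inf_lt_iff, lt_sup_iff, stepAt,
      max_le_iff, Pi.one_apply]
    rcases lt_or_gt_of_ne ha with ha' | ha' <;> rcases lt_or_gt_of_ne hb with hb' | hb'
    · simp [ha'.le, hb'.le, not_lt.2 ha'.le, not_lt.2 hb'.le]
      norm_num
    · simp [ha'.le, not_le.2 hb', ha', hb']
    · simp [not_le.2 ha', hb'.le, ha', hb']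
    · simp [not_le.2 ha', not_le.2 hb', not_lt.2 ha'.le, not_lt.2 hb'.le]
  rw [cellTerm, h2]
  linarith

theorem cellTerm_add {c t : ℝ} (hab : a < b) (hbc : b < c) (hb : g b ≠ t)
    (hfin : (Set.Ioo a c ∩ {s | g s = t}).Finite) :
    cellTerm g a c t = cellTerm g a b t + cellTerm g b c t + stepAt (g b) t := by
  have e : Set.Ioo a c ∩ {s | g s = t} =
      (Set.Ioo a b ∩ {s | g s = t}) ∪ (Set.Ioo b c ∩ {s | g s = t}) := by
    ext s
    constructor
    · rintro ⟨hs, hst⟩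
      rcases lt_trichotomy s b with h | rfl | h
      · exact Or.inl ⟨⟨hs.1, h⟩, hst⟩
      · exact absurd hst hb
      · exact Or.inr ⟨⟨h, hs.2⟩, hst⟩
    · rintro (⟨hs, hst⟩ | ⟨hs, hst⟩)
      · exact ⟨⟨hs.1, hs.2.trans hbc⟩, hst⟩
      · exact ⟨⟨hab.trans hs.1, hs.2⟩, hst⟩
  have h1 : (Set.Ioo a b ∩ {s | g s = t}).Finite := hfin.subset (e ▸ Set.subset_union_left)
  have h2 : (Set.Ioo b c ∩ {s | g s = t}).Finite := hfin.subset (e ▸ Set.subset_union_right)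
  have hdis : Disjoint (Set.Ioo a b ∩ {s | g s = t}) (Set.Ioo b c ∩ {s | g s = t}) := by
    rw [Set.disjoint_left]
    rintro s ⟨hs, _⟩ ⟨hs', _⟩
    exact lt_asymm hs.2 hs'.1
  rw [cellTerm, cellTerm, cellTerm, e, Set.ncard_union_eq hdis h1 h2]
  push_cast
  ring

/-- Subdividing a 1-cell turns each subdivision point into a vertex. -/
theorem cellTerm_eq_sum {x : ℕ → ℝ} (hx : StrictMono x) {t : ℝ} (m : ℕ)
    (hne : ∀ j, j ≤ m + 1 → g (x j) ≠ t)
    (hfin : (Set.Ioo (x 0) (x (m + 1)) ∩ {s | g s = t}).Finite) :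
    cellTerm g (x 0) (x (m + 1)) t = ∑ j ∈ Finset.range (m + 1), cellTerm g (x j) (x (j + 1)) t +
      ∑ j ∈ Finset.range m, stepAt (g (x (j + 1))) t := by
  induction m with
  | zero => simp
  | succ m ih =>
    have hsub : Set.Ioo (x 0) (x (m + 1)) ⊆ Set.Ioo (x 0) (x (m + 1 + 1)) :=
      Set.Ioo_subset_Ioo_right (hx.monotone (Nat.le_succ _))
    rw [cellTerm_add (hx (Nat.succ_pos m)) (hx (Nat.lt_succ_self (m + 1))) (hne _ (by omega)) hfin,
      ih (fun j hj => hne j (by omega)) (hfin.subset (Set.inter_subset_inter_left _ hsub)),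
      Finset.sum_range_succ _ (m + 1), Finset.sum_range_succ (fun j => stepAt (g (x (j + 1))) t) m]
    simp only [Nat.succ_eq_add_one]
    ring

/-- Comparison of the contributions of a 1-cell for two functions. The 1-cell is subdivided; on
each piece the contribution is a defect, controlled by the variation in excess of the increment, and
a step, and each subdivision point contributes another step. -/
theorem lintegral_cellTerm_sub_le {h h' k k' : ℝ → ℝ} {x : ℕ → ℝ} (hx : StrictMono x) (m : ℕ)
    (hh : ContinuousOn h (Set.Icc (x 0) (x (m + 1))))
    (hhd : ∀ s ∈ Set.Ioo (x 0) (x (m + 1)), HasDerivAt h (h' s) s)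
    (hh' : ContinuousOn h' (Set.Icc (x 0) (x (m + 1))))
    (hk : ContinuousOn k (Set.Icc (x 0) (x (m + 1))))
    (hkd : ∀ s ∈ Set.Ioo (x 0) (x (m + 1)), HasDerivAt k (k' s) s)
    (hk' : ContinuousOn k' (Set.Icc (x 0) (x (m + 1)))) {ε A B : ℝ}
    (hhk : ∀ s ∈ Set.Icc (x 0) (x (m + 1)), |h s - k s| ≤ ε) (hA0 : 0 ≤ A) (hB0 : 0 ≤ B)
    (hA : ∀ j ≤ m, (∫ s in x j..x (j + 1), |h' s|) - |h (x (j + 1)) - h (x j)| ≤ A)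
    (hB : ∀ j ≤ m, (∫ s in x j..x (j + 1), |k' s|) - |k (x (j + 1)) - k (x j)| ≤ B) :
    ∫⁻ t, ENNReal.ofReal |cellTerm h (x 0) (x (m + 1)) t - cellTerm k (x 0) (x (m + 1)) t| ≤
      ENNReal.ofReal ((m + 1) * (A / 2 + B / 2 + ε) + m * ε) := by
  have hε : 0 ≤ ε := (abs_nonneg _).trans (hhk (x 0) ⟨le_rfl, hx.monotone (Nat.zero_le _)⟩)
  have hmem : ∀ j ≤ m + 1, x j ∈ Set.Icc (x 0) (x (m + 1)) := fun j hj =>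
    ⟨hx.monotone (Nat.zero_le j), hx.monotone hj⟩
  have hIcc : ∀ j ≤ m, Set.Icc (x j) (x (j + 1)) ⊆ Set.Icc (x 0) (x (m + 1)) := fun j hj =>
    Set.Icc_subset_Icc (hmem j (by omega)).1 (hmem (j + 1) (by omega)).2
  have hIoo : ∀ j ≤ m, Set.Ioo (x j) (x (j + 1)) ⊆ Set.Ioo (x 0) (x (m + 1)) := fun j hj =>
    Set.Ioo_subset_Ioo (hmem j (by omega)).1 (hmem (j + 1) (by omega)).2
  -- bounds for the difference on the `j`-th piece and at the `(j + 1)`-st subdivision point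
  let D : ℕ → ℝ → ℝ≥0∞ := fun j t =>
    fiberDefect h (x j) (x (j + 1)) t / 2 + fiberDefect k (x j) (x (j + 1)) t / 2 +
      ENNReal.ofReal |stepAt (max (h (x j)) (h (x (j + 1)))) t -
        stepAt (max (k (x j)) (k (x (j + 1)))) t|
  let S : ℕ → ℝ → ℝ≥0∞ := fun j t =>
    ENNReal.ofReal |stepAt (h (x (j + 1))) t - stepAt (k (x (j + 1))) t|
  have hSm : ∀ p q : ℝ, Measurable fun t => ENNReal.ofReal |stepAt p t - stepAt q t| := fun p q =>
    ENNReal.measurable_ofReal.comp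
      (continuous_abs.measurable.comp ((measurable_stepAt p).sub (measurable_stepAt q)))
  have hmh : ∀ j ≤ m, Measurable (fiberDefect h (x j) (x (j + 1))) := fun j hj =>
    measurable_fiberDefect (hh.mono (hIcc j hj))
  have hmk : ∀ j ≤ m, Measurable (fiberDefect k (x j) (x (j + 1))) := fun j hj =>
    measurable_fiberDefect (hk.mono (hIcc j hj))
  have hDm : ∀ j ≤ m, Measurable (D j) := fun j hj =>
    (((hmh j hj).div_const 2).add ((hmk j hj).div_const 2)).add (hSm _ _)
  have hneh : ∀ p : ℝ, ∀ᵐ t, p ≠ t := fun p => by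
    filter_upwards [compl_mem_ae_iff.2 (measure_singleton (μ := (volume : Measure ℝ)) p)] with t ht
    exact fun h => ht h.symm
  have hgen : ∀ᵐ t, ∀ j ∈ Finset.range (m + 2), h (x j) ≠ t ∧ k (x j) ≠ t :=
    (Filter.eventually_all_finset _).2 fun j _ => (hneh _).and (hneh _)
  have hpt : ∀ᵐ t, ENNReal.ofReal
      |cellTerm h (x 0) (x (m + 1)) t - cellTerm k (x 0) (x (m + 1)) t| ≤
      ∑ j ∈ Finset.range (m + 1), D j t + ∑ j ∈ Finset.range m, S j t := by
    filter_upwards [hgen, ae_fiberCount_ne_top hh hhd hh', ae_fiberCount_ne_top hk hkd hk']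
      with t ht hfh hfk
    have hth : ∀ j, j ≤ m + 1 → h (x j) ≠ t := fun j hj => (ht j (Finset.mem_range.2 (by omega))).1
    have htk : ∀ j, j ≤ m + 1 → k (x j) ≠ t := fun j hj => (ht j (Finset.mem_range.2 (by omega))).2
    rw [cellTerm_eq_sum hx m hth hfh, cellTerm_eq_sum hx m htk hfk]
    have hfin : ∀ (g : ℝ → ℝ), (Set.Ioo (x 0) (x (m + 1)) ∩ {s | g s = t}).Finite → ∀ j ≤ m,
        (Set.Ioo (x j) (x (j + 1)) ∩ {s | g s = t}).Finite := fun g hg j hj =>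
      hg.subset (Set.inter_subset_inter_left _ (hIoo j hj))
    have htop : ∀ (g : ℝ → ℝ), (Set.Ioo (x 0) (x (m + 1)) ∩ {s | g s = t}).Finite → ∀ j ≤ m,
        fiberDefect g (x j) (x (j + 1)) t ≠ ⊤ := by
      intro g hg j hj
      refine (tsub_le_self.trans_lt ?_).ne
      simpa [fiberCount] using hfin g hg j hj
    have hD : ∀ j ∈ Finset.range (m + 1), ENNReal.ofReal
        |cellTerm h (x j) (x (j + 1)) t - cellTerm k (x j) (x (j + 1)) t| ≤ D j t := by
      intro j hj
      have hj' : j ≤ m := by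
        have := Finset.mem_range.1 hj
        omega
      rw [cellTerm_eq (hx (Nat.lt_succ_self j)).le (hh.mono (hIcc j hj')) (hth j (by omega))
        (hth (j + 1) (by omega)) (hfin h hfh j hj'),
        cellTerm_eq (hx (Nat.lt_succ_self j)).le (hk.mono (hIcc j hj')) (htk j (by omega))
        (htk (j + 1) (by omega)) (hfin k hfk j hj')]
      set p := fiberDefect h (x j) (x (j + 1)) t
      set q := fiberDefect k (x j) (x (j + 1)) t
      have hp : p / 2 = ENNReal.ofReal (p.toReal / 2) := by
        rw [ENNReal.ofReal_div_of_pos two_pos, ENNReal.ofReal_toReal (htop h hfh j hj'),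
          ENNReal.ofReal_ofNat]
      have hq : q / 2 = ENNReal.ofReal (q.toReal / 2) := by
        rw [ENNReal.ofReal_div_of_pos two_pos, ENNReal.ofReal_toReal (htop k hfk j hj'),
          ENNReal.ofReal_ofNat]
      have hp0 : 0 ≤ p.toReal := ENNReal.toReal_nonneg
      have hq0 : 0 ≤ q.toReal := ENNReal.toReal_nonneg
      change _ ≤ p / 2 + q / 2 + _
      rw [hp, hq, ← ENNReal.ofReal_add (by positivity) (by positivity),
        ← ENNReal.ofReal_add (by positivity) (by positivity)]
      refine ENNReal.ofReal_le_ofReal ?_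
      set u := stepAt (max (h (x j)) (h (x (j + 1)))) t
      set w := stepAt (max (k (x j)) (k (x (j + 1)))) t
      rw [abs_le]
      constructor <;> linarith [neg_abs_le (u - w), le_abs_self (u - w)]
    calc _ ≤ ENNReal.ofReal (∑ j ∈ Finset.range (m + 1),
            |cellTerm h (x j) (x (j + 1)) t - cellTerm k (x j) (x (j + 1)) t| +
          ∑ j ∈ Finset.range m, |stepAt (h (x (j + 1))) t - stepAt (k (x (j + 1))) t|) := by
          refine ENNReal.ofReal_le_ofReal ?_
          rw [add_sub_add_comm, ← Finset.sum_sub_distrib, ← Finset.sum_sub_distrib]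
          exact (abs_add_le _ _).trans
            (add_le_add (Finset.abs_sum_le_sum_abs _ _) (Finset.abs_sum_le_sum_abs _ _))
      _ ≤ _ := by
          rw [ENNReal.ofReal_add (Finset.sum_nonneg fun _ _ => abs_nonneg _)
            (Finset.sum_nonneg fun _ _ => abs_nonneg _),
            ENNReal.ofReal_sum_of_nonneg fun _ _ => abs_nonneg _,
            ENNReal.ofReal_sum_of_nonneg fun _ _ => abs_nonneg _]
          gcongr with j hj
          exact hD j hj
  have hDint : ∀ j ≤ m, ∫⁻ t, D j t ≤ ENNReal.ofReal (A / 2 + B / 2 + ε) := by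
    intro j hj
    have hjx := (hx (Nat.lt_succ_self j)).le
    have i1 : ∫⁻ t, fiberDefect h (x j) (x (j + 1)) t / 2 ≤ ENNReal.ofReal (A / 2) := by
      simp only [div_eq_mul_inv]
      rw [lintegral_mul_const _ (hmh j hj), ENNReal.ofReal_mul hA0]
      gcongr
      · exact (lintegral_fiberDefect_le hjx (hh.mono (hIcc j hj))
          (fun s hs => hhd s (hIoo j hj hs)) (hh'.mono (hIcc j hj))).trans
          (ENNReal.ofReal_le_ofReal (hA j hj))
      · rw [ENNReal.ofReal_inv_of_pos two_pos]
        simp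
    have i2 : ∫⁻ t, fiberDefect k (x j) (x (j + 1)) t / 2 ≤ ENNReal.ofReal (B / 2) := by
      simp only [div_eq_mul_inv]
      rw [lintegral_mul_const _ (hmk j hj), ENNReal.ofReal_mul hB0]
      gcongr
      · exact (lintegral_fiberDefect_le hjx (hk.mono (hIcc j hj))
          (fun s hs => hkd s (hIoo j hj hs)) (hk'.mono (hIcc j hj))).trans
          (ENNReal.ofReal_le_ofReal (hB j hj))
      · rw [ENNReal.ofReal_inv_of_pos two_pos]
        simp
    have i3 : ∫⁻ t, ENNReal.ofReal |stepAt (max (h (x j)) (h (x (j + 1)))) t -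
        stepAt (max (k (x j)) (k (x (j + 1)))) t| ≤ ENNReal.ofReal ε := by
      rw [lintegral_abs_stepAt_sub]
      refine ENNReal.ofReal_le_ofReal ((abs_max_sub_max_le_max _ _ _ _).trans ?_)
      exact max_le (hhk _ (hmem j (by omega))) (hhk _ (hmem (j + 1) (by omega)))
    have hD' : ∫⁻ t, D j t = (∫⁻ t, fiberDefect h (x j) (x (j + 1)) t / 2) +
        (∫⁻ t, fiberDefect k (x j) (x (j + 1)) t / 2) +
        ∫⁻ t, ENNReal.ofReal |stepAt (max (h (x j)) (h (x (j + 1)))) t -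
          stepAt (max (k (x j)) (k (x (j + 1)))) t| := by
      rw [← lintegral_add_left ((hmh j hj).div_const 2), ← lintegral_add_right _ (hSm _ _)]
    rw [hD', ENNReal.ofReal_add (by positivity) hε, ENNReal.ofReal_add (by positivity)
      (by positivity)]
    exact add_le_add (add_le_add i1 i2) i3
  have hSint : ∀ j < m, ∫⁻ t, S j t ≤ ENNReal.ofReal ε := by
    intro j hj
    rw [lintegral_abs_stepAt_sub]
    exact ENNReal.ofReal_le_ofReal (hhk _ (hmem (j + 1) (by omega)))
  calc _ ≤ ∫⁻ t, (∑ j ∈ Finset.range (m + 1), D j t + ∑ j ∈ Finset.range m, S j t) :=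
        lintegral_mono_ae hpt
    _ = (∑ j ∈ Finset.range (m + 1), ∫⁻ t, D j t) + ∑ j ∈ Finset.range m, ∫⁻ t, S j t := by
        rw [lintegral_add_right _ (Finset.measurable_fun_sum _ fun j _ => hSm _ _),
          lintegral_finsetSum' _ fun j hj => (hDm j (by
            have := Finset.mem_range.1 hj
            omega)).aemeasurable,
          lintegral_finsetSum _ fun j _ => hSm _ _]
    _ ≤ ∑ j ∈ Finset.range (m + 1), ENNReal.ofReal (A / 2 + B / 2 + ε) +
        ∑ j ∈ Finset.range m, ENNReal.ofReal ε := by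
        refine add_le_add (Finset.sum_le_sum fun j hj => hDint j ?_)
          (Finset.sum_le_sum fun j hj => hSint j (Finset.mem_range.1 hj))
        have := Finset.mem_range.1 hj
        omega
    _ = _ := by
        have h0 : 0 ≤ ((m : ℝ) + 1) * (A / 2 + B / 2 + ε) := by positivity
        have h1 : 0 ≤ (m : ℝ) * ε := by positivity
        have e1 : ENNReal.ofReal ((m : ℝ) + 1) = ((m + 1 : ℕ) : ℝ≥0∞) := by
          rw [← Nat.cast_succ, ENNReal.ofReal_natCast]
        rw [Finset.sum_const, Finset.sum_const, Finset.card_range, Finset.card_range,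
          ENNReal.ofReal_add h0 h1, nsmul_eq_mul, nsmul_eq_mul,
          ENNReal.ofReal_mul (by positivity), ENNReal.ofReal_mul (by positivity), e1,
          ENNReal.ofReal_natCast]

/-! ### Comparison of Euler characteristics of sublevel sets -/

/-- Both `Set.ncard` and `ENNReal.toReal` give zero for infinitely many level points. -/
theorem cellTerm_eq_toReal (g : ℝ → ℝ) (a b t : ℝ) :
    cellTerm g a b t = ((fiberCount g a b t).toReal - stepAt (g a) t - stepAt (g b) t) / 2 := by
  rw [cellTerm, fiberCount]
  congr 3
  by_cases h : (Set.Ioo a b ∩ {s | g s = t}).Finite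
  · rw [← h.cast_ncard_eq]
    simp
  · have h' : (Set.Ioo a b ∩ {s | g s = t}).Infinite := h
    rw [h'.ncard, h'.encard_eq]
    simp

theorem measurable_cellTerm {g : ℝ → ℝ} {a b : ℝ} (hg : ContinuousOn g (Set.Icc a b)) :
    Measurable (cellTerm g a b) := by
  have : cellTerm g a b = fun t =>
      ((fiberCount g a b t).toReal - stepAt (g a) t - stepAt (g b) t) / 2 :=
    funext fun t => cellTerm_eq_toReal g a b t
  rw [this]
  exact (((measurable_fiberCount hg).ennreal_toReal.sub (measurable_stepAt _)).sub
    (measurable_stepAt _)).div_const 2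

theorem absDiff_coe (m n : ℤ) :
    absDiff (m : WithTop ℤ) (n : WithTop ℤ) = ENNReal.ofReal |(m : ℝ) - (n : ℝ)| := rfl

namespace OneDimCW

variable {Z₀ Λ : Type} [Fintype Z₀] [Fintype Λ] (K : OneDimCW Z₀ Λ)

/-- The value of the Euler characteristic of a sublevel set at almost every level; unlike the Euler
characteristic itself, it is visibly measurable in the level. -/
def genericEuler (h : K.Space → ℝ) (t : ℝ) : ℝ :=
  ∑ v, stepAt (h (K.vertex v)) t + ∑ l, cellTerm (fun s => h (K.edge l s)) 0 1 t

theorem measurable_genericEuler {h : K.Space → ℝ} (hh : Continuous h) :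
    Measurable (K.genericEuler h) :=
  (Finset.measurable_fun_sum _ fun _ _ => measurable_stepAt _).add
    (Finset.measurable_fun_sum _ fun l _ =>
      measurable_cellTerm (hh.comp (K.continuous_edge l)).continuousOn)

theorem ae_eulerCharacteristic_sublevel {h : K.Space → ℝ} (hh : Continuous h) {h' : Λ → ℝ → ℝ}
    (hd : ∀ l, ∀ s ∈ Set.Ioo (0 : ℝ) 1, HasDerivAt (fun s => h (K.edge l s)) (h' l s) s)
    (hc : ∀ l, ContinuousOn (h' l) (Set.Icc 0 1)) :
    ∀ᵐ t, ∃ n : ℤ, eulerCharacteristic {z // h z ≤ t} = (n : WithTop ℤ) ∧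
      (n : ℝ) = K.genericEuler h t := by
  have h1 : ∀ᵐ t, ∀ v, h (K.vertex v) ≠ t := ae_all_iff.2 fun v => by
    filter_upwards [compl_mem_ae_iff.2
      (measure_singleton (μ := (volume : Measure ℝ)) (h (K.vertex v)))] with t ht
    exact fun h => ht h.symm
  have h2 : ∀ᵐ t, ∀ l, (Set.Ioo (0 : ℝ) 1 ∩ {s | h (K.edge l s) = t}).Finite :=
    ae_all_iff.2 fun l =>
      ae_fiberCount_ne_top (hh.comp (K.continuous_edge l)).continuousOn (hd l) (hc l)
  have h3 : ∀ᵐ t, ∀ l, ∀ s ∈ Set.Ioo (0 : ℝ) 1, h (K.edge l s) = t → h' l s ≠ 0 :=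
    ae_all_iff.2 fun l => ae_hasDerivAt_ne_zero (hd l)
  filter_upwards [h1, h2, h3] with t ht1 ht2 ht3
  exact K.eulerCharacteristic_sublevel hh t ht1 ht2 fun l s hs hst =>
    ⟨h' l s, ht3 l s hs hst, hd l s hs⟩

/-- The integrated difference of the Euler characteristics of the sublevel sets of two functions is
bounded by the contributions of the 0-cells and the 1-cells. -/
theorem lintegral_absDiff_sublevel_le {h k : K.Space → ℝ} (hh : Continuous h) (hk : Continuous k)
    {h' k' : Λ → ℝ → ℝ}
    (hhd : ∀ l, ∀ s ∈ Set.Ioo (0 : ℝ) 1, HasDerivAt (fun s => h (K.edge l s)) (h' l s) s)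
    (hkd : ∀ l, ∀ s ∈ Set.Ioo (0 : ℝ) 1, HasDerivAt (fun s => k (K.edge l s)) (k' l s) s)
    (hh' : ∀ l, ContinuousOn (h' l) (Set.Icc 0 1)) (hk' : ∀ l, ContinuousOn (k' l) (Set.Icc 0 1)) :
    AEMeasurable (fun t => absDiff (eulerCharacteristic {z // h z ≤ t})
      (eulerCharacteristic {z // k z ≤ t})) ∧
    ∫⁻ t, absDiff (eulerCharacteristic {z // h z ≤ t}) (eulerCharacteristic {z // k z ≤ t}) ≤
      ∑ v, ENNReal.ofReal |h (K.vertex v) - k (K.vertex v)| +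
        ∑ l, ∫⁻ t, ENNReal.ofReal |cellTerm (fun s => h (K.edge l s)) 0 1 t -
          cellTerm (fun s => k (K.edge l s)) 0 1 t| := by
  have hae : (fun t => absDiff (eulerCharacteristic {z // h z ≤ t})
      (eulerCharacteristic {z // k z ≤ t})) =ᵐ[volume]
      fun t => ENNReal.ofReal |K.genericEuler h t - K.genericEuler k t| := by
    filter_upwards [K.ae_eulerCharacteristic_sublevel hh hhd hh',
      K.ae_eulerCharacteristic_sublevel hk hkd hk'] with t ⟨n, hn, hn'⟩ ⟨m, hm, hm'⟩
    rw [hn, hm, absDiff_coe, hn', hm']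
  have hms : ∀ v, Measurable fun t =>
      ENNReal.ofReal |stepAt (h (K.vertex v)) t - stepAt (k (K.vertex v)) t| := fun v =>
    ENNReal.measurable_ofReal.comp
      (continuous_abs.measurable.comp ((measurable_stepAt _).sub (measurable_stepAt _)))
  have hmc : ∀ l, Measurable fun t => ENNReal.ofReal |cellTerm (fun s => h (K.edge l s)) 0 1 t -
      cellTerm (fun s => k (K.edge l s)) 0 1 t| := fun l =>
    ENNReal.measurable_ofReal.comp (continuous_abs.measurable.comp
      ((measurable_cellTerm (hh.comp (K.continuous_edge l)).continuousOn).sub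
        (measurable_cellTerm (hk.comp (K.continuous_edge l)).continuousOn)))
  refine ⟨⟨_, ?_, hae⟩, ?_⟩
  · exact ENNReal.measurable_ofReal.comp (continuous_abs.measurable.comp
      ((K.measurable_genericEuler hh).sub (K.measurable_genericEuler hk)))
  rw [lintegral_congr_ae hae]
  calc _ ≤ ∫⁻ t, (∑ v, ENNReal.ofReal |stepAt (h (K.vertex v)) t - stepAt (k (K.vertex v)) t| +
        ∑ l, ENNReal.ofReal |cellTerm (fun s => h (K.edge l s)) 0 1 t -
          cellTerm (fun s => k (K.edge l s)) 0 1 t|) := by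
        refine lintegral_mono fun t => ?_
        rw [← ENNReal.ofReal_sum_of_nonneg fun _ _ => abs_nonneg _,
          ← ENNReal.ofReal_sum_of_nonneg fun _ _ => abs_nonneg _,
          ← ENNReal.ofReal_add (Finset.sum_nonneg fun _ _ => abs_nonneg _)
            (Finset.sum_nonneg fun _ _ => abs_nonneg _)]
        refine ENNReal.ofReal_le_ofReal ?_
        rw [genericEuler, genericEuler, add_sub_add_comm, ← Finset.sum_sub_distrib,
          ← Finset.sum_sub_distrib]
        exact (abs_add_le _ _).trans
          (add_le_add (Finset.abs_sum_le_sum_abs _ _) (Finset.abs_sum_le_sum_abs _ _))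
    _ = _ := by
        rw [lintegral_add_left (Finset.measurable_fun_sum _ fun v _ => hms v),
          lintegral_finsetSum _ fun v _ => hms v, lintegral_finsetSum _ fun l _ => hmc l]
        simp only [lintegral_abs_stepAt_sub]

end OneDimCW

/-! ### Excess variation of a curve in a direction -/

/-- The Cauchy–Schwarz inequality against the constant function. -/
theorem sq_intervalIntegral_le {w : ℝ → ℝ} {a b : ℝ} (hab : a < b)
    (hw : ContinuousOn w (Set.Icc a b)) :
    (∫ s in a..b, w s) ^ 2 ≤ (b - a) * ∫ s in a..b, w s ^ 2 := by
  have hba : 0 < b - a := sub_pos.2 hab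
  have hi : IntervalIntegrable w volume a b := hw.intervalIntegrable_of_Icc hab.le
  have hi2 : IntervalIntegrable (fun s => w s ^ 2) volume a b :=
    (hw.pow 2).intervalIntegrable_of_Icc hab.le
  set μ := (∫ s in a..b, w s) / (b - a) with hμ
  have hS : ∫ s in a..b, w s = μ * (b - a) := by
    rw [hμ, div_mul_cancel₀ _ hba.ne']
  have h0 : 0 ≤ ∫ s in a..b, (w s - μ) ^ 2 :=
    intervalIntegral.integral_nonneg hab.le fun s _ => sq_nonneg _
  have h1 : ∫ s in a..b, (w s - μ) ^ 2 =
      (∫ s in a..b, w s ^ 2) - 2 * μ * (∫ s in a..b, w s) + μ ^ 2 * (b - a) := by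
    have e : (fun s => (w s - μ) ^ 2) = fun s => w s ^ 2 - 2 * μ * w s + μ ^ 2 := by
      funext s
      ring
    rw [e, intervalIntegral.integral_add (hi2.sub (hi.const_mul _)) (by simp),
      intervalIntegral.integral_sub hi2 (hi.const_mul _), intervalIntegral.integral_const_mul,
      intervalIntegral.integral_const, smul_eq_mul]
    ring
  rw [h1, hS] at h0
  rw [hS]
  nlinarith [mul_nonneg hba.le h0]

section Excess

variable {E : Type*} [NormedAddCommGroup E] [InnerProductSpace ℝ E]
variable {γ T : ℝ → E} {a b c : ℝ}

theorem intervalIntegral_inner_eq (hab : a ≤ b) (hγ : ContinuousOn γ (Set.Icc a b))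
    (hd : ∀ s ∈ Set.Ioo a b, HasDerivAt γ (T s) s) (hT : ContinuousOn T (Set.Icc a b)) (u : E) :
    ∫ s in a..b, inner ℝ (T s) u = inner ℝ (γ b - γ a) u := by
  have h := intervalIntegral.integral_eq_sub_of_hasDerivAt_of_le hab
    (f := fun s => inner ℝ (γ s) u) (f' := fun s => inner ℝ (T s) u)
    (hγ.inner continuousOn_const) (fun s hs => by
      simpa using (hd s hs).inner ℝ (hasDerivAt_const s u))
    ((hT.inner continuousOn_const).intervalIntegrable_of_Icc hab)
  rw [h, inner_sub_left]

theorem intervalIntegral_abs_inner_le (hab : a ≤ b) (hT : ContinuousOn T (Set.Icc a b))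
    (hc : ∀ s ∈ Set.Icc a b, ‖T s‖ = c) {v : E} (hv : ‖v‖ = 1) :
    ∫ s in a..b, |inner ℝ (T s) v| ≤ c * (b - a) := by
  have h : ∫ s in a..b, |inner ℝ (T s) v| ≤ ∫ _ in a..b, c := by
    refine intervalIntegral.integral_mono_on hab
      ((hT.inner continuousOn_const).abs.intervalIntegrable_of_Icc hab) (by simp) fun s hs => ?_
    have := abs_real_inner_le_norm (T s) v
    rwa [hv, mul_one, hc s hs] at this
  rw [intervalIntegral.integral_const, smul_eq_mul] at h
  linarith

/-- The variation of a curve of constant speed in a direction exceeds the increment by at most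
`2 √(2 ℓ e)`, where `ℓ` is the length of the curve and `e` is its excess over the chord. With the
sign of the direction chosen such that the increment is non-negative, the excess variation is twice
the integral of the negative part of the derivative, which is at most the distance between the
velocity and its average direction. -/
theorem excess_variation_le (hab : a < b) (hγ : ContinuousOn γ (Set.Icc a b))
    (hd : ∀ s ∈ Set.Ioo a b, HasDerivAt γ (T s) s) (hT : ContinuousOn T (Set.Icc a b))
    (hc : ∀ s ∈ Set.Icc a b, ‖T s‖ = c) {v : E} (hv : ‖v‖ = 1) {e : ℝ}
    (he : c * (b - a) - ‖γ b - γ a‖ ≤ e) :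
    (∫ s in a..b, |inner ℝ (T s) v|) - |inner ℝ (γ b - γ a) v| ≤
      2 * √(2 * (c * (b - a)) * e) := by
  set Δ := γ b - γ a with hΔ
  have hba : 0 < b - a := sub_pos.2 hab
  have hc0 : 0 ≤ c := hc a ⟨le_rfl, hab.le⟩ ▸ norm_nonneg _
  obtain ⟨v', hv', habs, hpos⟩ : ∃ v' : E, ‖v'‖ = 1 ∧
      (∀ x : E, |inner ℝ x v'| = |inner ℝ x v|) ∧ 0 ≤ inner ℝ Δ v' := by
    rcases le_total 0 (inner ℝ Δ v) with h | h
    · exact ⟨v, hv, fun _ => rfl, h⟩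
    · exact ⟨-v, by rwa [norm_neg], fun x => by rw [inner_neg_right, abs_neg],
        by rw [inner_neg_right]; linarith⟩
  -- `u` is the direction of the chord, or `v'` if the chord vanishes
  obtain ⟨u, hu, hΔu, huv⟩ : ∃ u : E, ‖u‖ = 1 ∧ inner ℝ Δ u = ‖Δ‖ ∧ 0 ≤ inner ℝ u v' := by
    by_cases h0 : Δ = 0
    · exact ⟨v', hv', by simp [h0], by rw [real_inner_self_eq_norm_sq]; positivity⟩
    · have hn : 0 < ‖Δ‖ := norm_pos_iff.2 h0
      refine ⟨‖Δ‖⁻¹ • Δ, ?_, ?_, ?_⟩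
      · rw [norm_smul, norm_inv, norm_norm, inv_mul_cancel₀ hn.ne']
      · rw [inner_smul_right, real_inner_self_eq_norm_sq]
        field_simp
      · rw [real_inner_smul_left]
        positivity
  have hw : ContinuousOn (fun s => ‖T s - c • u‖) (Set.Icc a b) :=
    (hT.sub continuousOn_const).norm
  have hTv : ContinuousOn (fun s => inner ℝ (T s) v') (Set.Icc a b) := hT.inner continuousOn_const
  have hw2 : ContinuousOn (fun s => 2 * ‖T s - c • u‖) (Set.Icc a b) := continuousOn_const.mul hw
  have hTu : ContinuousOn (fun s => 2 * c * inner ℝ (T s) u) (Set.Icc a b) :=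
    continuousOn_const.mul (hT.inner continuousOn_const)
  -- `⟪c u, v'⟫ ≥ 0` bounds the negative part of `⟪T s, v'⟫` by `‖T s - c u‖`
  have h1 : ∫ s in a..b, |inner ℝ (T s) v'| ≤
      ∫ s in a..b, (inner ℝ (T s) v' + 2 * ‖T s - c • u‖) := by
    refine intervalIntegral.integral_mono_on hab.le (hTv.abs.intervalIntegrable_of_Icc hab.le)
      ((hTv.add hw2).intervalIntegrable_of_Icc hab.le) fun s hs => ?_
    have h2 : |inner ℝ (T s - c • u) v'| ≤ ‖T s - c • u‖ := by
      have := abs_real_inner_le_norm (T s - c • u) v'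
      rwa [hv', mul_one] at this
    rw [inner_sub_left, real_inner_smul_left] at h2
    have h3 := (abs_le.1 h2).1
    have h4 := mul_nonneg hc0 huv
    rw [abs_le]
    constructor
    · linarith
    · linarith [norm_nonneg (T s - c • u)]
  rw [intervalIntegral.integral_add (hTv.intervalIntegrable_of_Icc hab.le)
    (hw2.intervalIntegrable_of_Icc hab.le),
    intervalIntegral.integral_const_mul, intervalIntegral_inner_eq hab.le hγ hd hT] at h1
  simp only [habs] at h1
  rw [← hΔ] at h1
  have h5 : inner ℝ Δ v' = |inner ℝ Δ v| := by rw [← habs, abs_of_nonneg hpos]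
  have h6 : ∫ s in a..b, ‖T s - c • u‖ ^ 2 = 2 * c * (c * (b - a) - ‖Δ‖) := by
    have e1 : ∫ s in a..b, ‖T s - c • u‖ ^ 2 =
        ∫ s in a..b, (2 * c ^ 2 - 2 * c * inner ℝ (T s) u) := by
      refine intervalIntegral.integral_congr fun s hs => ?_
      rw [Set.uIcc_of_le hab.le] at hs
      rw [norm_sub_sq_real, hc s hs, norm_smul, hu, inner_smul_right, Real.norm_eq_abs, mul_one,
        sq_abs]
      ring
    rw [e1, intervalIntegral.integral_sub (by simp)
      (hTu.intervalIntegrable_of_Icc hab.le),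
      intervalIntegral.integral_const_mul, intervalIntegral.integral_const_mul,
      intervalIntegral_inner_eq hab.le hγ hd hT,
      intervalIntegral.integral_const, smul_eq_mul, ← hΔ, hΔu]
    ring
  have h7 : ∫ s in a..b, ‖T s - c • u‖ ≤ √(2 * (c * (b - a)) * e) := by
    refine Real.le_sqrt_of_sq_le ((sq_intervalIntegral_le hab hw).trans ?_)
    rw [h6]
    have h8 : 0 ≤ 2 * (c * (b - a)) := by positivity
    nlinarith [mul_le_mul_of_nonneg_left he h8]
  linarith

/-- A curve of constant speed and bounded curvature is only slightly longer than its chord: the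
projection of the velocity to the direction at the midpoint is almost as long as the velocity. -/
theorem length_sub_chord_le {T' : ℝ → E} {M : ℝ} (hab : a < b) (hγ : ContinuousOn γ (Set.Icc a b))
    (hd : ∀ s ∈ Set.Ioo a b, HasDerivAt γ (T s) s)
    (hT : ∀ s ∈ Set.Icc a b, HasDerivWithinAt T (T' s) (Set.Icc a b) s)
    (hc : ∀ s ∈ Set.Icc a b, ‖T s‖ = c) (hM : ∀ s ∈ Set.Icc a b, ‖T' s‖ ≤ M * c ^ 2) :
    c * (b - a) - ‖γ b - γ a‖ ≤ M ^ 2 * (c * (b - a)) ^ 3 / 24 := by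
  have hba : 0 < b - a := sub_pos.2 hab
  have hTc : ContinuousOn T (Set.Icc a b) := fun s hs => (hT s hs).continuousWithinAt
  have hc0 : 0 ≤ c := hc a ⟨le_rfl, hab.le⟩ ▸ norm_nonneg _
  rcases eq_or_lt_of_le hc0 with rfl | hcpos
  · simp
  set m := (a + b) / 2 with hm
  have hmI : m ∈ Set.Icc a b := by constructor <;> linarith
  have h1 : ∀ s ∈ Set.Icc a b, c ^ 2 - M ^ 2 * c ^ 4 / 2 * (s - m) ^ 2 ≤ inner ℝ (T s) (T m) := by
    intro s hs
    have h2 : ‖T s - T m‖ ≤ M * c ^ 2 * ‖s - m‖ :=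
      (convex_Icc a b).norm_image_sub_le_of_norm_hasDerivWithin_le hT hM hmI hs
    have h3 : ‖T s - T m‖ ^ 2 ≤ (M * c ^ 2 * ‖s - m‖) ^ 2 := by gcongr
    rw [norm_sub_sq_real, hc s hs, hc m hmI, mul_pow, Real.norm_eq_abs, sq_abs] at h3
    nlinarith
  have h2 : ∫ s in a..b, (c ^ 2 - M ^ 2 * c ^ 4 / 2 * (s - m) ^ 2) ≤
      ∫ s in a..b, inner ℝ (T s) (T m) := by
    refine intervalIntegral.integral_mono_on hab.le ?_
      ((hTc.inner continuousOn_const).intervalIntegrable_of_Icc hab.le) h1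
    exact Continuous.intervalIntegrable (by fun_prop) _ _
  have h3 : ∫ s in a..b, (c ^ 2 - M ^ 2 * c ^ 4 / 2 * (s - m) ^ 2) =
      c ^ 2 * (b - a) - M ^ 2 * c ^ 4 / 24 * (b - a) ^ 3 := by
    rw [intervalIntegral.integral_sub (by simp) (Continuous.intervalIntegrable (by fun_prop) _ _),
      intervalIntegral.integral_const_mul,
      intervalIntegral.integral_comp_sub_right (fun s => s ^ 2),
      integral_pow, intervalIntegral.integral_const, smul_eq_mul, hm]
    push_cast
    ring
  rw [h3, intervalIntegral_inner_eq hab.le hγ hd hTc] at h2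
  have h4 : inner ℝ (γ b - γ a) (T m) ≤ ‖γ b - γ a‖ * c := by
    have := real_inner_le_norm (γ b - γ a) (T m)
    rwa [hc m hmI] at this
  have h5 : c * (c * (b - a) - ‖γ b - γ a‖) ≤ c * (M ^ 2 * (c * (b - a)) ^ 3 / 24) := by
    nlinarith
  exact le_of_mul_le_mul_left h5 hcpos

end Excess

/-! ### Smooth curves on the unit interval -/

section Curves

variable {d : ℕ} {γ : ℝ → EuclideanSpace ℝ (Fin d)} {r : ℕ∞}

theorem hasDerivWithinAt_velocity (hr : 2 ≤ r) (hγ : ContDiffOn ℝ r γ (Set.Icc 0 1)) {s : ℝ}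
    (hs : s ∈ Set.Icc (0 : ℝ) 1) : HasDerivWithinAt γ (velocity γ s) (Set.Icc 0 1) s := by
  have h1 : (r : WithTop ℕ∞) ≠ 0 := by
    intro h
    have : r = 0 := by exact_mod_cast h
    rw [this] at hr
    exact absurd hr (by decide)
  exact ((hγ.differentiableOn h1) s hs).hasDerivWithinAt

theorem hasDerivAt_velocity (hr : 2 ≤ r) (hγ : ContDiffOn ℝ r γ (Set.Icc 0 1)) {s : ℝ}
    (hs : s ∈ Set.Ioo (0 : ℝ) 1) : HasDerivAt γ (velocity γ s) s :=
  (hasDerivWithinAt_velocity hr hγ (Set.Ioo_subset_Icc_self hs)).hasDerivAt (Icc_mem_nhds hs.1 hs.2)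

theorem contDiffOn_velocity (hr : 2 ≤ r) (hγ : ContDiffOn ℝ r γ (Set.Icc 0 1)) :
    ContDiffOn ℝ 1 (velocity γ) (Set.Icc 0 1) := by
  refine hγ.derivWithin (uniqueDiffOn_Icc zero_lt_one) ?_
  have : ((2 : ℕ∞) : WithTop ℕ∞) ≤ r := WithTop.coe_le_coe.2 hr
  exact le_trans (le_of_eq one_add_one_eq_two) this

theorem hasDerivWithinAt_acceleration (hr : 2 ≤ r) (hγ : ContDiffOn ℝ r γ (Set.Icc 0 1)) {s : ℝ}
    (hs : s ∈ Set.Icc (0 : ℝ) 1) :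
    HasDerivWithinAt (velocity γ) (acceleration γ s) (Set.Icc 0 1) s :=
  (((contDiffOn_velocity hr hγ).differentiableOn one_ne_zero) s hs).hasDerivWithinAt

theorem continuousOn_acceleration (hr : 2 ≤ r) (hγ : ContDiffOn ℝ r γ (Set.Icc 0 1)) :
    ContinuousOn (acceleration γ) (Set.Icc 0 1) :=
  (contDiffOn_velocity hr hγ).continuousOn_derivWithin (uniqueDiffOn_Icc zero_lt_one) le_rfl

theorem arcLength_eq_of_constantSpeed {c : ℝ} (hc : ∀ t ∈ Set.Icc (0 : ℝ) 1, ‖velocity γ t‖ = c) :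
    arcLength γ = c := by
  have h : ∫ t in (0 : ℝ)..1, ‖velocity γ t‖ = ∫ _ in (0 : ℝ)..1, c :=
    intervalIntegral.integral_congr fun t ht => hc t (by rwa [Set.uIcc_of_le zero_le_one] at ht)
  rw [arcLength, h]
  simp

theorem HasConstantSpeed.norm_velocity (h : HasConstantSpeed γ) {t : ℝ}
    (ht : t ∈ Set.Icc (0 : ℝ) 1) : ‖velocity γ t‖ = arcLength γ := by
  obtain ⟨c, hc⟩ := h
  rw [arcLength_eq_of_constantSpeed hc, hc t ht]

theorem inner_velocity_acceleration_eq_zero (hr : 2 ≤ r) (hγ : ContDiffOn ℝ r γ (Set.Icc 0 1))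
    (h : HasConstantSpeed γ) {t : ℝ} (ht : t ∈ Set.Icc (0 : ℝ) 1) :
    inner ℝ (velocity γ t) (acceleration γ t) = 0 := by
  have h1 : HasDerivWithinAt (fun s => inner ℝ (velocity γ s) (velocity γ s))
      (inner ℝ (velocity γ t) (acceleration γ t) + inner ℝ (acceleration γ t) (velocity γ t))
      (Set.Icc 0 1) t :=
    (hasDerivWithinAt_acceleration hr hγ ht).inner ℝ (hasDerivWithinAt_acceleration hr hγ ht)
  have h2 : HasDerivWithinAt (fun s => inner ℝ (velocity γ s) (velocity γ s)) 0
      (Set.Icc 0 1) t := by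
    refine (hasDerivWithinAt_const t (Set.Icc (0 : ℝ) 1) (arcLength γ ^ 2)).congr ?_ ?_
    · intro s hs
      rw [real_inner_self_eq_norm_sq, h.norm_velocity hs]
    · rw [real_inner_self_eq_norm_sq, h.norm_velocity ht]
  have h3 := (uniqueDiffOn_Icc (zero_lt_one' ℝ) t ht).eq_deriv _ h1 h2
  rw [real_inner_comm (velocity γ t) (acceleration γ t)] at h3
  linarith

theorem curvature_of_constantSpeed (hr : 2 ≤ r) (hγ : ContDiffOn ℝ r γ (Set.Icc 0 1))
    (h : HasConstantSpeed γ) {t : ℝ} (ht : t ∈ Set.Icc (0 : ℝ) 1) :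
    curvature γ t = ‖acceleration γ t‖ / arcLength γ ^ 2 := by
  have h0 : 0 ≤ arcLength γ := h.norm_velocity ht ▸ norm_nonneg _
  rw [curvature, inner_velocity_acceleration_eq_zero hr hγ h ht, h.norm_velocity ht]
  rw [zero_pow two_ne_zero, sub_zero, ← mul_pow, Real.sqrt_sq (by positivity)]
  rcases eq_or_lt_of_le h0 with h1 | h1
  · rw [← h1]
    simp
  · field_simp

end Curves

/-! ### The bound for a single cell -/

theorem cellBound_nonneg (M L ε : ℝ) (hε : 0 ≤ ε) : 0 ≤ cellBound M L ε := by
  unfold cellBound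
  split_ifs <;> positivity

theorem cellCount_pos {M L ε : ℝ} (hM : 0 < M) (hL : 0 < L) : 0 < cellCount M L ε := by
  refine lt_of_lt_of_le ?_ (le_max_right _ _)
  exact Nat.ceil_pos.2 (by positivity)

/-- The number of pieces is such that a piece of curvature at most `M` exceeds its chord by at most
`ε`, see `length_sub_chord_le`. -/
theorem cellCount_spec {M L ε : ℝ} (hM : 0 < M) (hL : 0 < L) (hε : 0 < ε) :
    M ^ 2 * (L / cellCount M L ε) ^ 3 / 24 ≤ ε := by
  have hn : (0 : ℝ) < cellCount M L ε := by exact_mod_cast cellCount_pos hM hL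
  set q := M ^ 2 * L ^ 3 / (24 * ε) with hq
  have hq0 : 0 ≤ q := by positivity
  have h1 : q ^ (1 / 3 : ℝ) ≤ cellCount M L ε := by
    refine (Nat.le_ceil _).trans ?_
    exact_mod_cast le_max_left _ _
  have h2 : q ≤ (cellCount M L ε : ℝ) ^ 3 := by
    calc q = (q ^ (1 / 3 : ℝ)) ^ 3 := by
          rw [← Real.rpow_natCast, ← Real.rpow_mul hq0]
          norm_num
      _ ≤ _ := by gcongr
  rw [hq, div_le_iff₀ (by positivity)] at h2
  rw [div_pow, ← mul_div_assoc, div_div, div_le_iff₀ (by positivity)]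
  linarith

/-- The arithmetic behind the constants: `ℓ` and `ℓ'` are the lengths of corresponding pieces of
the two curves, whose excesses over their chords are at most `ε` and `4 * ε`. In terms of
`q = √(ℓ ε)` one has `√2 q ≤ 1.5 q`, `√(8 (ℓ + ε) ε) ≤ √12 q ≤ 3.5 q` and `ε ≤ q`. -/
theorem sum_pieces_le_of_long {n ℓ ℓ' ε : ℝ} (hn : 1 ≤ n) (hε : 0 < ε) (h : 2 * ε < ℓ)
    (hℓ : ℓ' ≤ ℓ + ε) :
    n * (2 * √(2 * ℓ * ε) / 2 + 2 * √(2 * ℓ' * (4 * ε)) / 2 + ε) + (n - 1) * ε ≤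
      8 * √(n * ℓ * n * ε) + n * ε := by
  have hℓ0 : 0 < ℓ := by linarith
  set q := √(ℓ * ε) with hq
  have hq2 : q ^ 2 = ℓ * ε := Real.sq_sqrt (by positivity)
  have hq0 : 0 ≤ q := Real.sqrt_nonneg _
  have h1 : √(n * ℓ * n * ε) = n * q := by
    rw [show n * ℓ * n * ε = n ^ 2 * (ℓ * ε) by ring, Real.sqrt_mul (by positivity),
      Real.sqrt_sq (by linarith)]
  have h2 : √(2 * ℓ * ε) ≤ 1.5 * q :=
    Real.sqrt_le_iff.2 ⟨by positivity, by nlinarith [mul_pos hℓ0 hε]⟩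
  have h3 : √(2 * ℓ' * (4 * ε)) ≤ 3.5 * q :=
    Real.sqrt_le_iff.2 ⟨by positivity, by nlinarith [mul_pos hℓ0 hε]⟩
  have h4 : ε ≤ q := Real.le_sqrt_of_sq_le (by nlinarith)
  rw [h1]
  nlinarith [mul_le_mul_of_nonneg_left h2 (by linarith : (0 : ℝ) ≤ n),
    mul_le_mul_of_nonneg_left h3 (by linarith : (0 : ℝ) ≤ n),
    mul_le_mul_of_nonneg_left h4 (by linarith : (0 : ℝ) ≤ n)]

section

variable {d : ℕ} {γ κ : ℝ → EuclideanSpace ℝ (Fin d)} {r : ℕ∞}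

theorem hasDerivAt_inner_velocity (hr : 2 ≤ r) (hγ : ContDiffOn ℝ r γ (Set.Icc 0 1)) {s : ℝ}
    (hs : s ∈ Set.Ioo (0 : ℝ) 1) (v : EuclideanSpace ℝ (Fin d)) :
    HasDerivAt (fun s => inner ℝ (γ s) v) (inner ℝ (velocity γ s) v) s := by
  simpa using (hasDerivAt_velocity hr hγ hs).inner ℝ (hasDerivAt_const s v)

/-- The contribution of one 1-cell: subdivide it into `cellCount` pieces of equal length. -/
theorem lintegral_cellTerm_inner_le (hr : 2 ≤ r) (hγ : ContDiffOn ℝ r γ (Set.Icc 0 1))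
    (hκ : ContDiffOn ℝ r κ (Set.Icc 0 1)) (hγs : HasConstantSpeed γ) (hκs : HasConstantSpeed κ)
    {ε M : ℝ} (hε : 0 < ε) (hM : 0 < M) (hlen : |arcLength γ - arcLength κ| ≤ ε)
    (hγκ : ∀ s ∈ Set.Icc (0 : ℝ) 1, ‖γ s - κ s‖ ≤ ε) (hcurv : CurvatureBoundedBy γ M)
    {v : EuclideanSpace ℝ (Fin d)} (hv : ‖v‖ = 1) :
    ∫⁻ t, ENNReal.ofReal |cellTerm (fun s => inner ℝ (γ s) v) 0 1 t -
        cellTerm (fun s => inner ℝ (κ s) v) 0 1 t| ≤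
      ENNReal.ofReal (cellBound M (arcLength γ) ε) := by
  have h0I : (0 : ℝ) ∈ Set.Icc (0 : ℝ) 1 := ⟨le_rfl, zero_le_one⟩
  set L := arcLength γ with hL
  set L' := arcLength κ with hL'
  have hL0 : 0 < L := by
    rw [hL, ← hγs.norm_velocity h0I]
    exact norm_pos_iff.2 (hcurv 0 h0I).1
  have hL'0 : 0 ≤ L' := by
    rw [hL', ← hκs.norm_velocity h0I]
    exact norm_nonneg _
  have hacc : ∀ s ∈ Set.Icc (0 : ℝ) 1, ‖acceleration γ s‖ ≤ M * L ^ 2 := by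
    intro s hs
    have := (hcurv s hs).2
    rwa [curvature_of_constantSpeed hr hγ hγs hs, div_le_iff₀ (by positivity)] at this
  have hspec := cellCount_spec hM hL0 hε
  have hnpos := cellCount_pos (ε := ε) hM hL0
  obtain ⟨m, hm⟩ := Nat.exists_eq_succ_of_ne_zero hnpos.ne'
  have hn : (cellCount M L ε : ℝ) = m + 1 := by
    rw [hm]
    push_cast
    ring
  rw [hn] at hspec
  have hm1 : (0 : ℝ) < m + 1 := by positivity
  let x : ℕ → ℝ := fun j => j / (m + 1)
  have hx : StrictMono x := fun i j hij => by
    simp only [x]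
    gcongr
  have hx0 : x 0 = 0 := by simp [x]
  have hx1 : x (m + 1) = 1 := by
    simp only [x]
    push_cast
    exact div_self hm1.ne'
  have hxd : ∀ j, x (j + 1) - x j = 1 / (m + 1) := fun j => by
    simp only [x]
    push_cast
    ring
  have hIcc : ∀ j ≤ m, Set.Icc (x j) (x (j + 1)) ⊆ Set.Icc 0 1 := fun j hj =>
    hx0 ▸ hx1 ▸ Set.Icc_subset_Icc (hx.monotone (Nat.zero_le j)) (hx.monotone (by omega))
  have hIoo : ∀ j ≤ m, Set.Ioo (x j) (x (j + 1)) ⊆ Set.Ioo 0 1 := fun j hj =>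
    hx0 ▸ hx1 ▸ Set.Ioo_subset_Ioo (hx.monotone (Nat.zero_le j)) (hx.monotone (by omega))
  have hvel := (contDiffOn_velocity hr hγ).continuousOn
  have hvel' := (contDiffOn_velocity hr hκ).continuousOn
  set ℓ := L / (m + 1) with hℓ
  set ℓ' := L' / (m + 1) with hℓ'
  have hlj : ∀ j, L * (x (j + 1) - x j) = ℓ := fun j => by rw [hxd, hℓ, mul_one_div]
  have hlj' : ∀ j, L' * (x (j + 1) - x j) = ℓ' := fun j => by rw [hxd, hℓ', mul_one_div]
  have hℓℓ' : ℓ' ≤ ℓ + ε := by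
    have h1 : L' ≤ L + ε := by linarith [(abs_le.1 hlen).1]
    calc ℓ' ≤ (L + ε) / (m + 1) := by rw [hℓ']; gcongr
      _ = ℓ + ε / (m + 1) := by rw [hℓ, add_div]
      _ ≤ ℓ + ε := by
        gcongr
        exact div_le_self hε.le (by linarith [(Nat.cast_nonneg m : (0 : ℝ) ≤ m)])
  -- each piece of `γ` exceeds its chord by at most `ε`; compared with `γ`, the chord of a piece of
  -- `κ` is shorter by at most `2 ε` and the piece is longer by at most `ε`
  have hef : ∀ j ≤ m, L * (x (j + 1) - x j) - ‖γ (x (j + 1)) - γ (x j)‖ ≤ ε := by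
    intro j hj
    have := length_sub_chord_le (M := M) (hx (Nat.lt_succ_self j))
      (hγ.continuousOn.mono (hIcc j hj))
      (fun s hs => hasDerivAt_velocity hr hγ (hIoo j hj hs))
      (fun s hs => (hasDerivWithinAt_acceleration hr hγ (hIcc j hj hs)).mono (hIcc j hj))
      (fun s hs => hγs.norm_velocity (hIcc j hj hs)) (fun s hs => hacc s (hIcc j hj hs))
    simp only [Nat.succ_eq_add_one, ← hL] at this
    rw [hlj] at this ⊢
    exact this.trans hspec
  have heg : ∀ j ≤ m, L' * (x (j + 1) - x j) - ‖κ (x (j + 1)) - κ (x j)‖ ≤ 4 * ε := by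
    intro j hj
    have h1 := hef j hj
    have hxj : x j ∈ Set.Icc (0 : ℝ) 1 := hIcc j hj ⟨le_rfl, (hx (Nat.lt_succ_self j)).le⟩
    have hxj' : x (j + 1) ∈ Set.Icc (0 : ℝ) 1 := hIcc j hj ⟨(hx (Nat.lt_succ_self j)).le, le_rfl⟩
    have h2 : ‖γ (x (j + 1)) - γ (x j)‖ ≤ ‖κ (x (j + 1)) - κ (x j)‖ + 2 * ε := by
      have e : γ (x (j + 1)) - γ (x j) = (κ (x (j + 1)) - κ (x j)) +
          ((γ (x (j + 1)) - κ (x (j + 1))) - (γ (x j) - κ (x j))) := by abel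
      rw [e]
      refine (norm_add_le _ _).trans ?_
      gcongr
      refine (norm_sub_le _ _).trans ?_
      linarith [hγκ _ hxj, hγκ _ hxj']
    rw [hlj] at h1
    rw [hlj']
    linarith
  have hmain := fun A B => lintegral_cellTerm_sub_le (h := fun s => inner ℝ (γ s) v)
    (h' := fun s => inner ℝ (velocity γ s) v) (k := fun s => inner ℝ (κ s) v)
    (k' := fun s => inner ℝ (velocity κ s) v) (ε := ε) (A := A) (B := B) hx m
    (by rw [hx0, hx1]; exact hγ.continuousOn.inner continuousOn_const)
    (by
      rw [hx0, hx1]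
      intro s hs
      exact hasDerivAt_inner_velocity hr hγ hs v)
    (by rw [hx0, hx1]; exact hvel.inner continuousOn_const)
    (by rw [hx0, hx1]; exact hκ.continuousOn.inner continuousOn_const)
    (by
      rw [hx0, hx1]
      intro s hs
      exact hasDerivAt_inner_velocity hr hκ hs v)
    (by rw [hx0, hx1]; exact hvel'.inner continuousOn_const)
    (by
      rw [hx0, hx1]
      intro s hs
      rw [← inner_sub_left]
      have := abs_real_inner_le_norm (γ s - κ s) v
      rw [hv, mul_one] at this
      exact this.trans (hγκ s hs))
  rw [hx0, hx1] at hmain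
  simp only [← inner_sub_left] at hmain
  unfold cellBound
  rw [hn, ← hℓ]
  by_cases hcase : ℓ > 2 * ε
  · rw [if_pos hcase]
    refine (hmain (2 * √(2 * ℓ * ε)) (2 * √(2 * ℓ' * (4 * ε))) (by positivity) (by positivity)
      ?_ ?_).trans (ENNReal.ofReal_le_ofReal ?_)
    · intro j hj
      rw [← hlj j]
      exact excess_variation_le (hx (Nat.lt_succ_self j)) (hγ.continuousOn.mono (hIcc j hj))
        (fun s hs => hasDerivAt_velocity hr hγ (hIoo j hj hs)) (hvel.mono (hIcc j hj))
        (fun s hs => hγs.norm_velocity (hIcc j hj hs)) hv (hef j hj)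
    · intro j hj
      rw [← hlj' j]
      exact excess_variation_le (hx (Nat.lt_succ_self j)) (hκ.continuousOn.mono (hIcc j hj))
        (fun s hs => hasDerivAt_velocity hr hκ (hIoo j hj hs)) (hvel'.mono (hIcc j hj))
        (fun s hs => hκs.norm_velocity (hIcc j hj hs)) hv (heg j hj)
    · have := sum_pieces_le_of_long (n := m + 1) (by linarith [(Nat.cast_nonneg m : (0 : ℝ) ≤ m)])
        hε hcase hℓℓ'
      rw [add_sub_cancel_right, show ((m : ℝ) + 1) * ℓ = L by rw [hℓ]; field_simp] at this
      exact this
  · -- short pieces: the excess variation is at most the length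
    rw [if_neg hcase]
    have hℓ0 : 0 ≤ ℓ := by positivity
    have hℓ'0 : 0 ≤ ℓ' := by positivity
    refine (hmain ℓ ℓ' hℓ0 hℓ'0 ?_ ?_).trans (ENNReal.ofReal_le_ofReal ?_)
    · intro j hj
      have := intervalIntegral_abs_inner_le (hx (Nat.lt_succ_self j)).le (hvel.mono (hIcc j hj))
        (fun s hs => hγs.norm_velocity (hIcc j hj hs)) hv
      rw [← hL, Nat.succ_eq_add_one, hlj j] at this
      linarith [abs_nonneg (inner ℝ (γ (x (j + 1)) - γ (x j)) v)]
    · intro j hj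
      have := intervalIntegral_abs_inner_le (hx (Nat.lt_succ_self j)).le (hvel'.mono (hIcc j hj))
        (fun s hs => hκs.norm_velocity (hIcc j hj hs)) hv
      rw [← hL', Nat.succ_eq_add_one, hlj' j] at this
      linarith [abs_nonneg (inner ℝ (κ (x (j + 1)) - κ (x j)) v)]
    · rw [not_lt] at hcase
      nlinarith [mul_pos hm1 hε]

end

namespace OneDimCW

variable {Z₀ Λ : Type} (K : OneDimCW Z₀ Λ) {d : ℕ} {r : ℕ∞}

theorem mapECT_bound [Fintype Z₀] [Fintype Λ] (hr : 2 ≤ r)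
    {f g : K.Space → EuclideanSpace ℝ (Fin d)}
    (hf : f ∈ K.smoothMaps r d) (hg : g ∈ K.smoothMaps r d) {M ε : ℝ} (hM : 0 < M) (hε : 0 < ε)
    (h : K.Close f g ε) (hcurv : K.MapCurvatureBoundedBy f M) :
    ECTDiffMeasurable (mapECT f) (mapECT g) ∧
      ectDist (mapECT f) (mapECT g) ≤ ENNReal.ofReal
        (Fintype.card Z₀ * ε + ∑ l, cellBound M (arcLength (K.curve f l)) ε) := by
  have hcf := K.continuous_of_mem_smoothMaps hf
  have hcg := K.continuous_of_mem_smoothMaps hg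
  have key : ∀ v : Direction d, _ := fun v => K.lintegral_absDiff_sublevel_le
    (h := fun z => inner ℝ (f z) (v : EuclideanSpace ℝ (Fin d)))
    (k := fun z => inner ℝ (g z) (v : EuclideanSpace ℝ (Fin d)))
    (h' := fun l s => inner ℝ (velocity (K.curve f l) s) (v : EuclideanSpace ℝ (Fin d)))
    (k' := fun l s => inner ℝ (velocity (K.curve g l) s) (v : EuclideanSpace ℝ (Fin d)))
    (hcf.inner continuous_const) (hcg.inner continuous_const)
    (fun l s hs => by
      exact hasDerivAt_inner_velocity hr (hf l) hs _)
    (fun l s hs => by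
      exact hasDerivAt_inner_velocity hr (hg l) hs _)
    (fun l => (contDiffOn_velocity hr (hf l)).continuousOn.inner continuousOn_const)
    (fun l => (contDiffOn_velocity hr (hg l)).continuousOn.inner continuousOn_const)
  refine ⟨fun v => (key v).1, iSup_le fun v => (key v).2.trans ?_⟩
  have hv : ‖(v : EuclideanSpace ℝ (Fin d))‖ = 1 := by simp
  rw [ENNReal.ofReal_add (by positivity)
    (Finset.sum_nonneg fun l _ => cellBound_nonneg _ _ _ hε.le),
    ENNReal.ofReal_sum_of_nonneg fun l _ => cellBound_nonneg _ _ _ hε.le]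
  refine add_le_add ?_ (Finset.sum_le_sum fun l _ => ?_)
  · calc _ ≤ ∑ _ : Z₀, ENNReal.ofReal ε := by
          refine Finset.sum_le_sum fun w _ => ENNReal.ofReal_le_ofReal ?_
          rw [← inner_sub_left]
          have := abs_real_inner_le_norm (f (K.vertex w) - g (K.vertex w))
            (v : EuclideanSpace ℝ (Fin d))
          rw [hv, mul_one] at this
          exact this.trans (h.sup_norm _)
      _ = _ := by
          rw [Finset.sum_const, Finset.card_univ, nsmul_eq_mul,
            ENNReal.ofReal_mul (Nat.cast_nonneg _), ENNReal.ofReal_natCast]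
  · exact lintegral_cellTerm_inner_le hr (hf l) (hg l) (h.speed_left l) (h.speed_right l) hε hM
      (h.length l) (fun s _ => h.sup_norm _) (hcurv l) hv

/-- The transform of an embedded shape is the transform of any embedding with that image. -/
theorem setECT_eq_mapECT {h : K.Space → EuclideanSpace ℝ (Fin d)} (hh : Topology.IsEmbedding h)
    {X : Set (EuclideanSpace ℝ (Fin d))} (hX : Set.range h = X) : setECT X = mapECT h := by
  subst hX
  funext v t
  let p : K.Space → Prop := fun z => inner ℝ (h z) (v : EuclideanSpace ℝ (Fin d)) ≤ t
  let F : {z // p z} → {x : EuclideanSpace ℝ (Fin d) //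
      x ∈ Set.range h ∧ inner ℝ x (v : EuclideanSpace ℝ (Fin d)) ≤ t} :=
    fun z => ⟨h z, ⟨z, rfl⟩, z.2⟩
  have hF : Topology.IsEmbedding F :=
    Topology.IsEmbedding.of_comp
      ((hh.continuous.comp continuous_subtype_val).subtype_mk _) continuous_subtype_val
      (hh.comp Topology.IsEmbedding.subtypeVal)
  have hs : Function.Surjective F := by
    rintro ⟨_, ⟨z, rfl⟩, hz⟩
    exact ⟨⟨z, hz⟩, rfl⟩
  exact ((hF.toHomeomorphOfSurjective hs).eulerCharacteristic_eq).symm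

theorem setECT_bound [Fintype Z₀] [Fintype Λ] (hr : 2 ≤ r) {X Y : Set (EuclideanSpace ℝ (Fin d))}
    {hX hY : K.Space → EuclideanSpace ℝ (Fin d)} {M ε : ℝ} (hM : 0 < M) (hε : 0 < ε)
    (h : K.IsMatching r X Y ε hX hY) (hcurv : K.MapCurvatureBoundedBy hX M) :
    ECTDiffMeasurable (setECT X) (setECT Y) ∧
      ectDist (setECT X) (setECT Y) ≤ ENNReal.ofReal
        (Fintype.card Z₀ * ε + ∑ l, cellBound M (arcLength (K.curve hX l)) ε) := by
  obtain ⟨h1, h2, h3, h4, h5⟩ := h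
  rw [K.setECT_eq_mapECT h1.2 h3, K.setECT_eq_mapECT h2.2 h4]
  exact K.mapECT_bound hr h1.1 h2.1 hM hε h5 hcurv

end OneDimCW

/-! ### Reparametrized curves -/

/-- If `γ ∘ φ` is of class `C²` for a continuous `φ` and a regular `C²` curve `γ`, then so is `φ`:
project to the tangent line and invert. -/
theorem contDiffAt_of_comp_eq {E : Type*} [NormedAddCommGroup E] [InnerProductSpace ℝ E]
    {γ κ : ℝ → E} {φ : ℝ → ℝ} {s₀ : ℝ} {γ' : E} (hγ : ContDiffAt ℝ 2 γ (φ s₀))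
    (hd : HasDerivAt γ γ' (φ s₀)) (h0 : γ' ≠ 0) (hκ : ContDiffAt ℝ 2 κ s₀)
    (hφ : ContinuousAt φ s₀) (he : ∀ᶠ s in nhds s₀, γ (φ s) = κ s) : ContDiffAt ℝ 2 φ s₀ := by
  have hg : ContDiffAt ℝ 2 (fun σ => inner ℝ (γ σ) γ') (φ s₀) := hγ.inner ℝ contDiffAt_const
  have hgd : HasDerivAt (fun σ => inner ℝ (γ σ) γ') (inner ℝ γ' γ') (φ s₀) := by
    simpa using hd.inner ℝ (hasDerivAt_const (φ s₀) γ')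
  have hne : (inner ℝ γ' γ' : ℝ) ≠ 0 := inner_self_ne_zero.2 h0
  have hfd := hgd.hasFDerivAt_equiv hne
  have hinv := hg.to_localInverse hfd two_ne_zero
  have hleft := (hg.hasStrictFDerivAt' hfd two_ne_zero).eventually_left_inverse
  have heq : φ =ᶠ[nhds s₀] fun s => hg.localInverse hfd two_ne_zero (inner ℝ (κ s) γ') := by
    filter_upwards [hφ.eventually hleft, he] with s hs hs'
    rw [← hs']
    exact hs.symm
  refine ContDiffAt.congr_of_eventuallyEq ?_ heq
  have hκ' : ContDiffAt ℝ 2 (fun s => (inner ℝ (κ s) γ' : ℝ)) s₀ := hκ.inner ℝ contDiffAt_const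
  refine ContDiffAt.comp s₀ (g := hg.localInverse hfd two_ne_zero) ?_ hκ'
  rw [← he.self_of_nhds]
  exact hinv

section Reparam

variable {d : ℕ} {γ κ : ℝ → EuclideanSpace ℝ (Fin d)} {r : ℕ∞} {φ : ℝ → ℝ} {s₀ : ℝ}

theorem velocity_comp (hr : 2 ≤ r) (hγ : ContDiffOn ℝ r γ (Set.Icc 0 1))
    (hκ : ContDiffOn ℝ r κ (Set.Icc 0 1)) (hs : s₀ ∈ Set.Ioo (0 : ℝ) 1)
    (hφs : φ s₀ ∈ Set.Ioo (0 : ℝ) 1) (hφ : DifferentiableAt ℝ φ s₀)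
    (he : ∀ᶠ s in nhds s₀, γ (φ s) = κ s) :
    velocity κ s₀ = deriv φ s₀ • velocity γ (φ s₀) := by
  have h1 := (hasDerivAt_velocity hr hγ hφs).scomp s₀ hφ.hasDerivAt
  have h2 : HasDerivAt κ (deriv φ s₀ • velocity γ (φ s₀)) s₀ :=
    h1.congr_of_eventuallyEq (he.mono fun s hs => hs.symm)
  exact (hasDerivAt_velocity hr hκ hs).unique h2

theorem acceleration_comp (hr : 2 ≤ r) (hγ : ContDiffOn ℝ r γ (Set.Icc 0 1))
    (hκ : ContDiffOn ℝ r κ (Set.Icc 0 1)) (hs : s₀ ∈ Set.Ioo (0 : ℝ) 1)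
    (hφs : φ s₀ ∈ Set.Ioo (0 : ℝ) 1) (hφ : ContDiffAt ℝ 2 φ s₀)
    (he : ∀ᶠ s in nhds s₀, γ (φ s) = κ s) :
    acceleration κ s₀ = deriv φ s₀ • deriv φ s₀ • acceleration γ (φ s₀) +
      deriv (deriv φ) s₀ • velocity γ (φ s₀) := by
  have hφd : DifferentiableAt ℝ φ s₀ := hφ.differentiableAt two_ne_zero
  have hφ1 : ∀ᶠ s in nhds s₀, DifferentiableAt ℝ φ s := by
    filter_upwards [hφ.eventually (by simp)] with s hs
    exact hs.differentiableAt two_ne_zero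
  have hφ2 : DifferentiableAt ℝ (deriv φ) s₀ := by
    have h : ContDiffAt ℝ 1 (fderiv ℝ φ) s₀ := hφ.fderiv_right (le_of_eq one_add_one_eq_two)
    exact (h.differentiableAt one_ne_zero).clm_apply (differentiableAt_const (1 : ℝ))
  have hv : ∀ᶠ s in nhds s₀, velocity κ s = deriv φ s • velocity γ (φ s) := by
    filter_upwards [he.eventually_nhds, hφ1, isOpen_Ioo.mem_nhds hs,
      hφd.continuousAt.preimage_mem_nhds (isOpen_Ioo.mem_nhds hφs)] with s h1 h2 h3 h4
    exact velocity_comp hr hγ hκ h3 h4 h2 h1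
  have hI := Icc_mem_nhds hs.1 hs.2
  have hI' := Icc_mem_nhds hφs.1 hφs.2
  have h1 : HasDerivAt (velocity γ) (acceleration γ (φ s₀)) (φ s₀) :=
    (hasDerivWithinAt_acceleration hr hγ (Set.Ioo_subset_Icc_self hφs)).hasDerivAt hI'
  have h2 : HasDerivAt (velocity κ) (acceleration κ s₀) s₀ :=
    (hasDerivWithinAt_acceleration hr hκ (Set.Ioo_subset_Icc_self hs)).hasDerivAt hI
  have h3 := hφ2.hasDerivAt.smul (h1.scomp s₀ hφd.hasDerivAt)
  exact h2.unique (h3.congr_of_eventuallyEq hv)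

/-- Curvature does not depend on the parametrization. -/
theorem curvature_comp (hr : 2 ≤ r) (hγ : ContDiffOn ℝ r γ (Set.Icc 0 1))
    (hκ : ContDiffOn ℝ r κ (Set.Icc 0 1)) (hs : s₀ ∈ Set.Ioo (0 : ℝ) 1)
    (hφs : φ s₀ ∈ Set.Ioo (0 : ℝ) 1) (hφ : ContDiffAt ℝ 2 φ s₀)
    (he : ∀ᶠ s in nhds s₀, γ (φ s) = κ s) (h0 : velocity κ s₀ ≠ 0) :
    curvature κ s₀ = curvature γ (φ s₀) := by
  have hv := velocity_comp hr hγ hκ hs hφs (hφ.differentiableAt two_ne_zero) he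
  have ha := acceleration_comp hr hγ hκ hs hφs hφ he
  have hφ0 : deriv φ s₀ ≠ 0 := by
    intro h
    rw [h, zero_smul] at hv
    exact h0 hv
  rw [curvature, curvature, hv, ha]
  set p := deriv φ s₀
  set q := deriv (deriv φ) s₀
  set V := velocity γ (φ s₀)
  set A := acceleration γ (φ s₀)
  have e : ‖p • V‖ ^ 2 * ‖p • p • A + q • V‖ ^ 2 - inner ℝ (p • V) (p • p • A + q • V) ^ 2 =
      (|p| ^ 3) ^ 2 * (‖V‖ ^ 2 * ‖A‖ ^ 2 - inner ℝ V A ^ 2) := by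
    rw [← pow_mul, pow_mul |p| 2 3, sq_abs]
    simp only [← real_inner_self_eq_norm_sq, inner_add_left, inner_add_right,
      real_inner_smul_left, real_inner_smul_right, real_inner_comm V A]
    ring
  rw [e, Real.sqrt_mul (by positivity), Real.sqrt_sq (by positivity), norm_smul, Real.norm_eq_abs,
    mul_pow, mul_div_mul_left _ _ (by positivity)]

end Reparam

/-! ### Two embeddings with the same image -/

namespace OneDimCW

variable {Z₀ Λ : Type} (K : OneDimCW Z₀ Λ)

/-- The interior of a 1-cell. -/
def openCell (l : Λ) : Set K.Space := K.edge l '' Set.Ioo 0 1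

/-- The parameter of a point in the interior of a 1-cell. -/
def cellParam (l : Λ) : K.Space → ℝ := Function.invFunOn (K.edge l) (Set.Ioo 0 1)

theorem isOpen_openCell (l : Λ) : IsOpen (K.openCell l) := by
  have e : K.openCell l = {z | 0 < K.edgeCoord l (fun _ => 1) z} := by
    ext z
    constructor
    · rintro ⟨s, hs, rfl⟩
      rw [Set.mem_ofPred_eq, K.edgeCoord_edge_self l _ (Set.Ioo_subset_Icc_self hs), mul_one]
      exact mul_pos hs.1 (by linarith [hs.2])
    · intro hz
      rw [Set.mem_ofPred_eq] at hz
      rcases K.exists_rep z with ⟨v, rfl⟩ | ⟨m, s, hs, rfl⟩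
      · rw [K.edgeCoord_vertex] at hz
        exact absurd hz (lt_irrefl _)
      · by_cases h : m = l
        · exact h ▸ ⟨s, hs, rfl⟩
        · rw [K.edgeCoord_edge_of_ne h _ (Set.Ioo_subset_Icc_self hs)] at hz
          exact absurd hz (lt_irrefl _)
  rw [e]
  exact isOpen_lt continuous_const (K.continuous_edgeCoord l continuous_const)

theorem cellParam_mem {l : Λ} {z : K.Space} (hz : z ∈ K.openCell l) :
    K.cellParam l z ∈ Set.Ioo (0 : ℝ) 1 := Function.invFunOn_mem hz

theorem edge_cellParam {l : Λ} {z : K.Space} (hz : z ∈ K.openCell l) :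
    K.edge l (K.cellParam l z) = z := Function.invFunOn_eq hz

theorem continuousOn_cellParam (l : Λ) : ContinuousOn (K.cellParam l) (K.openCell l) := by
  refine continuousOn_of_leftInverse_of_isCompact isCompact_Icc (K.continuous_edge l).continuousOn
    (fun y hy => ⟨Set.Ioo_subset_Icc_self (K.cellParam_mem hy), K.edge_cellParam hy⟩) ?_
  intro s hs hmem
  exact (K.edge_inj (K.cellParam_mem hmem) hs (K.edge_cellParam hmem)).2

variable {d : ℕ} {r : ℕ∞} {h k : K.Space → EuclideanSpace ℝ (Fin d)}

theorem exists_transition (hh : Topology.IsEmbedding h) (hk : Topology.IsEmbedding k)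
    (hhk : Set.range h = Set.range k) :
    ∃ ψ : K.Space → K.Space, Continuous ψ ∧ Function.Injective ψ ∧ ∀ z, h (ψ z) = k z := by
  have hex : ∀ z, ∃ w, h w = k z := fun z => by
    have : k z ∈ Set.range h := hhk ▸ ⟨z, rfl⟩
    exact this
  choose ψ hψ using hex
  have e : h ∘ ψ = k := funext hψ
  refine ⟨ψ, hh.continuous_iff.2 (e ▸ hk.continuous), fun z w hzw => hk.injective ?_, hψ⟩
  rw [← hψ z, ← hψ w, hzw]

/-- In the interior of the 1-cells, the change of parameters between two embeddings with the same
image is of class `C²`. -/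
theorem contDiffAt_transition (hr : 2 ≤ r) (hh : h ∈ K.smoothMaps r d)
    (hk : k ∈ K.smoothMaps r d) {ψ : K.Space → K.Space} (hψ : Continuous ψ)
    (hψe : ∀ z, h (ψ z) = k z) {l m : Λ} {s₀ : ℝ} (hs : s₀ ∈ Set.Ioo (0 : ℝ) 1)
    (hm : ψ (K.edge l s₀) ∈ K.openCell m)
    (hreg : ∀ s ∈ Set.Ioo (0 : ℝ) 1, velocity (K.curve h m) s ≠ 0) :
    ContDiffAt ℝ 2 (fun s => K.cellParam m (ψ (K.edge l s))) s₀ ∧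
      ∀ᶠ s in nhds s₀, K.curve h m (K.cellParam m (ψ (K.edge l s))) = K.curve k l s := by
  have hc : Continuous fun s => ψ (K.edge l s) := hψ.comp (K.continuous_edge l)
  have he : ∀ᶠ s in nhds s₀,
      K.curve h m (K.cellParam m (ψ (K.edge l s))) = K.curve k l s := by
    filter_upwards [hc.continuousAt.preimage_mem_nhds ((K.isOpen_openCell m).mem_nhds hm)] with s hs
    rw [curve_eq_comp, curve_eq_comp, Function.comp_apply, Function.comp_apply,
      K.edge_cellParam hs, hψe]
  refine ⟨?_, he⟩
  have hr' : ((2 : ℕ∞) : WithTop ℕ∞) ≤ r := WithTop.coe_le_coe.2 hr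
  have hmem := K.cellParam_mem hm
  refine contDiffAt_of_comp_eq (γ := K.curve h m) (κ := K.curve k l) (s₀ := s₀)
    (φ := fun s => K.cellParam m (ψ (K.edge l s)))
    (((hh m).of_le hr').contDiffAt (Icc_mem_nhds hmem.1 hmem.2))
    (hasDerivAt_velocity hr (hh m) hmem) (hreg _ hmem)
    (((hk l).of_le hr').contDiffAt (Icc_mem_nhds hs.1 hs.2)) ?_ he
  exact ContinuousAt.comp (f := fun s => ψ (K.edge l s))
    ((K.continuousOn_cellParam m).continuousAt ((K.isOpen_openCell m).mem_nhds hm)) hc.continuousAt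

/-- All but finitely many interior points of a 1-cell correspond to interior points of 1-cells. -/
theorem finite_transition_vertex [Finite Z₀] {ψ : K.Space → K.Space}
    (hψ : Function.Injective ψ) (l : Λ) :
    (Set.Ioo (0 : ℝ) 1 ∩ {s | ∀ m, ψ (K.edge l s) ∉ K.openCell m}).Finite := by
  refine Set.Finite.of_finite_image (f := fun s => ψ (K.edge l s))
    ((Set.finite_range K.vertex).subset ?_) ?_
  · rintro _ ⟨s, ⟨_, hs⟩, rfl⟩
    rcases K.exists_rep (ψ (K.edge l s)) with ⟨v, hv⟩ | ⟨m, t, ht, hmt⟩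
    · exact ⟨v, hv⟩
    · exact absurd ⟨t, ht, hmt⟩ (hs m)
  · intro s hs t ht hst
    exact (K.edge_inj hs.1 (Set.Ioo_subset_Icc_self ht.1) (hψ hst)).2

theorem velocity_ne_zero_of_constantSpeed (hr : 2 ≤ r) (hk : k ∈ K.smoothMaps r d)
    (hinj : Function.Injective k) {l : Λ} (hc : HasConstantSpeed (K.curve k l)) {t : ℝ}
    (ht : t ∈ Set.Icc (0 : ℝ) 1) : velocity (K.curve k l) t ≠ 0 := by
  intro h0
  have hL : arcLength (K.curve k l) = 0 := by rw [← hc.norm_velocity ht, h0, norm_zero]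
  have hz : ∀ s ∈ Set.Icc (0 : ℝ) 1, ‖velocity (K.curve k l) s‖ ≤ 0 := fun s hs =>
    (hc.norm_velocity hs).trans hL |>.le
  have h1 : (1 / 2 : ℝ) ∈ Set.Ioo (0 : ℝ) 1 := by constructor <;> norm_num
  have h2 : (1 / 3 : ℝ) ∈ Set.Icc (0 : ℝ) 1 := by constructor <;> norm_num
  have := (convex_Icc (0 : ℝ) 1).norm_image_sub_le_of_norm_hasDerivWithin_le
    (fun s hs => hasDerivWithinAt_velocity hr (hk l) hs) hz h2 (Set.Ioo_subset_Icc_self h1)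
  rw [zero_mul] at this
  have heq : k (K.edge l (1 / 2)) = k (K.edge l (1 / 3)) :=
    sub_eq_zero.1 (norm_le_zero_iff.1 this)
  have := (K.edge_inj h1 h2 (hinj heq)).2
  norm_num at this

/-- A curvature bound passes from one embedding to every constant speed embedding with the same
image. -/
theorem mapCurvatureBoundedBy_of_range_eq [Finite Z₀] (hr : 2 ≤ r) (hh : h ∈ K.smoothEmbeddings r d)
    (hk : k ∈ K.smoothEmbeddings r d) (hhk : Set.range h = Set.range k)
    (hc : ∀ l, HasConstantSpeed (K.curve k l)) {M : ℝ} (hM : K.MapCurvatureBoundedBy h M) :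
    K.MapCurvatureBoundedBy k M := by
  obtain ⟨ψ, hψc, hψi, hψ⟩ := K.exists_transition hh.2 hk.2 hhk
  intro l
  have hne := fun t ht =>
    K.velocity_ne_zero_of_constantSpeed hr hk.1 hk.2.injective (hc l) (t := t) ht
  have h0I : (0 : ℝ) ∈ Set.Icc (0 : ℝ) 1 := ⟨le_rfl, zero_le_one⟩
  have hLpos : 0 < arcLength (K.curve k l) := by
    rw [← (hc l).norm_velocity h0I]
    exact norm_pos_iff.2 (hne 0 h0I)
  set F := Set.Ioo (0 : ℝ) 1 ∩ {s | ∀ m, ψ (K.edge l s) ∉ K.openCell m} with hF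
  have hFfin : F.Finite := K.finite_transition_vertex hψi l
  have hgood : ∀ s ∈ Set.Ioo (0 : ℝ) 1 ∩ Fᶜ,
      ‖acceleration (K.curve k l) s‖ ≤ M * arcLength (K.curve k l) ^ 2 := by
    rintro s ⟨hs, hsF⟩
    have hex : ∃ m, ψ (K.edge l s) ∈ K.openCell m := by
      by_contra hcon
      exact hsF ⟨hs, not_exists.1 hcon⟩
    obtain ⟨m, hm⟩ := hex
    obtain ⟨h1, h2⟩ := K.contDiffAt_transition hr hh.1 hk.1 hψc hψ hs hm
      fun t ht => (hM m t (Set.Ioo_subset_Icc_self ht)).1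
    have hs' := Set.Ioo_subset_Icc_self hs
    have hmem := K.cellParam_mem hm
    have h3 := curvature_comp hr (hh.1 m) (hk.1 l) hs hmem h1 h2 (hne s hs')
    have h4 := (hM m _ (Set.Ioo_subset_Icc_self hmem)).2
    rw [← h3, curvature_of_constantSpeed hr (hk.1 l) (hc l) hs',
      div_le_iff₀ (by positivity)] at h4
    exact h4
  -- the bound extends by continuity to the finitely many other parameters
  have hclosed : IsClosed (Set.Icc (0 : ℝ) 1 ∩ (fun s => ‖acceleration (K.curve k l) s‖) ⁻¹'
      Set.Iic (M * arcLength (K.curve k l) ^ 2)) :=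
    (continuousOn_acceleration hr (hk.1 l)).norm.preimage_isClosed_of_isClosed isClosed_Icc
      isClosed_Iic
  have hdense : Set.Icc (0 : ℝ) 1 ⊆ closure (Set.Ioo (0 : ℝ) 1 ∩ Fᶜ) := by
    rw [← closure_Ioo (zero_ne_one' ℝ)]
    refine closure_minimal ?_ isClosed_closure
    exact (hFfin.countable.dense_compl ℝ).open_subset_closure_inter isOpen_Ioo
  have hall : Set.Icc (0 : ℝ) 1 ⊆ Set.Icc (0 : ℝ) 1 ∩
      (fun s => ‖acceleration (K.curve k l) s‖) ⁻¹' Set.Iic (M * arcLength (K.curve k l) ^ 2) :=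
    hdense.trans (closure_minimal
      (fun s hs => ⟨Set.Ioo_subset_Icc_self hs.1, hgood s hs⟩) hclosed)
  intro t ht
  refine ⟨hne t ht, ?_⟩
  rw [curvature_of_constantSpeed hr (hk.1 l) (hc l) ht, div_le_iff₀ (by positivity)]
  exact (hall ht).2

/-- The length of a 1-cell under a constant speed embedding is at most the total length of any
other constant speed embedding with the same image. -/
theorem arcLength_le_sum [Finite Z₀] [Fintype Λ] (hr : 2 ≤ r) (hh : h ∈ K.smoothEmbeddings r d)
    (hk : k ∈ K.smoothEmbeddings r d) (hhk : Set.range h = Set.range k)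
    (hc : ∀ l, HasConstantSpeed (K.curve k l)) (hc' : ∀ l, HasConstantSpeed (K.curve h l)) (l : Λ) :
    arcLength (K.curve k l) ≤ ∑ m, arcLength (K.curve h m) := by
  obtain ⟨ψ, hψc, hψi, hψ⟩ := K.exists_transition hh.2 hk.2 hhk
  have hcont : Continuous fun s => ψ (K.edge l s) := hψc.comp (K.continuous_edge l)
  have h0I : (0 : ℝ) ∈ Set.Icc (0 : ℝ) 1 := ⟨le_rfl, zero_le_one⟩
  have hL0 : 0 ≤ arcLength (K.curve k l) := (hc l).norm_velocity h0I ▸ norm_nonneg _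
  have hLpos : ∀ m, 0 < arcLength (K.curve h m) := fun m => by
    rw [← (hc' m).norm_velocity h0I]
    exact norm_pos_iff.2
      (K.velocity_ne_zero_of_constantSpeed hr hh.1 hh.2.injective (hc' m) h0I)
  let S : Λ → Set ℝ := fun m => Set.Ioo 0 1 ∩ (fun s => ψ (K.edge l s)) ⁻¹' K.openCell m
  have hSo : ∀ m, IsOpen (S m) := fun m =>
    isOpen_Ioo.inter ((K.isOpen_openCell m).preimage hcont)
  -- each part covers at most the full length of one cell
  have hpart : ∀ m, ENNReal.ofReal (arcLength (K.curve k l)) * volume (S m) ≤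
      ENNReal.ofReal (arcLength (K.curve h m)) := by
    intro m
    let φ : ℝ → ℝ := fun s => K.cellParam m (ψ (K.edge l s))
    have hmem : ∀ s ∈ S m, φ s ∈ Set.Ioo (0 : ℝ) 1 := fun s hs => K.cellParam_mem hs.2
    have htr : ∀ s ∈ S m, _ := fun s hs => K.contDiffAt_transition hr hh.1 hk.1 hψc hψ hs.1 hs.2
      fun t ht => K.velocity_ne_zero_of_constantSpeed hr hh.1 hh.2.injective (hc' m)
        (Set.Ioo_subset_Icc_self ht)
    have hdiff : ∀ s ∈ S m, DifferentiableAt ℝ φ s := fun s hs =>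
      (htr s hs).1.differentiableAt two_ne_zero
    have hinj : Set.InjOn φ (S m) := by
      intro s hs t ht hst
      have e : ψ (K.edge l s) = ψ (K.edge l t) := by
        exact (K.edge_cellParam hs.2).symm.trans
          ((congrArg (K.edge m) hst).trans (K.edge_cellParam ht.2))
      exact (K.edge_inj hs.1 (Set.Ioo_subset_Icc_self ht.1) (hψi e)).2
    have hspeed : ∀ s ∈ S m, |deriv φ s| = arcLength (K.curve k l) / arcLength (K.curve h m) := by
      intro s hs
      have h1 := velocity_comp hr (hh.1 m) (hk.1 l) hs.1 (hmem s hs) (hdiff s hs) (htr s hs).2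
      have h2 := congrArg norm h1
      rw [norm_smul, (hc l).norm_velocity (Set.Ioo_subset_Icc_self hs.1),
        (hc' m).norm_velocity (Set.Ioo_subset_Icc_self (hmem s hs)), Real.norm_eq_abs] at h2
      rw [h2, mul_div_cancel_right₀ _ (hLpos m).ne']
    have harea := lintegral_abs_det_fderiv_eq_addHaar_image volume (hSo m).measurableSet (f := φ)
      (f' := fun s => ContinuousLinearMap.toSpanSingleton ℝ (deriv φ s))
      (fun s hs => (hdiff s hs).hasDerivAt.hasFDerivAt.hasFDerivWithinAt) hinj
    have hle : volume (φ '' S m) ≤ 1 := by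
      have : φ '' S m ⊆ Set.Ioo 0 1 := by
        rintro _ ⟨s, hs, rfl⟩
        exact hmem s hs
      refine (measure_mono this).trans ?_
      simp
    rw [← harea, setLIntegral_congr_fun (hSo m).measurableSet (g := fun _ =>
      ENNReal.ofReal (arcLength (K.curve k l) / arcLength (K.curve h m)))
      (fun s hs => by simp [hspeed s hs]), setLIntegral_const] at hle
    calc ENNReal.ofReal (arcLength (K.curve k l)) * volume (S m)
        = ENNReal.ofReal (arcLength (K.curve h m)) *
          (ENNReal.ofReal (arcLength (K.curve k l) / arcLength (K.curve h m)) * volume (S m)) := by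
          rw [← mul_assoc, ← ENNReal.ofReal_mul (hLpos m).le, mul_div_cancel₀ _ (hLpos m).ne']
      _ ≤ ENNReal.ofReal (arcLength (K.curve h m)) * 1 := by gcongr
      _ = _ := mul_one _
  have hcover : Set.Ioo (0 : ℝ) 1 ⊆
      (Set.Ioo (0 : ℝ) 1 ∩ {s | ∀ m, ψ (K.edge l s) ∉ K.openCell m}) ∪ ⋃ m, S m := by
    intro s hs
    by_cases hex : ∃ m, ψ (K.edge l s) ∈ K.openCell m
    · obtain ⟨m, hm⟩ := hex
      exact Or.inr (Set.mem_iUnion.2 ⟨m, hs, hm⟩)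
    · exact Or.inl ⟨hs, not_exists.1 hex⟩
  have hvol : (1 : ℝ≥0∞) ≤ ∑ m, volume (S m) := by
    calc (1 : ℝ≥0∞) = volume (Set.Ioo (0 : ℝ) 1) := by simp
      _ ≤ volume (Set.Ioo (0 : ℝ) 1 ∩ {s | ∀ m, ψ (K.edge l s) ∉ K.openCell m}) +
          volume (⋃ m, S m) := (measure_mono hcover).trans (measure_union_le _ _)
      _ ≤ 0 + ∑ m, volume (S m) := by
          gcongr
          · exact ((K.finite_transition_vertex hψi l).measure_zero _).le
          · exact measure_iUnion_fintype_le _ _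
      _ = _ := zero_add _
  have hfinal : ENNReal.ofReal (arcLength (K.curve k l)) ≤
      ENNReal.ofReal (∑ m, arcLength (K.curve h m)) := by
    rw [ENNReal.ofReal_sum_of_nonneg fun m _ => (hLpos m).le]
    calc ENNReal.ofReal (arcLength (K.curve k l))
        ≤ ENNReal.ofReal (arcLength (K.curve k l)) * ∑ m, volume (S m) :=
          le_mul_of_one_le_right' hvol
      _ = ∑ m, ENNReal.ofReal (arcLength (K.curve k l)) * volume (S m) := Finset.mul_sum _ _ _
      _ ≤ _ := Finset.sum_le_sum fun m _ => hpart m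
  exact (ENNReal.ofReal_le_ofReal_iff (Finset.sum_nonneg fun m _ => (hLpos m).le)).1 hfinal

end OneDimCW

/-! ### Continuity of the transform on shapes -/

/-- An upper bound for the product of `cellCount M L ε` and `ε` for all lengths `L ≤ B`. It tends to
zero with `ε`. -/
def cellCountBound (M B ε : ℝ) : ℝ :=
  (M ^ 2 * B ^ 3 / 24) ^ (1 / 3 : ℝ) * ε ^ (2 / 3 : ℝ) + (B * M / Real.pi + 2) * ε

theorem cellCount_mul_le {M L B ε : ℝ} (hM : 0 < M) (hL : 0 < L) (hLB : L ≤ B) (hε : 0 < ε) :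
    cellCount M L ε * ε ≤ cellCountBound M B ε := by
  have hB : 0 < B := hL.trans_le hLB
  have h1 : (M ^ 2 * L ^ 3 / (24 * ε)) ^ (1 / 3 : ℝ) ≤
      (M ^ 2 * B ^ 3 / (24 * ε)) ^ (1 / 3 : ℝ) := by
    gcongr
  have h2 : L * M / Real.pi ≤ B * M / Real.pi := by gcongr
  have h3 : 0 ≤ (M ^ 2 * L ^ 3 / (24 * ε)) ^ (1 / 3 : ℝ) := by positivity
  have h4 : 0 ≤ L * M / Real.pi := by positivity
  have hcount : (cellCount M L ε : ℝ) ≤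
      (M ^ 2 * B ^ 3 / (24 * ε)) ^ (1 / 3 : ℝ) + (B * M / Real.pi + 2) := by
    rw [cellCount, Nat.cast_max]
    refine max_le ?_ ?_
    · linarith [(Nat.ceil_lt_add_one h3).le]
    · linarith [(Nat.ceil_lt_add_one h4).le]
  have h5 : (M ^ 2 * B ^ 3 / (24 * ε)) ^ (1 / 3 : ℝ) * ε =
      (M ^ 2 * B ^ 3 / 24) ^ (1 / 3 : ℝ) * ε ^ (2 / 3 : ℝ) := by
    rw [← div_div, Real.div_rpow (by positivity) hε.le, div_mul_eq_mul_div, mul_div_assoc]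
    congr 1
    rw [div_eq_iff (by positivity), ← Real.rpow_add hε]
    norm_num
  calc _ ≤ ((M ^ 2 * B ^ 3 / (24 * ε)) ^ (1 / 3 : ℝ) + (B * M / Real.pi + 2)) * ε := by gcongr
    _ = _ := by rw [add_mul, h5, cellCountBound]

theorem cellBound_le {M L B ε : ℝ} (hM : 0 < M) (hL : 0 < L) (hLB : L ≤ B) (hε : 0 < ε) :
    cellBound M L ε ≤ 8 * √(B * cellCountBound M B ε) + 11 * cellCountBound M B ε := by
  have h1 := cellCount_mul_le hM hL hLB hε
  have h2 : 0 ≤ (cellCount M L ε : ℝ) * ε := by positivity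
  have hB : 0 < B := hL.trans_le hLB
  have h3 : √(L * cellCount M L ε * ε) ≤ √(B * cellCountBound M B ε) := by
    rw [mul_assoc]
    gcongr
  have h4 := Real.sqrt_nonneg (B * cellCountBound M B ε)
  unfold cellBound
  split_ifs <;> linarith

theorem continuous_cellCountBound (M B : ℝ) : Continuous (cellCountBound M B) := by
  have h : Continuous fun ε : ℝ => ε ^ (2 / 3 : ℝ) := Real.continuous_rpow_const (by norm_num)
  unfold cellCountBound
  fun_prop

theorem cellCountBound_zero (M B : ℝ) : cellCountBound M B 0 = 0 := by
  rw [cellCountBound, Real.zero_rpow (by norm_num)]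
  simp

namespace OneDimCW

variable {Z₀ Λ : Type} (K : OneDimCW Z₀ Λ) {d : ℕ} {r : ℕ∞}

/-- Shapes at distance less than `ε` have an `ε`-matching. -/
theorem exists_isMatching_of_shapeDist_lt {X Y : Set (EuclideanSpace ℝ (Fin d))} {ε : ℝ}
    (h : K.shapeDist r X Y < ENNReal.ofReal ε) :
    0 < ε ∧ ∃ hX hY, K.IsMatching r X Y ε hX hY := by
  have hε : 0 < ε := by
    by_contra hcon
    rw [ENNReal.ofReal_of_nonpos (not_lt.1 hcon)] at h
    exact absurd h not_lt_zero
  rw [shapeDist, iInf_lt_iff] at h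
  obtain ⟨ε', h⟩ := h
  rw [iInf_lt_iff] at h
  obtain ⟨⟨hX, hY, h1, h2, h3, h4, h5⟩, hlt⟩ := h
  have hle : (ε' : ℝ) ≤ ε := by
    rw [ENNReal.ofReal, ENNReal.coe_lt_coe] at hlt
    exact (Real.lt_toNNReal_iff_coe_lt.1 hlt).le
  exact ⟨hε, hX, hY, h1, h2, h3, h4, ⟨fun l => (h5.length l).trans hle, h5.speed_left,
    h5.speed_right, fun z => (h5.sup_norm z).trans hle⟩⟩

/-- A constant speed embedding has bounded curvature, by compactness. -/
theorem exists_mapCurvatureBoundedBy [Fintype Λ] (hr : 2 ≤ r)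
    {h : K.Space → EuclideanSpace ℝ (Fin d)} (hh : h ∈ K.smoothEmbeddings r d)
    (hc : ∀ l, HasConstantSpeed (K.curve h l)) : ∃ M, 0 < M ∧ K.MapCurvatureBoundedBy h M := by
  have hb : ∀ l, ∃ C, ∀ t ∈ Set.Icc (0 : ℝ) 1, ‖acceleration (K.curve h l) t‖ ≤ C := fun l =>
    isCompact_Icc.exists_bound_of_continuousOn (continuousOn_acceleration hr (hh.1 l))
  choose C hC using hb
  refine ⟨∑ l, |C l / arcLength (K.curve h l) ^ 2| + 1, ?_, fun l t ht => ⟨?_, ?_⟩⟩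
  · have := Finset.sum_nonneg fun l (_ : l ∈ Finset.univ) =>
      abs_nonneg (C l / arcLength (K.curve h l) ^ 2)
    linarith
  · exact K.velocity_ne_zero_of_constantSpeed hr hh.1 hh.2.injective (hc l) ht
  · rw [curvature_of_constantSpeed hr (hh.1 l) (hc l) ht]
    have h1 : ‖acceleration (K.curve h l) t‖ / arcLength (K.curve h l) ^ 2 ≤
        C l / arcLength (K.curve h l) ^ 2 := by
      gcongr
      exact hC l t ht
    have h2 := Finset.single_le_sum
      (fun m _ => abs_nonneg (C m / arcLength (K.curve h m) ^ 2)) (Finset.mem_univ l)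
    linarith [le_abs_self (C l / arcLength (K.curve h l) ^ 2)]

variable [Fintype Z₀] [Fintype Λ]

/-- The bound of `setECT_bound` tends to zero with `ε`, uniformly in the embeddings with image `X`:
all of those with constant speed have the same curvature bound and a common bound on their
lengths. -/
theorem continuous_setECT (hr : 2 ≤ r) (X : Set (EuclideanSpace ℝ (Fin d))) {η : ℝ≥0∞}
    (hη : 0 < η) : ∃ δ : ℝ≥0∞, 0 < δ ∧ ∀ Y, K.shapeDist r X Y < δ →
      ECTDiffMeasurable (setECT X) (setECT Y) ∧ ectDist (setECT X) (setECT Y) < η := by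
  by_cases hex : ∃ h ∈ K.smoothEmbeddings r d, Set.range h = X ∧
      ∀ l, HasConstantSpeed (K.curve h l)
  swap
  · -- no shape is at finite distance from `X`
    refine ⟨ENNReal.ofReal 1, by simp, fun Y hY => ?_⟩
    obtain ⟨-, hX, hY', hm⟩ := K.exists_isMatching_of_shapeDist_lt hY
    exact absurd ⟨hX, hm.1, hm.2.2.1, hm.2.2.2.2.speed_left⟩ hex
  obtain ⟨h, hh, hX, hc⟩ := hex
  obtain ⟨M, hM, hMh⟩ := K.exists_mapCurvatureBoundedBy hr hh hc
  -- the embedding in a matching varies with `Y`, but its lengths are all at most `B`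
  set B := ∑ l, arcLength (K.curve h l)
  let Q : ℝ → ℝ := fun ε => Fintype.card Z₀ * ε + Fintype.card Λ *
    (8 * √(B * cellCountBound M B ε) + 11 * cellCountBound M B ε)
  have hQ : Continuous Q := by
    have := continuous_cellCountBound M B
    fun_prop
  have hQ0 : Q 0 = 0 := by simp [Q, cellCountBound_zero]
  have hη1 : min η 1 ≠ ⊤ := (min_le_right η 1).trans_lt ENNReal.one_lt_top |>.ne
  have hη' : 0 < (min η 1).toReal := ENNReal.toReal_pos (lt_min hη one_pos).ne' hη1
  have hev : ∀ᶠ ε in nhdsWithin (0 : ℝ) (Set.Ioi 0), Q ε < (min η 1).toReal :=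
    (hQ.tendsto 0).eventually (gt_mem_nhds (hQ0.symm ▸ hη')) |>.filter_mono nhdsWithin_le_nhds
  obtain ⟨ε, hεQ, hε⟩ := (hev.and self_mem_nhdsWithin).exists
  have hε : 0 < ε := hε
  refine ⟨ENNReal.ofReal ε, by simpa using hε, fun Y hY => ?_⟩
  obtain ⟨-, hX', hY', hm⟩ := K.exists_isMatching_of_shapeDist_lt hY
  have hrange : Set.range h = Set.range hX' := hX.trans hm.2.2.1.symm
  have hcurv := K.mapCurvatureBoundedBy_of_range_eq hr hh hm.1 hrange hm.2.2.2.2.speed_left hMh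
  obtain ⟨hmeas, hle⟩ := K.setECT_bound hr hM hε hm hcurv
  refine ⟨hmeas, hle.trans_lt ?_⟩
  refine lt_of_lt_of_le ?_ (min_le_left η 1)
  rw [← ENNReal.ofReal_toReal hη1, ENNReal.ofReal_lt_ofReal_iff hη']
  refine lt_of_le_of_lt ?_ hεQ
  simp only [Q]
  gcongr
  calc ∑ l, cellBound M (arcLength (K.curve hX' l)) ε
      ≤ ∑ _ : Λ, (8 * √(B * cellCountBound M B ε) + 11 * cellCountBound M B ε) := by
        refine Finset.sum_le_sum fun l _ => cellBound_le hM ?_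
          (K.arcLength_le_sum hr hh hm.1 hrange hm.2.2.2.2.speed_left hc l) hε
        have h0I : (0 : ℝ) ∈ Set.Icc (0 : ℝ) 1 := ⟨le_rfl, zero_le_one⟩
        rw [← (hm.2.2.2.2.speed_left l).norm_velocity h0I]
        exact norm_pos_iff.2 (hcurv l 0 h0I).1
    _ = _ := by rw [Finset.sum_const, Finset.card_univ, nsmul_eq_mul]

end OneDimCW

end

theorem theorem3p2 {Z₀ Λ : Type} [Fintype Z₀] [Fintype Λ] (K : OneDimCW Z₀ Λ) (d : ℕ)
    (r : ℕ∞) (hr : 2 ≤ r) :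
    -- continuity of `X ↦ ECT_X`
    (∀ X ∈ K.shapes r d, ∀ η : ℝ≥0∞, 0 < η → ∃ δ : ℝ≥0∞, 0 < δ ∧
      ∀ Y ∈ K.shapes r d, K.shapeDist r X Y < δ →
        ECTDiffMeasurable (setECT X) (setECT Y) ∧ ectDist (setECT X) (setECT Y) < η) ∧
    -- the quantitative bound for embedded shapes
    (∀ X ∈ K.shapes r d, ∀ Y ∈ K.shapes r d, ∀ M ε : ℝ, 0 < M →
      K.ShapeCurvatureBoundedBy r X M → K.shapeDist r X Y < ENNReal.ofReal ε →
        (∃ hX hY, K.IsMatching r X Y ε hX hY) ∧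
        ∀ hX hY, K.IsMatching r X Y ε hX hY →
          ECTDiffMeasurable (setECT X) (setECT Y) ∧
          ectDist (setECT X) (setECT Y) ≤ ENNReal.ofReal
            (Fintype.card Z₀ * ε + ∑ l, cellBound M (arcLength (K.curve hX l)) ε)) ∧
    -- the functional version
    (∀ f ∈ K.smoothMaps r d, ∀ g ∈ K.smoothMaps r d, ∀ M ε : ℝ, 0 < M → 0 < ε →
      K.Close f g ε → K.MapCurvatureBoundedBy f M →
        ECTDiffMeasurable (mapECT f) (mapECT g) ∧
        ectDist (mapECT f) (mapECT g) ≤ ENNReal.ofReal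
          (Fintype.card Z₀ * ε + ∑ l, cellBound M (arcLength (K.curve f l)) ε)) := by
  refine ⟨fun X _ η hη => ?_, fun X _ Y _ M ε hM hcurv hdist => ?_, ?_⟩
  · obtain ⟨δ, hδ, h⟩ := K.continuous_setECT hr X hη
    exact ⟨δ, hδ, fun Y _ => h Y⟩
  · obtain ⟨hε, hmatch⟩ := K.exists_isMatching_of_shapeDist_lt hdist
    refine ⟨hmatch, fun hX hY hm => K.setECT_bound hr hM hε hm ?_⟩
    obtain ⟨h, hh, hhX, hMh⟩ := hcurv
    exact K.mapCurvatureBoundedBy_of_range_eq hr hh hm.1 (hhX.trans hm.2.2.1.symm)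
      hm.2.2.2.2.speed_left hMh
  · exact fun f hf g hg M ε hM hε h hcurv => K.mapECT_bound hr hf hg hM hε h hcurv
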